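/- Let $F(s,t)=\mathrm{sech}((t-s)/2)$ and, for $\alpha>-1$ and a standard Brownian motion $W$ on $[0,\infty)$, consider the process $$Y^{(\alpha)}_t=\frac{\int_0^\infty g_t(r)\,dW_r}{\big(\int_0^\infty g_t(r)^2\,dr\big)^{1/2}},\qquad g_t(r)=r^{\alpha/2}\exp(-e^{-t}r),\quad t\in\mathbb R,$$ the numerator being a Wiener integral. For each $\alpha>-1$, $Y^{(\alpha)}$ has a version all of whose sample paths are in $C^\infty(\mathbb R)$, and it is a centered stationary Gaussian process with covariance function $F(s,t)^{\alpha+1}$. Taking a version with (almost surely) continuous paths, the persistence exponent $$b_\alpha:=-\lim_{T\to\infty}\frac1T\log\mathbb P\Big(\sup_{t\in[0,T]}Y^{(\alpha)}_t\le\delta_T\Big)$$ exists, is finite, and is the same for every choice of $\delta_T\to0$. The function $\alpha\mapsto(\alpha+1)^{-1}b_\alpha$ is non-increasing on $(-1,\infty)$ and increases to $1/2$ as $\alpha\downarrow-1$; the function $\alpha\mapsto(\alpha+1)^{-1/2}b_\alpha$ is non-decreasing on $(-1,\infty)$ and increases to $\widehat b_\infty$ as $\alpha\uparrow\infty$. Here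 $\widehat b_\infty<\infty$ is the persistence exponent, defined in the same way (and likewise the same for every $\delta_T\to0$), of the centered stationary Gaussian process $\{\widehat Z_t\}_{t\ge0}$ with continuous paths and covariance function $\exp\{-(t-s)^2/8\}$; such a process exists. -/

import Mathlib

open MeasureTheory ProbabilityTheory Filter Set
open scoped NNReal Topology

universe u

noncomputable section

/-- A step function `∑ i, c i * 1_{(lo i, hi i]}` on the half-line. -/
structure StepFunction where
  /-- number of steps -/
  n : ℕ
  /-- left end points -/
  lo : Fin n → ℝ≥0
  /-- right end points -/
  hi : Fin n → ℝ≥0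
  lo_le_hi : ∀ i, lo i ≤ hi i
  /-- heights -/
  c : Fin n → ℝ

namespace StepFunction

/-- The step function as a function of a real variable. -/
def eval (φ : StepFunction) (r : ℝ) : ℝ :=
  ∑ i, φ.c i * (Ioc (φ.lo i : ℝ) (φ.hi i : ℝ)).indicator (fun _ => (1 : ℝ)) r

/-- The elementary integral `∑ i, c i * (W_{hi i} - W_{lo i})`. -/
def wienerSum {Ω : Type u} (φ : StepFunction) (W : ℝ≥0 → Ω → ℝ) (ω : Ω) : ℝ :=
  ∑ i, φ.c i * (W (φ.hi i) ω - W (φ.lo i) ω)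

end StepFunction

/-- `X` is (a version of) the Wiener integral `∫_0^∞ g(r) dW_r` of the deterministic function
`g ∈ L²(0, ∞)`: the `L²(P)`-limit of the elementary integrals of step functions that converge
to `g` in `L²(0, ∞)`. -/
def IsWienerIntegral {Ω : Type u} [MeasurableSpace Ω] (W : ℝ≥0 → Ω → ℝ) (P : Measure Ω)
    (g : ℝ → ℝ) (X : Ω → ℝ) : Prop :=
  MemLp g 2 (volume.restrict (Ioi (0 : ℝ))) ∧ MemLp X 2 P ∧
    ∃ φ : ℕ → StepFunction,
      Tendsto (fun n => eLpNorm (fun r => g r - (φ n).eval r) 2 (volume.restrict (Ioi (0 : ℝ))))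
        atTop (𝓝 0) ∧
      Tendsto (fun n => eLpNorm (fun ω => X ω - (φ n).wienerSum W ω) 2 P) atTop (𝓝 0)

/-- `g_t(r) = r^{α/2} exp(-e^{-t} r)`. -/
def gKernel (α t r : ℝ) : ℝ := r ^ (α / 2) * Real.exp (-(Real.exp (-t)) * r)

/-- `Y` is a version of the normalized Wiener integral process
`Y_t = (∫_0^∞ g_t(r) dW_r) / (∫_0^∞ g_t(r)² dr)^{1/2}`, `t ∈ ℝ`. -/
def IsNormalizedWienerProcess {Ω : Type u} [MeasurableSpace Ω] (W : ℝ≥0 → Ω → ℝ) (P : Measure Ω)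
    (α : ℝ) (Y : ℝ → Ω → ℝ) : Prop :=
  ∀ t, ∃ X : Ω → ℝ, IsWienerIntegral W P (gKernel α t) X ∧
    Y t =ᵐ[P] fun ω => X ω / √(∫ r in Ioi (0 : ℝ), gKernel α t r ^ 2)

/-- `X` is a centered stationary Gaussian process under `P`, with covariance function `C`. -/
structure IsStationaryGaussian {Ω : Type u} [MeasurableSpace Ω] {I : Type} [Add I]
    (X : I → Ω → ℝ) (P : Measure Ω) (C : I → I → ℝ) : Prop where
  gaussian : IsGaussianProcess X P
  centered : ∀ t, ∫ ω, X t ω ∂P = 0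
  cov_eq : ∀ s t, cov[X s, X t; P] = C s t
  stationary : ∀ (h : I) (J : Finset I),
    P.map (fun ω (t : J) => X (t + h) ω) = P.map (fun ω (t : J) => X t ω)

/-- `F(s,t) = sech((t-s)/2)`. -/
def sechCov (s t : ℝ) : ℝ := 1 / Real.cosh ((t - s) / 2)

/-- The event `{sup_{t ∈ [0,T]} X_t ≤ x}`. -/
def stayBelow {Ω : Type u} (X : ℝ≥0 → Ω → ℝ) (T x : ℝ) : Set Ω :=
  {ω | ∀ t : ℝ≥0, (t : ℝ) ≤ T → X t ω ≤ x}

/-- `b` is the persistence exponent of `X`: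
`-(1/T) log P(sup_{t ∈ [0,T]} X_t ≤ δ_T) → b` as `T → ∞`, for every choice of `δ_T → 0`.
(Positivity of the probabilities makes the logarithms genuine.) -/
def IsPersistenceExponent {Ω : Type u} [MeasurableSpace Ω] (P : Measure Ω) (X : ℝ≥0 → Ω → ℝ)
    (b : ℝ) : Prop :=
  ∀ δ : ℝ → ℝ, Tendsto δ atTop (𝓝 0) →
    (∀ᶠ T in atTop, 0 < P.real (stayBelow X T (δ T))) ∧
    Tendsto (fun T : ℝ => -(1 / T * Real.log (P.real (stayBelow X T (δ T))))) atTop (𝓝 b)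

end

/-! For a stationary Gaussian process with continuous paths, the probability of staying below `x` on
`[0,T]` is the infimum of orthant probabilities over finite sets of times (`real_stayBelow`), hence
a functional `persist C T x` of the covariance alone. Slepian's inequality (`orth_le_orth_of_le`)
says that it grows when correlations grow at fixed variance. For nonnegative correlations this makes
`persist C · 0` supermultiplicative, so Fekete's lemma yields the exponent `expo C`. Shifting the
Gaussian measure along a direction of energy `O(T)` and applying Hölder (`exists_level_bound`) shows
that levels `δ_T → 0` do not change it.

The process `Y^{(α)}` has covariance `sech^p` of half the time lag, with `p = α + 1`. Multiplying an
exponent by `1/c` amounts to rescaling time by `c`, so the two monotonicity claims reduce to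
pointwise monotonicity in `p` of `sechPow p (τ / p)` and `sechPow p (τ / √p)`. These follow from
`log cosh (c x) ≤ c log cosh x` and `c² log cosh x ≤ log cosh (c x)` for `0 < c ≤ 1`. As `p ↓ 0` the
first kernel decreases to the Ornstein–Uhlenbeck covariance `exp (-|τ|/2)`, and as `p ↑ ∞` the
second decreases to `exp (-τ²/8)`.

Convergence of the exponents needs one inequality beyond Slepian, the lower semicontinuity
`eventually_sub_le_expo`. Finitely many times in one long block nearly realize the limiting
exponent; the process on many separated copies of this block is dominated, in Slepian's sense, by
independent blocks plus a weak common noise, and that noise is controlled by a Chernoff bound. The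
value `1/2` for Ornstein–Uhlenbeck comes from Gaussian random walks: the mean of the walk on the
event that it has stayed nonnegative is conserved up to the overshoot, while the walk itself is of
order `exp (T/2)` (`expo_ouCov`).

The processes are realized as follows. Wiener integrals are `L²` limits of Gaussian sums, which
gives laws and covariances. The addition formula for `cosh` expands the `sech^p` kernel in powers of
`tanh (s/2) tanh (t/2)`; transferring this Gram expansion to `L²(P)` writes `Y^{(α)}` as a random
power series on the given probability space, hence with smooth paths. A similar series with
independent coefficients gives the Gaussian kernel. -/

/-! ### Centered Gaussian vectors and their orthant probabilities -/

/-- `X` is a centered Gaussian vector under `P` with covariance matrix `S`. -/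
structure CenteredGaussian {Ω ι : Type*} [MeasurableSpace Ω] (X : ι → Ω → ℝ) (P : Measure Ω)
    (S : Matrix ι ι ℝ) : Prop where
  gaussian : HasGaussianLaw (fun ω i => X i ω) P
  centered : ∀ i, ∫ ω, X i ω ∂P = 0
  cov : ∀ i j, ∫ ω, X i ω * X j ω ∂P = S i j

open scoped Classical in
/-- The centered Gaussian measure on `ι → ℝ` with covariance matrix `S`. -/
noncomputable def gaussN {ι : Type*} [Fintype ι] (S : Matrix ι ι ℝ) : Measure (ι → ℝ) :=
  (multivariateGaussian 0 S).map WithLp.ofLp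

/-- The probability that the centered Gaussian vector with covariance `S` is at most `u`. -/
noncomputable def orth {ι : Type*} [Fintype ι] (S : Matrix ι ι ℝ) (u : ι → ℝ) : ℝ :=
  (gaussN S).real {x | ∀ i, x i ≤ u i}

instance {ι : Type*} [Fintype ι] (S : Matrix ι ι ℝ) : IsProbabilityMeasure (gaussN S) := by
  classical
  unfold gaussN
  exact Measure.isProbabilityMeasure_map (by fun_prop)

namespace CenteredGaussian

variable {Ω Ω' ι κ : Type*} [MeasurableSpace Ω] [MeasurableSpace Ω'] {P : Measure Ω}
  {P' : Measure Ω'} {X : ι → Ω → ℝ} {Y : ι → Ω' → ℝ} {S S' : Matrix ι ι ℝ}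

lemma memLp [Fintype ι] (h : CenteredGaussian X P S) (i : ι) : MemLp (X i) 2 P :=
  (h.gaussian.eval i).memLp_two

lemma isProbabilityMeasure [Fintype ι] (h : CenteredGaussian X P S) : IsProbabilityMeasure P :=
  h.gaussian.isProbabilityMeasure

lemma aemeasurable [Fintype ι] (h : CenteredGaussian X P S) (i : ι) : AEMeasurable (X i) P :=
  (h.gaussian.eval i).aemeasurable

lemma covariance_eq [Fintype ι] (h : CenteredGaussian X P S) (i j : ι) :
    cov[X i, X j; P] = S i j := by
  have := h.isProbabilityMeasure
  rw [covariance_eq_sub (h.memLp i) (h.memLp j), h.centered, h.centered]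
  simpa using h.cov i j

lemma integrable_mul [Fintype ι] (h : CenteredGaussian X P S) (i j : ι) :
    Integrable (fun ω => X i ω * X j ω) P :=
  (h.memLp i).integrable_mul (h.memLp j)

lemma integral_sq_sum [Fintype ι] (h : CenteredGaussian X P S) (w : ι → ℝ) :
    ∫ ω, (∑ i, w i * X i ω) ^ 2 ∂P = w ⬝ᵥ S.mulVec w := by
  have : ∀ ω, (∑ i, w i * X i ω) ^ 2 = ∑ i, ∑ j, w i * w j * (X i ω * X j ω) := by
    intro ω
    rw [sq, Finset.sum_mul_sum]
    refine Finset.sum_congr rfl fun i _ => Finset.sum_congr rfl fun j _ => by ring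
  simp_rw [this]
  rw [integral_finsetSum _ fun i _ => integrable_finsetSum _ fun j _ =>
    (h.integrable_mul i j).const_mul _]
  simp_rw [dotProduct, Matrix.mulVec, dotProduct]
  refine Finset.sum_congr rfl fun i _ => ?_
  rw [integral_finsetSum _ fun j _ => (h.integrable_mul i j).const_mul _, Finset.mul_sum]
  refine Finset.sum_congr rfl fun j _ => ?_
  rw [integral_const_mul, h.cov]; ring

lemma posSemidef [Fintype ι] (h : CenteredGaussian X P S) : S.PosSemidef := by
  refine Matrix.PosSemidef.of_dotProduct_mulVec_nonneg ?_ fun x => ?_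
  · ext i j
    simp only [Matrix.conjTranspose_apply, star_trivial]
    rw [← h.cov, ← h.cov]
    simp_rw [mul_comm]
  · rw [star_trivial, ← h.integral_sq_sum x]
    exact integral_nonneg fun ω => sq_nonneg _

/-- A Gaussian measure is determined by its mean and covariance form. Orthant probabilities can
therefore be computed in whichever realization of `S` is most convenient. -/
lemma map_eq [Fintype ι] (h : CenteredGaussian X P S) : P.map (fun ω i => X i ω) = gaussN S := by
  classical
  have hP := h.isProbabilityMeasure
  have key : P.map (fun ω => WithLp.toLp 2 fun i => X i ω) = multivariateGaussian 0 S := by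
    have := (h.gaussian.toLp_pi 2).isGaussian_map
    apply IsGaussian.ext
    · rw [integral_id_multivariateGaussian', integral_map]
      · ext i
        have := ContinuousLinearMap.integral_comp_comm
          (EuclideanSpace.proj i : EuclideanSpace ℝ ι →L[ℝ] ℝ)
          (h.gaussian.toLp_pi 2).integrable
        simp only [id_eq]
        simpa [h.centered] using this.symm
      · exact (h.gaussian.toLp_pi 2).aemeasurable
      · exact aestronglyMeasurable_id
    · ext x y
      rw [covarianceBilin_apply_pi h.memLp, covarianceBilin_multivariateGaussian h.posSemidef]
      simp_rw [h.covariance_eq, dotProduct, Matrix.mulVec, dotProduct, Finset.mul_sum]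
      refine Finset.sum_congr rfl fun i _ => Finset.sum_congr rfl fun j _ => by ring
  rw [gaussN]
  have h2 := congrArg (Measure.map WithLp.ofLp) key
  rw [AEMeasurable.map_map_of_aemeasurable (by fun_prop)
    (h.gaussian.toLp_pi 2).aemeasurable] at h2
  exact h2

lemma real_preimage [Fintype ι] (h : CenteredGaussian X P S) {A : Set (ι → ℝ)}
    (hA : MeasurableSet A) : P.real {ω | (fun i => X i ω) ∈ A} = (gaussN S).real A := by
  rw [← h.map_eq, map_measureReal_apply_of_aemeasurable h.gaussian.aemeasurable hA]
  rfl

lemma real_le [Fintype ι] (h : CenteredGaussian X P S) (u : ι → ℝ) :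
    P.real {ω | ∀ i, X i ω ≤ u i} = orth S u := by
  refine h.real_preimage (A := {x | ∀ i, x i ≤ u i}) ?_
  rw [ofPred_forall]
  exact MeasurableSet.iInter fun i => measurableSet_le (by fun_prop) (by fun_prop)

lemma of_gaussN [Fintype ι] (hS : S.PosSemidef) :
    CenteredGaussian (fun i (x : ι → ℝ) => x i) (gaussN S) S := by
  classical
  have hg : HasGaussianLaw (fun (x : ι → ℝ) i => x i) (gaussN S) := by
    have : IsGaussian (gaussN S) := by
      unfold gaussN
      have : (WithLp.ofLp : EuclideanSpace ℝ ι → ι → ℝ) = EuclideanSpace.equiv ι ℝ := rfl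
      rw [this]
      infer_instance
    exact IsGaussian.hasGaussianLaw_id
  have h0 : ∀ i, ∫ x : ι → ℝ, x i ∂(gaussN S) = 0 := by
    intro i
    rw [gaussN, integral_map (by fun_prop) (Measurable.aestronglyMeasurable (by fun_prop))]
    have := ContinuousLinearMap.integral_comp_comm
          (EuclideanSpace.proj i : EuclideanSpace ℝ ι →L[ℝ] ℝ)
          (IsGaussian.integrable_id (μ := multivariateGaussian 0 S))
    simpa using this
  refine ⟨hg, h0, fun i j => ?_⟩
  have h1 := covariance_eval_multivariateGaussian (μ := 0) hS i j
  have h2 : cov[fun x : ι → ℝ => x i, fun x => x j; gaussN S] = S i j := by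
    rw [gaussN, covariance_map_fun (Measurable.aestronglyMeasurable (by fun_prop))
      (Measurable.aestronglyMeasurable (by fun_prop)) (by fun_prop)]
    exact h1
  rw [covariance_eq_sub (hg.eval i).memLp_two (hg.eval j).memLp_two, h0, h0] at h2
  simpa using h2

lemma linear [Fintype ι] [Fintype κ] (h : CenteredGaussian X P S) (A : Matrix κ ι ℝ) :
    CenteredGaussian (fun k ω => ∑ i, A k i * X i ω) P (A * S * A.transpose) := by
  classical
  have hP := h.isProbabilityMeasure
  refine ⟨?_, fun k => ?_, fun k l => ?_⟩
  · have := h.gaussian.map_fun (Matrix.toLin' A).toContinuousLinearMap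
    refine this.congr (ae_of_all _ fun ω => ?_)
    ext k
    simp [Matrix.mulVec, dotProduct]
  · rw [integral_finsetSum _ fun i _ => ((h.memLp i).integrable (by norm_num)).const_mul _]
    simp_rw [integral_const_mul, h.centered]; simp
  · have : ∀ ω, (∑ i, A k i * X i ω) * (∑ j, A l j * X j ω)
        = ∑ i, ∑ j, A k i * A l j * (X i ω * X j ω) := by
      intro ω
      rw [Finset.sum_mul_sum]
      refine Finset.sum_congr rfl fun i _ => Finset.sum_congr rfl fun j _ => by ring
    simp_rw [this]
    rw [integral_finsetSum _ fun i _ => integrable_finsetSum _ fun j _ =>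
      (h.integrable_mul i j).const_mul _]
    simp_rw [Matrix.mul_apply, Matrix.transpose_apply, Finset.sum_mul]
    rw [Finset.sum_comm]
    refine Finset.sum_congr rfl fun i _ => ?_
    rw [integral_finsetSum _ fun j _ => (h.integrable_mul _ j).const_mul _]
    refine Finset.sum_congr rfl fun j _ => ?_
    rw [integral_const_mul, h.cov]; ring

lemma comp [Fintype ι] [Fintype κ] (h : CenteredGaussian X P S) (e : κ → ι) :
    CenteredGaussian (fun k => X (e k)) P (S.submatrix e e) := by
  refine ⟨?_, fun k => h.centered _, fun k l => h.cov _ _⟩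
  exact h.gaussian.map_fun (ContinuousLinearMap.pi fun k =>
    ContinuousLinearMap.proj (R := ℝ) (φ := fun _ : ι => ℝ) (e k))

lemma const_mul [Fintype ι] (h : CenteredGaussian X P S) (c : ℝ) :
    CenteredGaussian (fun i ω => c * X i ω) P (c ^ 2 • S) := by
  refine ⟨h.gaussian.fun_smul c, fun k => ?_, fun k l => ?_⟩
  · rw [integral_const_mul, h.centered, mul_zero]
  · have : ∀ ω, c * X k ω * (c * X l ω) = c ^ 2 * (X k ω * X l ω) := fun ω => by ring
    simp_rw [this, integral_const_mul, h.cov]; simp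

lemma add_prod [Fintype ι] (h : CenteredGaussian X P S) (h' : CenteredGaussian Y P' S') :
    CenteredGaussian (fun i (ω : Ω × Ω') => X i ω.1 + Y i ω.2) (P.prod P') (S + S') := by
  have := h.isProbabilityMeasure
  have := h'.isProbabilityMeasure
  have hX : HasGaussianLaw (fun (ω : Ω × Ω') i => X i ω.1) (P.prod P') := by
    constructor
    have := h.gaussian.isGaussian_map
    have e := (measurePreserving_fst (μ := P) (ν := P')).map_eq
    rw [show (fun (ω : Ω × Ω') i => X i ω.1) = (fun ω i => X i ω) ∘ Prod.fst from rfl,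
      ← AEMeasurable.map_map_of_aemeasurable (by rw [e]; exact h.gaussian.aemeasurable)
        (by fun_prop), e]
    exact this
  have hY : HasGaussianLaw (fun (ω : Ω × Ω') i => Y i ω.2) (P.prod P') := by
    constructor
    have := h'.gaussian.isGaussian_map
    have e := (measurePreserving_snd (μ := P) (ν := P')).map_eq
    rw [show (fun (ω : Ω × Ω') i => Y i ω.2) = (fun ω i => Y i ω) ∘ Prod.snd from rfl,
      ← AEMeasurable.map_map_of_aemeasurable (by rw [e]; exact h'.gaussian.aemeasurable)
        (by fun_prop), e]
    exact this
  have hI : IndepFun (fun (ω : Ω × Ω') i => X i ω.1) (fun (ω : Ω × Ω') i => Y i ω.2)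
      (P.prod P') :=
    indepFun_prod₀ (X := fun ω i => X i ω) (Y := fun ω i => Y i ω) h.gaussian.aemeasurable
      h'.gaussian.aemeasurable
  have i1 : ∀ i, Integrable (X i) P := fun i => (h.memLp i).integrable (by norm_num)
  have i2 : ∀ i, Integrable (Y i) P' := fun i => (h'.memLp i).integrable (by norm_num)
  refine ⟨(IndepFun.hasGaussianLaw hX hY hI).fun_add, fun i => ?_, fun i j => ?_⟩
  · rw [integral_add ((i1 i).comp_fst P') ((i2 i).comp_snd P), integral_fun_fst, integral_fun_snd,
      h.centered, h'.centered]
    simp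
  · have : ∀ ω : Ω × Ω', (X i ω.1 + Y i ω.2) * (X j ω.1 + Y j ω.2)
      = X i ω.1 * X j ω.1 + Y i ω.2 * Y j ω.2 + X i ω.1 * Y j ω.2 + X j ω.1 * Y i ω.2 :=
      fun ω => by ring
    simp_rw [this]
    have a1 := (h.integrable_mul i j).comp_fst P'
    have a2 := (h'.integrable_mul i j).comp_snd P
    have a3 := (i1 i).mul_prod (i2 j)
    have a4 := (i1 j).mul_prod (i2 i)
    refine (integral_add ((a1.add a2).add a3) a4).trans ?_
    rw [integral_add' (a1.add a2) a3, integral_add' a1 a2, integral_prod_mul, integral_prod_mul,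
      integral_fun_fst (fun ω => X i ω * X j ω),
      integral_fun_snd (fun ω => Y i ω * Y j ω), h.cov, h'.cov, h.centered, h.centered]
    simp

end CenteredGaussian

/-! ### Elementary properties of orthant probabilities -/

section Orthant

variable {ι κ : Type*} [Fintype ι] [Fintype κ] {S S' R : Matrix ι ι ℝ} {u v : ι → ℝ}

lemma measurableSet_forall_le {α : Type*} [MeasurableSpace α] {f : ι → α → ℝ} (u : ι → ℝ)
    (hf : ∀ i, Measurable (f i)) : MeasurableSet {x | ∀ i, f i x ≤ u i} := by
  rw [ofPred_forall]
  exact MeasurableSet.iInter fun i => measurableSet_le (hf i) measurable_const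

lemma orth_nonneg (S : Matrix ι ι ℝ) (u : ι → ℝ) : 0 ≤ orth S u := measureReal_nonneg

lemma orth_le_one (S : Matrix ι ι ℝ) (u : ι → ℝ) : orth S u ≤ 1 := measureReal_le_one

lemma orth_mono (S : Matrix ι ι ℝ) (huv : u ≤ v) : orth S u ≤ orth S v :=
  measureReal_mono fun _ hx i => (hx i).trans (huv i)

lemma orth_submatrix (hS : S.PosSemidef) (e : κ → ι) (v : κ → ℝ) :
    orth (S.submatrix e e) v = (gaussN S).real {x | ∀ k, x (e k) ≤ v k} :=
  (((CenteredGaussian.of_gaussN hS).comp e).real_le v).symm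

lemma orth_le_orth_submatrix (hS : S.PosSemidef) (e : κ → ι) (u : ι → ℝ) :
    orth S u ≤ orth (S.submatrix e e) (fun k => u (e k)) := by
  rw [orth_submatrix hS]
  exact measureReal_mono fun x hx k => hx (e k)

lemma orth_submatrix_of_surjective (hS : S.PosSemidef) {e : κ → ι} (he : e.Surjective)
    (u : ι → ℝ) : orth (S.submatrix e e) (fun k => u (e k)) = orth S u := by
  rw [orth_submatrix hS]
  unfold orth
  congr 1
  ext x
  exact (he.forall (p := fun i => x i ≤ u i)).symm

/-- Right continuity in the level: the closed orthant is a decreasing intersection of slightly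
larger ones. No density is involved, so degenerate `S` is allowed. -/
lemma le_orth_of_forall_pos {a : ℝ} (h : ∀ ε > 0, a ≤ orth S (fun i => u i + ε)) :
    a ≤ orth S u := by
  have hlim : Tendsto (fun n : ℕ => orth S (fun i => u i + 1 / (n + 1 : ℝ))) atTop
      (𝓝 (orth S u)) := by
    have hset : {x : ι → ℝ | ∀ i, x i ≤ u i} =
        ⋂ n : ℕ, {x | ∀ i, x i ≤ u i + 1 / (n + 1 : ℝ)} := by
      ext x
      simp only [mem_iInter]
      constructor
      · intro hx n i
        have : (0 : ℝ) < 1 / (n + 1 : ℝ) := by positivity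
        linarith [hx i]
      · intro hx i
        refine le_of_forall_pos_le_add fun ε hε => ?_
        obtain ⟨n, hn⟩ := exists_nat_one_div_lt hε
        linarith [hx n i]
    unfold orth
    rw [hset]
    refine (ENNReal.tendsto_toReal (measure_ne_top _ _)).comp
      (tendsto_measure_iInter_atTop (fun n => (measurableSet_forall_le _
        fun i => measurable_pi_apply i).nullMeasurableSet) ?_ ⟨0, measure_ne_top _ _⟩)
    intro m n hmn x hx i
    refine (hx i).trans ?_
    have : (1 : ℝ) / (n + 1) ≤ 1 / (m + 1) := by
      apply one_div_le_one_div_of_le (by positivity)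
      have : (m : ℝ) ≤ n := by exact_mod_cast hmn
      linarith
    linarith
  exact ge_of_tendsto' hlim fun n => h _ (by positivity)

lemma CenteredGaussian.mul_gaussianReal (a : ι → ℝ) :
    CenteredGaussian (fun i (g : ℝ) => a i * g) (gaussianReal 0 1) (Matrix.vecMulVec a a) := by
  refine ⟨?_, fun i => ?_, fun i j => ?_⟩
  · exact (IsGaussian.hasGaussianLaw_id (μ := gaussianReal 0 1)).map_fun
      (ContinuousLinearMap.pi fun i => a i • ContinuousLinearMap.id ℝ ℝ)
  · rw [integral_const_mul]
    simp [integral_id_gaussianReal]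
  · have : ∀ g : ℝ, a i * g * (a j * g) = a i * a j * g ^ 2 := fun g => by ring
    simp_rw [this, integral_const_mul, Matrix.vecMulVec_apply]
    have h2 : ∫ g, g ^ 2 ∂gaussianReal 0 1 = 1 := by
      have := variance_id_gaussianReal (μ := 0) (v := 1)
      rw [variance_eq_integral (by fun_prop)] at this
      simpa [integral_id_gaussianReal] using this
    rw [h2, mul_one]

/-- A rank-one summand of the covariance is an independent scalar Gaussian added along `a`. Both
Slepian's inequality and the change of level work on this scalar alone, the rest of the vector being
frozen. -/
lemma orth_add_vecMulVec (hR : R.PosSemidef) (a : ι → ℝ) (u : ι → ℝ) :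
    orth (R + Matrix.vecMulVec a a) u =
      ((gaussN R).prod (gaussianReal 0 1)).real {p | ∀ i, p.1 i + a i * p.2 ≤ u i} :=
  (((CenteredGaussian.of_gaussN hR).add_prod
    (CenteredGaussian.mul_gaussianReal a)).real_le u).symm

end Orthant

/-! ### Slepian's inequality -/

section Slepian

variable {ι : Type*} [Fintype ι] {S S' R : Matrix ι ι ℝ}

lemma gaussianReal_neg_preimage (A : Set ℝ) :
    gaussianReal 0 1 {g | -g ∈ A} = gaussianReal 0 1 A := by
  have := (MeasurableEquiv.neg ℝ).map_apply (μ := gaussianReal 0 1) A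
  have h2 : (gaussianReal 0 1).map (MeasurableEquiv.neg ℝ) = gaussianReal 0 1 := by
    have := gaussianReal_map_neg (μ := 0) (v := 1)
    simpa using this
  rw [h2] at this
  exact this.symm

/-- The one-dimensional core of Slepian's inequality: two constraints are easier to satisfy with the
same `g` than with `g` and `-g`. If `a ≤ b` this is an inclusion, otherwise it is one after
reflecting `g`. `Q` stands for the constraints that do not involve `g`. -/
lemma gaussianReal_orthant_le (a b : ℝ) (Q : Prop) :
    gaussianReal 0 1 {g | Q ∧ g ≤ a ∧ -g ≤ b} ≤ gaussianReal 0 1 {g | Q ∧ g ≤ a ∧ g ≤ b} := by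
  by_cases hab : a ≤ b
  · exact measure_mono fun g hg => ⟨hg.1, hg.2.1, hg.2.1.trans hab⟩
  · rw [← gaussianReal_neg_preimage {g | Q ∧ g ≤ a ∧ -g ≤ b}]
    refine measure_mono fun g hg => ⟨hg.1, ?_, ?_⟩
    · have := hg.2.2
      simp only [neg_neg] at this
      linarith
    · simpa using hg.2.2

/-- The vector with entries `1` and `σ` at the two points of `p`. -/
noncomputable def pairVec [DecidableEq ι] (σ : ℝ) (p : ι × ι) : ι → ℝ :=
  Pi.single p.1 1 + σ • Pi.single p.2 1

lemma posSemidef_vecMulVec_self (a : ι → ℝ) : (Matrix.vecMulVec a a).PosSemidef := by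
  simpa using Matrix.posSemidef_vecMulVec_self_star a

/-- With the `R`-part fixed, only the coordinates `p.1` and `p.2` see the extra noise, with equal or
opposite signs. Both choices of sign add the same variances; only the covariance of the two
coordinates differs. -/
lemma orth_add_pair_le [DecidableEq ι] (hR : R.PosSemidef) {c : ℝ} (hc : 0 ≤ c) {p : ι × ι}
    (hp : p.1 ≠ p.2) (u : ι → ℝ) :
    orth (R + c • Matrix.vecMulVec (pairVec (-1) p) (pairVec (-1) p)) u ≤
      orth (R + c • Matrix.vecMulVec (pairVec 1 p) (pairVec 1 p)) u := by
  have e : ∀ σ, c • Matrix.vecMulVec (pairVec σ p) (pairVec σ p) =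
      Matrix.vecMulVec (fun i => √c * pairVec σ p i) (fun i => √c * pairVec σ p i) := by
    intro σ
    ext i j
    simp only [Matrix.smul_apply, Matrix.vecMulVec_apply, smul_eq_mul]
    rw [mul_mul_mul_comm, Real.mul_self_sqrt hc]
  rw [e, e, orth_add_vecMulVec hR, orth_add_vecMulVec hR]
  rcases hc.eq_or_lt with rfl | hc
  · simp
  have hm : ∀ σ, MeasurableSet {q : (ι → ℝ) × ℝ | ∀ i, q.1 i + √c * pairVec σ p i * q.2 ≤ u i} :=
    fun σ => measurableSet_forall_le _ fun i => by fun_prop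
  refine ENNReal.toReal_mono (measure_ne_top _ _) ?_
  rw [Measure.prod_apply (hm _), Measure.prod_apply (hm _)]
  refine lintegral_mono fun x => ?_
  have hs : 0 < √c := Real.sqrt_pos.2 hc
  have key : ∀ σ, Prod.mk x ⁻¹' {q : (ι → ℝ) × ℝ | ∀ i, q.1 i + √c * pairVec σ p i * q.2 ≤ u i} =
      {g | (∀ i, i ≠ p.1 → i ≠ p.2 → x i ≤ u i) ∧ g ≤ (u p.1 - x p.1) / √c ∧
        σ * g ≤ (u p.2 - x p.2) / √c} := by
    intro σ
    ext g
    have h1 : g ≤ (u p.1 - x p.1) / √c ↔ x p.1 + √c * pairVec σ p p.1 * g ≤ u p.1 := by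
      rw [le_div_iff₀ hs]
      simp only [pairVec, Pi.add_apply, Pi.single_eq_same, Pi.smul_apply,
        Pi.single_eq_of_ne hp, smul_zero, add_zero]
      constructor <;> intro h <;> linarith
    have h2 : σ * g ≤ (u p.2 - x p.2) / √c ↔ x p.2 + √c * pairVec σ p p.2 * g ≤ u p.2 := by
      rw [le_div_iff₀ hs]
      simp only [pairVec, Pi.add_apply, Pi.single_eq_same, Pi.smul_apply,
        Pi.single_eq_of_ne hp.symm, smul_eq_mul, mul_one, zero_add]
      constructor <;> intro h <;> linarith
    have h3 : ∀ i, i ≠ p.1 → i ≠ p.2 → (x i ≤ u i ↔ x i + √c * pairVec σ p i * g ≤ u i) := by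
      intro i h1 h2
      simp [pairVec, Pi.single_eq_of_ne h1, Pi.single_eq_of_ne h2]
    simp only [mem_preimage, mem_ofPred_eq, h1, h2]
    constructor
    · intro h
      exact ⟨fun i hi hi' => (h3 i hi hi').2 (h i), h _, h _⟩
    · rintro ⟨h, h', h''⟩ i
      by_cases hi : i = p.1
      · rw [hi]; exact h'
      by_cases hi' : i = p.2
      · rw [hi']; exact h''
      exact (h3 i hi hi').1 (h i hi hi')
  rw [key, key]
  simpa using gaussianReal_orthant_le _ _ _

lemma orth_add_sum_pair_le [DecidableEq ι] (s : Finset (ι × ι)) (hs : ∀ p ∈ s, p.1 ≠ p.2)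
    (w : ι × ι → ℝ) (hw : ∀ p, 0 ≤ w p) (hR : R.PosSemidef) (u : ι → ℝ) :
    orth (R + ∑ p ∈ s, w p • Matrix.vecMulVec (pairVec (-1) p) (pairVec (-1) p)) u ≤
      orth (R + ∑ p ∈ s, w p • Matrix.vecMulVec (pairVec 1 p) (pairVec 1 p)) u := by
  induction s using Finset.induction_on generalizing R with
  | empty => simp
  | insert p s hps ih =>
    rw [Finset.sum_insert hps, Finset.sum_insert hps]
    have hsum : (∑ p ∈ s, w p • Matrix.vecMulVec (pairVec 1 p) (pairVec 1 p)).PosSemidef := by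
      refine Matrix.posSemidef_sum _ fun p _ => ?_
      exact (posSemidef_vecMulVec_self _).smul (hw p)
    have h1 := ih (fun q hq => hs q (Finset.mem_insert_of_mem hq))
      (hR.add ((posSemidef_vecMulVec_self (pairVec (-1) p)).smul (hw p)))
    have h2 := orth_add_pair_le (hR.add hsum) (hw p) (hs p (Finset.mem_insert_self _ _)) u
    have e : ∀ X : Matrix ι ι ℝ,
        R + ∑ p ∈ s, w p • Matrix.vecMulVec (pairVec 1 p) (pairVec 1 p) + X =
        R + (X + ∑ p ∈ s, w p • Matrix.vecMulVec (pairVec 1 p) (pairVec 1 p)) := fun X => by abel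
    rw [e, e] at h2
    rw [← add_assoc]
    rw [← add_assoc] at h2
    exact h1.trans h2

lemma gaussN_abs_gt_le {A : Matrix ι ι ℝ} (hA : A.PosSemidef) {c ε : ℝ} (hε : 0 < ε) :
    (gaussN A).real {y | ∃ i, ε < |c * y i|} ≤ c ^ 2 * ∑ i, A i i / ε ^ 2 := by
  have hG := CenteredGaussian.of_gaussN hA
  have : {y : ι → ℝ | ∃ i, ε < |c * y i|} ⊆ 
      ⋃ i ∈ (Finset.univ : Finset ι), {y | ε ^ 2 ≤ (c * y i) ^ 2} := by
    rintro y ⟨i, hi⟩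
    simp only [Finset.mem_univ, iUnion_true, mem_iUnion]
    refine ⟨i, ?_⟩
    change ε ^ 2 ≤ (c * y i) ^ 2
    rw [← sq_abs (c * y i)]
    exact pow_le_pow_left₀ hε.le hi.le 2
  refine (measureReal_mono this (measure_ne_top _ _)).trans ((measureReal_biUnion_finset_le _ _).trans ?_)
  rw [Finset.mul_sum]
  refine Finset.sum_le_sum fun i _ => ?_
  have hi : Integrable (fun y : ι → ℝ => (c * y i) ^ 2) (gaussN A) := by
    have := (hG.integrable_mul i i).const_mul (c ^ 2)
    refine this.congr (ae_of_all _ fun y => by ring)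
  have := mul_meas_ge_le_integral_of_nonneg
    (ae_of_all _ fun y : ι → ℝ => sq_nonneg (c * y i)) hi (ε ^ 2)
  have h2 : ∫ y : ι → ℝ, (c * y i) ^ 2 ∂gaussN A = c ^ 2 * A i i := by
    rw [← hG.cov i i, ← integral_const_mul]
    refine integral_congr_ae (ae_of_all _ fun y => by ring)
  rw [h2] at this
  rw [← mul_div_assoc, le_div_iff₀ (by positivity), mul_comm]
  exact this

lemma CenteredGaussian.add_smul (hS : S.PosSemidef) {A : Matrix ι ι ℝ} (hA : A.PosSemidef)
    (c : ℝ) : CenteredGaussian (fun i (p : (ι → ℝ) × (ι → ℝ)) => p.1 i + c * p.2 i)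
      ((gaussN S).prod (gaussN A)) (S + c ^ 2 • A) :=
  (of_gaussN hS).add_prod ((of_gaussN hA).const_mul c)

lemma gaussN_prod_abs_gt_le {A : Matrix ι ι ℝ} (hA : A.PosSemidef) {c ε : ℝ} (hε : 0 < ε) :
    ((gaussN S).prod (gaussN A)).real {p | ∃ i, ε < |c * p.2 i|} ≤
      c ^ 2 * ∑ i, A i i / ε ^ 2 := by
  refine le_trans (le_of_eq ?_) (gaussN_abs_gt_le hA hε)
  have : {p : (ι → ℝ) × (ι → ℝ) | ∃ i, ε < |c * p.2 i|} = univ ×ˢ {y | ∃ i, ε < |c * y i|} := by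
    ext; simp
  rw [this, measureReal_prod_prod]
  simp

/-- By Chebyshev and a union bound, an independent noise of covariance `c ^ 2 • A` moves some
coordinate by more than `ε` only with probability `O(c²)`. -/
lemma orth_le_orth_add_smul (hS : S.PosSemidef) {A : Matrix ι ι ℝ} (hA : A.PosSemidef)
    (c : ℝ) {ε : ℝ} (hε : 0 < ε) (u : ι → ℝ) :
    orth S u ≤ orth (S + c ^ 2 • A) (fun i => u i + ε) + c ^ 2 * ∑ i, A i i / ε ^ 2 := by
  rw [← (CenteredGaussian.add_smul hS hA c).real_le]
  have h1 : orth S u = ((gaussN S).prod (gaussN A)).real ({x | ∀ i, x i ≤ u i} ×ˢ univ) := by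
    rw [measureReal_prod_prod]; simp [orth]
  rw [h1]
  refine le_trans (measureReal_mono (s₂ := {p | ∀ i, p.1 i + c * p.2 i ≤ u i + ε} ∪
    {p : (ι → ℝ) × (ι → ℝ) | ∃ i, ε < |c * p.2 i|}) ?_) ((measureReal_union_le _ _).trans
      (add_le_add le_rfl (gaussN_prod_abs_gt_le hA hε)))
  rintro ⟨x, y⟩ ⟨hx, -⟩
  by_cases h : ∃ i, ε < |c * y i|
  · exact Or.inr h
  · push Not at h
    exact Or.inl fun i => add_le_add (hx i) ((le_abs_self _).trans (h i))

lemma orth_add_smul_le_orth (hS : S.PosSemidef) {A : Matrix ι ι ℝ} (hA : A.PosSemidef)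
    (c : ℝ) {ε : ℝ} (hε : 0 < ε) (u : ι → ℝ) :
    orth (S + c ^ 2 • A) u ≤ orth S (fun i => u i + ε) + c ^ 2 * ∑ i, A i i / ε ^ 2 := by
  rw [← (CenteredGaussian.add_smul hS hA c).real_le]
  have h1 : orth S (fun i => u i + ε) =
      ((gaussN S).prod (gaussN A)).real ({x | ∀ i, x i ≤ u i + ε} ×ˢ univ) := by
    rw [measureReal_prod_prod]; simp [orth]
  rw [h1]
  refine le_trans (measureReal_mono (s₂ := ({x | ∀ i, x i ≤ u i + ε} ×ˢ univ) ∪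
    {p : (ι → ℝ) × (ι → ℝ) | ∃ i, ε < |c * p.2 i|}) ?_) ((measureReal_union_le _ _).trans
      (add_le_add le_rfl (gaussN_prod_abs_gt_le hA hε)))
  rintro ⟨x, y⟩ hx
  by_cases h : ∃ i, ε < |c * y i|
  · exact Or.inr h
  · push Not at h
    refine Or.inl ⟨fun i => ?_, mem_univ _⟩
    have h1 : x i + c * y i ≤ u i := hx i
    have h2 := neg_abs_le (c * y i)
    have h3 := h i
    change x i ≤ u i + ε
    linarith

/-- **Slepian's inequality**. -/
theorem orth_le_orth_of_le (hS : S.PosSemidef) (hS' : S'.PosSemidef)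
    (hdiag : ∀ i, S' i i = S i i) (hle : ∀ i j, S' i j ≤ S i j) (u : ι → ℝ) :
    orth S' u ≤ orth S u := by
  classical
  let s : Finset (ι × ι) := Finset.univ.filter fun p => p.1 ≠ p.2
  -- The outer squares of `pairVec 1 p` and `pairVec (-1) p` differ by `2` at each of the two
  -- entries belonging to `p`. Both orderings of a pair lie in `s`, hence the weight of one quarter
  -- of the gap.
  let w : ι × ι → ℝ := fun p => (S p.1 p.2 - S' p.1 p.2) / 4
  have hw : ∀ p, 0 ≤ w p := fun p => by
    have := hle p.1 p.2
    simp only [w]; linarith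
  let V : ℝ → Matrix ι ι ℝ := fun σ =>
    ∑ p ∈ s, w p • Matrix.vecMulVec (pairVec σ p) (pairVec σ p)
  have hV : ∀ σ, (V σ).PosSemidef := fun σ =>
    Matrix.posSemidef_sum _ fun p _ => (posSemidef_vecMulVec_self _).smul (hw p)
  have hsym : ∀ {M : Matrix ι ι ℝ}, M.PosSemidef → ∀ i j, M i j = M j i := fun hM i j => by
    have := hM.1.apply i j
    simpa using this.symm
  have hD : S - S' = V 1 - V (-1) := by
    ext i j
    simp only [V, ← Finset.sum_sub_distrib, Matrix.sub_apply, Matrix.sum_apply]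
    have : ∀ p : ι × ι, (w p • Matrix.vecMulVec (pairVec 1 p) (pairVec 1 p)) i j -
        (w p • Matrix.vecMulVec (pairVec (-1) p) (pairVec (-1) p)) i j =
        (if p = (i, j) then 2 * w p else 0) + (if p = (j, i) then 2 * w p else 0) := by
      rintro ⟨a, b⟩
      have h1 : ∀ x y : ι, (Pi.single a 1 : ι → ℝ) x * (Pi.single b 1 : ι → ℝ) y =
          if (a, b) = (x, y) then 1 else 0 := by
        intro x y
        simp only [Pi.single_apply, Prod.mk.injEq, ite_and, @eq_comm _ x, @eq_comm _ y]
        split_ifs <;> simp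
      simp only [Matrix.smul_apply, Matrix.vecMulVec_apply, pairVec, Pi.add_apply,
        Pi.smul_apply, smul_eq_mul]
      have e1 := h1 i j
      have e2 := h1 j i
      have : ∀ P : Prop, ∀ [Decidable P], (if P then 2 * w (a, b) else 0) =
          2 * w (a, b) * (if P then 1 else 0) := by intro P _; split_ifs <;> simp
      rw [this, this, ← e1, ← e2]
      ring
    rw [Finset.sum_congr rfl fun p _ => this p, Finset.sum_add_distrib, Finset.sum_ite_eq',
      Finset.sum_ite_eq']
    simp only [s, Finset.mem_filter, Finset.mem_univ, true_and]
    by_cases hij : i = j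
    · subst hij; simp [hdiag]
    · simp only [ne_eq, hij, not_false_eq_true, if_true, Ne.symm hij, w]
      rw [hsym hS j i, hsym hS' j i]; ring
  -- Exchanging all of `V (-1)` for `V 1` at once would require `S' - V (-1)` to be positive
  -- semidefinite, which may fail. Instead `(1/N) V (-1)` is carried along as extra noise: each
  -- exchange moves the matrix by `(S - S') / N` on the segment from `S'` to `S`, where
  -- semidefiniteness holds by convexity. The noise disappears as `N → ∞`, at the price of raising
  -- the level by `ε`.
  have hchain : ∀ N : ℕ, 0 < N → ∀ v, orth (S' + (1 / N : ℝ) • V (-1)) v ≤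
      orth (S + (1 / N : ℝ) • V (-1)) v := by
    intro N hN v
    have hN' : (0 : ℝ) < N := by exact_mod_cast hN
    have hpsd : ∀ k : ℕ, k ≤ N → (S' + (k / N : ℝ) • (S - S')).PosSemidef := by
      intro k hk
      have hk1 : (k / N : ℝ) ≤ 1 := by
        rw [div_le_one hN']; exact_mod_cast hk
      have : S' + (k / N : ℝ) • (S - S') = (1 - k / N : ℝ) • S' + (k / N : ℝ) • S := by
        rw [smul_sub, sub_smul, one_smul]; abel
      rw [this]
      exact (hS'.smul (by linarith)).add (hS.smul (by positivity))
    have hstep : ∀ k : ℕ, k ≤ N → orth (S' + (1 / N : ℝ) • V (-1)) v ≤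
        orth (S' + (k / N : ℝ) • (S - S') + (1 / N : ℝ) • V (-1)) v := by
      intro k
      induction k with
      | zero => intro; simp
      | succ k ih =>
        intro hk
        refine (ih (by omega)).trans ?_
        have := orth_add_sum_pair_le s (fun p hp => (Finset.mem_filter.1 hp).2)
          (fun p => (1 / N : ℝ) * w p) (fun p => mul_nonneg (by positivity) (hw p))
          (hpsd k (by omega)) v
        simp_rw [mul_smul, ← Finset.smul_sum] at this
        refine this.trans (le_of_eq ?_)
        congr 1
        rw [hD]
        push_cast
        rw [add_div, add_smul, smul_sub (1 / N : ℝ)]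
        abel
    have := hstep N le_rfl
    rw [div_self hN'.ne', one_smul, add_sub_cancel] at this
    exact this
  refine le_orth_of_forall_pos fun ε hε => ?_
  have hε2 : 0 < ε / 2 := by positivity
  have hbound : ∀ N : ℕ, orth S' u ≤ orth S (fun i => u i + ε) +
      2 * (1 / ((N : ℝ) + 1) * ∑ i, V (-1) i i / (ε / 2) ^ 2) := by
    intro N
    have hsq : (√(1 / ((N : ℝ) + 1))) ^ 2 = 1 / ((N : ℝ) + 1) := Real.sq_sqrt (by positivity)
    have h1 := orth_le_orth_add_smul hS' (hV (-1)) (√(1 / ((N : ℝ) + 1))) hε2 u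
    have h2 := hchain (N + 1) (by omega) (fun i => u i + ε / 2)
    have h3 := orth_add_smul_le_orth hS (hV (-1)) (√(1 / ((N : ℝ) + 1))) hε2
      (fun i => u i + ε / 2)
    rw [hsq] at h1 h3
    push_cast at h2
    simp_rw [add_assoc, add_halves] at h3 
    linarith
  have hlim : Tendsto (fun N : ℕ => orth S (fun i => u i + ε) +
      2 * (1 / ((N : ℝ) + 1) * ∑ i, V (-1) i i / (ε / 2) ^ 2)) atTop
      (𝓝 (orth S (fun i => u i + ε) + 2 * (0 * ∑ i, V (-1) i i / (ε / 2) ^ 2))) :=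
    (((tendsto_one_div_add_atTop_nhds_zero_nat).mul_const _).const_mul _).const_add _
  rw [zero_mul, mul_zero, add_zero] at hlim
  exact ge_of_tendsto' hlim hbound

end Slepian

/-! ### Block-diagonal covariances and positive association -/

section Blocks

variable {κ : Type*} [Fintype κ] [DecidableEq κ] {β : κ → Type*} [∀ k, Fintype (β k)]

lemma CenteredGaussian.blockDiagonal' {B : ∀ k, Matrix (β k) (β k) ℝ}
    (hB : ∀ k, (B k).PosSemidef) :
    CenteredGaussian (fun (p : Σ k, β k) (ω : ∀ k, β k → ℝ) => ω p.1 p.2)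
      (Measure.pi fun k => gaussN (B k)) (Matrix.blockDiagonal' B) := by
  have hG := fun k => CenteredGaussian.of_gaussN (hB k)
  have hmp := fun k => measurePreserving_eval (fun k => gaussN (B k)) k
  have hint : ∀ k (f : (β k → ℝ) → ℝ), Measurable f →
      ∫ ω, f (ω k) ∂(Measure.pi fun k => gaussN (B k)) = ∫ x, f x ∂(gaussN (B k)) := by
    intro k f hf
    rw [← (hmp k).map_eq, integral_map (hmp k).measurable.aemeasurable hf.aestronglyMeasurable]
  have hind : iIndepFun (fun k (ω : ∀ k, β k → ℝ) => ω k) (Measure.pi fun k => gaussN (B k)) :=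
    iIndepFun_pi (X := fun k => id) fun k => aemeasurable_id
  refine ⟨?_, ?_, ?_⟩
  · have h1 : ∀ k, HasGaussianLaw (fun ω : ∀ k, β k → ℝ => ω k)
        (Measure.pi fun k => gaussN (B k)) := by
      intro k
      constructor
      have := (hG k).gaussian.isGaussian_map
      rw [show (fun ω : ∀ k, β k → ℝ => ω k) = Function.eval k from rfl, (hmp k).map_eq]
      simpa using this
    have h2 := iIndepFun.hasGaussianLaw h1 hind
    exact h2.map_fun (ContinuousLinearMap.pi fun p : Σ k, β k =>
      (ContinuousLinearMap.proj (R := ℝ) (φ := fun _ : β p.1 => ℝ) p.2).comp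
        (ContinuousLinearMap.proj (R := ℝ) (φ := fun k => β k → ℝ) p.1))
  · rintro ⟨k, i⟩
    exact (hint k (fun x => x i) (by fun_prop)).trans ((hG k).centered i)
  · rintro ⟨k, i⟩ ⟨l, j⟩
    rcases eq_or_ne k l with rfl | hkl
    · rw [Matrix.blockDiagonal'_apply_eq]
      exact (hint k (fun x => x i * x j) (by fun_prop)).trans ((hG k).cov i j)
    · rw [Matrix.blockDiagonal'_apply_ne _ _ _ hkl]
      have h1 : IndepFun (fun ω : ∀ k, β k → ℝ => ω k i) (fun ω => ω l j)
          (Measure.pi fun k => gaussN (B k)) :=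
        (hind.indepFun hkl).comp (φ := fun x : β k → ℝ => x i) (ψ := fun x : β l → ℝ => x j)
          (by fun_prop) (by fun_prop)
      rw [h1.integral_fun_mul_eq_mul_integral (Measurable.aestronglyMeasurable (by fun_prop))
        (Measurable.aestronglyMeasurable (by fun_prop)),
        hint k (fun x => x i) (by fun_prop), (hG k).centered, zero_mul]

lemma orth_blockDiagonal' {B : ∀ k, Matrix (β k) (β k) ℝ} (hB : ∀ k, (B k).PosSemidef)
    (u : (Σ k, β k) → ℝ) :
    orth (Matrix.blockDiagonal' B) u = ∏ k, orth (B k) (fun i => u ⟨k, i⟩) := by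
  rw [← (CenteredGaussian.blockDiagonal' hB).real_le]
  have : {ω : ∀ k, β k → ℝ | ∀ p : Σ k, β k, ω p.1 p.2 ≤ u p} =
      univ.pi fun k => {x | ∀ i, x i ≤ u ⟨k, i⟩} := by
    ext ω
    simp [Sigma.forall]
  rw [this, measureReal_def, Measure.pi_pi, ENNReal.toReal_prod]
  rfl

/-- Blocks that are nonnegatively correlated with each other are positively associated. -/
lemma prod_orth_le_orth {ι : Type*} [Fintype ι] {S : Matrix ι ι ℝ} (hS : S.PosSemidef)
    (f : ι → κ) (hf : ∀ i j, f i ≠ f j → 0 ≤ S i j) (u : ι → ℝ) :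
    ∏ k, orth (S.submatrix (fun i : {i // f i = k} => i.1) (fun i => i.1)) (fun i => u i.1) ≤
      orth S u := by
  have hB := fun k => hS.submatrix (fun i : {i // f i = k} => i.1)
  rw [← orth_blockDiagonal' hB fun p => u p.2.1,
    ← orth_submatrix_of_surjective hS (Equiv.sigmaFiberEquiv f).surjective]
  -- Deleting the nonnegative correlations between different blocks lowers the orthant probability,
  -- and makes the blocks independent.
  refine orth_le_orth_of_le (hS.submatrix _) (CenteredGaussian.blockDiagonal' hB).posSemidef
    ?_ ?_ _
  · rintro ⟨k, i⟩
    rw [Matrix.blockDiagonal'_apply_eq]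
    rfl
  · rintro ⟨k, i⟩ ⟨l, j⟩
    rcases eq_or_ne k l with rfl | hkl
    · rw [Matrix.blockDiagonal'_apply_eq]
      rfl
    · rw [Matrix.blockDiagonal'_apply_ne _ _ _ hkl]
      refine hf _ _ ?_
      change f i.1 ≠ f j.1
      rw [i.2, j.2]
      exact hkl

lemma mul_orth_le_orth {ι : Type*} [Fintype ι] {S : Matrix ι ι ℝ} (hS : S.PosSemidef)
    (p : ι → Prop) [DecidablePred p] (hp : ∀ i j, p i → ¬ p j → 0 ≤ S i j) (u : ι → ℝ) :
    orth (S.submatrix (fun i : {i // p i} => i.1) (fun i => i.1)) (fun i => u i.1) *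
      orth (S.submatrix (fun i : {i // ¬ p i} => i.1) (fun i => i.1)) (fun i => u i.1) ≤
      orth S u := by
  have hsym : ∀ i j, S i j = S j i := fun i j => by
    have := hS.1.apply i j
    simpa using this.symm
  have := prod_orth_le_orth hS (fun i => decide (p i)) (fun i j hij => by
    by_cases hi : p i <;> by_cases hj : p j
    · simp [hi, hj] at hij
    · exact hp i j hi hj
    · rw [hsym]; exact hp j i hj hi
    · simp [hi, hj] at hij) u
  rw [Fintype.prod_bool] at this
  refine le_trans (le_of_eq ?_) this
  congr 1
  · let e : {i // p i} ≃ {i // decide (p i) = true} := Equiv.subtypeEquivRight (by simp)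
    exact orth_submatrix_of_surjective (hS.submatrix (fun i : {i // decide (p i) = true} => i.1))
      e.surjective (fun i => u i.1)
  · let e : {i // ¬ p i} ≃ {i // decide (p i) = false} := Equiv.subtypeEquivRight (by simp)
    exact orth_submatrix_of_surjective (hS.submatrix (fun i : {i // decide (p i) = false} => i.1))
      e.surjective (fun i => u i.1)

end Blocks

/-! ### Changing the level -/

section Level

/-- The Cameron–Martin formula in dimension one. -/
lemma gaussianReal_sub_preimage (m : ℝ) {E : Set ℝ} (hE : MeasurableSet E) :
    gaussianReal 0 1 {g | g - m ∈ E} =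
      ∫⁻ g in E, ENNReal.ofReal (Real.exp (-m * g - m ^ 2 / 2)) ∂gaussianReal 0 1 := by
  have h1 : (gaussianReal 0 1).map (fun g => g - m) = gaussianReal (-m) 1 := by
    have := gaussianReal_map_sub_const (μ := 0) (v := 1) m
    simpa using this
  have h2 : gaussianReal (-m) 1 = (gaussianReal 0 1).withDensity
      fun g => ENNReal.ofReal (Real.exp (-m * g - m ^ 2 / 2)) := by
    rw [gaussianReal_of_var_ne_zero _ one_ne_zero, gaussianReal_of_var_ne_zero _ one_ne_zero,
      ← withDensity_mul _ (by fun_prop) (by fun_prop)]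
    congr 1
    ext g
    simp only [Pi.mul_apply, gaussianPDF]
    rw [← ENNReal.ofReal_mul (gaussianPDFReal_nonneg _ _ _)]
    congr 1
    simp only [gaussianPDFReal]
    rw [mul_assoc (_⁻¹), ← Real.exp_add]
    congr 2
    simp only [NNReal.coe_one]
    ring
  rw [← withDensity_apply _ hE, ← h2, ← h1, Measure.map_apply (by fun_prop) hE]
  rfl

lemma lintegral_exp_gaussianReal (a b : ℝ) :
    ∫⁻ g, ENNReal.ofReal (Real.exp (a * g + b)) ∂gaussianReal 0 1 =
      ENNReal.ofReal (Real.exp (a ^ 2 / 2 + b)) := by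
  have hmgf := mgf_gaussianReal (p := gaussianReal 0 1) (X := id) (μ := 0) (v := 1) (by simp) a
  have hint : Integrable (fun g => Real.exp (a * g)) (gaussianReal 0 1) :=
    integrable_exp_mul_gaussianReal a
  simp_rw [Real.exp_add]
  rw [← ofReal_integral_eq_lintegral_ofReal (hint.mul_const _)
    (ae_of_all _ fun g => by positivity), integral_mul_const]
  simp only [mgf, id] at hmgf
  rw [hmgf]
  simp

variable {ι : Type*} [Fintype ι] {S : Matrix ι ι ℝ}

/-- The matrix is the conditional covariance given the functional `w`. Its form at `x` is the form
of `S` at `x - c w`, where `c` minimizes that quadratic; this is Cauchy–Schwarz for `S`. -/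
lemma posSemidef_sub_vecMulVec (hS : S.PosSemidef) (w : ι → ℝ) (hv : 0 < w ⬝ᵥ S.mulVec w) :
    (S - Matrix.vecMulVec (fun i => S.mulVec w i / √(w ⬝ᵥ S.mulVec w))
      (fun i => S.mulVec w i / √(w ⬝ᵥ S.mulVec w))).PosSemidef := by
  set v := w ⬝ᵥ S.mulVec w with hvdef
  have hsq : √v * √v = v := Real.mul_self_sqrt hv.le
  refine Matrix.PosSemidef.of_dotProduct_mulVec_nonneg ?_ fun x => ?_
  · exact hS.1.sub (posSemidef_vecMulVec_self _).1
  · rw [star_trivial]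
    set c := (x ⬝ᵥ S.mulVec w) / v
    have h := hS.dotProduct_mulVec_nonneg (x - c • w)
    rw [star_trivial] at h
    have hsym : w ⬝ᵥ S.mulVec x = x ⬝ᵥ S.mulVec w := by
      have : S.transpose = S := by
        have := hS.1
        rwa [Matrix.IsHermitian, Matrix.conjTranspose_eq_transpose_of_trivial] at this
      rw [Matrix.dotProduct_mulVec, ← Matrix.mulVec_transpose, this, dotProduct_comm]
    have h2 : (x - c • w) ⬝ᵥ S.mulVec (x - c • w) =
        x ⬝ᵥ S.mulVec x - 2 * c * (x ⬝ᵥ S.mulVec w) + c ^ 2 * v := by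
      rw [Matrix.mulVec_sub, Matrix.mulVec_smul, sub_dotProduct, dotProduct_sub, dotProduct_sub,
        smul_dotProduct, smul_dotProduct, dotProduct_smul, dotProduct_smul, hsym, ← hvdef]
      simp only [smul_eq_mul]
      ring
    have h3 : x ⬝ᵥ (S - Matrix.vecMulVec (fun i => S.mulVec w i / √v)
        (fun i => S.mulVec w i / √v)).mulVec x = x ⬝ᵥ S.mulVec x - (x ⬝ᵥ S.mulVec w) ^ 2 / v := by
      rw [Matrix.sub_mulVec, dotProduct_sub]
      congr 1
      have h4 : x ⬝ᵥ (fun i => S.mulVec w i / √v) = (x ⬝ᵥ S.mulVec w) / √v := by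
        simp only [dotProduct, Finset.sum_div, mul_div_assoc]
      rw [Matrix.vecMulVec_mulVec, op_smul_eq_smul, dotProduct_smul,
        dotProduct_comm _ x, h4, smul_eq_mul, div_mul_div_comm, hsq, sq]
    rw [h3]
    rw [h2] at h
    have hc : c * v = x ⬝ᵥ S.mulVec w := div_mul_cancel₀ _ hv.ne'
    have : (x ⬝ᵥ S.mulVec w) ^ 2 / v = c * (x ⬝ᵥ S.mulVec w) := by
      simp only [c]; ring
    have h4 : c ^ 2 * v = c * (x ⬝ᵥ S.mulVec w) := by rw [← hc]; ring
    rw [this]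
    linarith

/-- Raising the level by `y` costs at most an exponential factor and a power close to one. -/
lemma orth_add_le_exp_mul_rpow (hS : S.PosSemidef) (w : ι → ℝ) (hv : 0 < w ⬝ᵥ S.mulVec w)
    (hw : ∀ i, 1 ≤ S.mulVec w i) {y : ℝ} (hy : 0 < y) (u : ι → ℝ) :
    orth S (fun i => u i + y) ≤
      Real.exp (y * (w ⬝ᵥ S.mulVec w) / 2) * orth S u ^ (1 / (1 + y)) := by
  set v := w ⬝ᵥ S.mulVec w with hvdef
  set a : ι → ℝ := fun i => S.mulVec w i / √v with ha
  have hsv : 0 < √v := Real.sqrt_pos.2 hv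
  have hR := posSemidef_sub_vecMulVec hS w hv
  rw [← hvdef] at hR
  set R := S - Matrix.vecMulVec a a with hRdef
  have hSR : S = R + Matrix.vecMulVec a a := by rw [hRdef]; abel
  -- Shifting the scalar Gaussian by `m` moves coordinate `i` by `a i * m = y * S.mulVec w i`, which
  -- is at least `y` by `hw`.
  set m := y * √v with hm
  set E : Set ((ι → ℝ) × ℝ) := {p | ∀ i, p.1 i + a i * p.2 ≤ u i} with hE
  have hEm : MeasurableSet E := measurableSet_forall_le _ fun i => by fun_prop
  have hEm' : MeasurableSet {p : (ι → ℝ) × ℝ | ∀ i, p.1 i + a i * p.2 ≤ u i + y} :=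
    measurableSet_forall_le (fun i => u i + y) fun i => by fun_prop
  set ν := (gaussN R).prod (gaussianReal 0 1)
  have hO : orth S u = ν.real E := by
    conv_lhs => rw [hSR, orth_add_vecMulVec hR]
  have hO' : orth S (fun i => u i + y) = ν.real {p | ∀ i, p.1 i + a i * p.2 ≤ u i + y} := by
    conv_lhs => rw [hSR, orth_add_vecMulVec hR]
  set ρ : ℝ → ENNReal := fun g => ENNReal.ofReal (Real.exp (-m * g - m ^ 2 / 2)) with hρ
  have hρm : Measurable ρ := by fun_prop
  -- With this pair of exponents the event enters with power `1 / (1 + y)`, close to one for small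
  -- `y`, and the dual norm of the shift density is exactly `exp (y v / 2)`.
  have hpq : (1 + y).HolderConjugate ((1 + y) / y) := by
    rw [Real.holderConjugate_iff]
    refine ⟨by linarith, ?_⟩
    field_simp
  have step1 : ν {p | ∀ i, p.1 i + a i * p.2 ≤ u i + y} ≤
      ∫⁻ p, (E.indicator 1 p) * ρ p.2 ∂ν := by
    have hmeas : Measurable fun p : (ι → ℝ) × ℝ => (E.indicator 1 p : ENNReal) * ρ p.2 :=
      (measurable_one.indicator hEm).mul (hρm.comp measurable_snd)
    rw [Measure.prod_apply hEm', lintegral_prod _ hmeas.aemeasurable]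
    refine lintegral_mono fun x => ?_
    have hEx : MeasurableSet (Prod.mk x ⁻¹' E) := measurable_prodMk_left hEm
    have : Prod.mk x ⁻¹' {p : (ι → ℝ) × ℝ | ∀ i, p.1 i + a i * p.2 ≤ u i + y} ⊆
        {g | g - m ∈ Prod.mk x ⁻¹' E} := by
      intro g hg i
      have h1 : x i + a i * g ≤ u i + y := hg i
      change x i + a i * (g - m) ≤ u i
      have h2 : a i * m = S.mulVec w i * y := by
        simp only [ha, hm]
        field_simp
      have := mul_le_mul_of_nonneg_right (hw i) hy.le
      rw [mul_sub, h2]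
      linarith
    refine (measure_mono this).trans (le_of_eq ?_)
    rw [gaussianReal_sub_preimage m hEx, ← lintegral_indicator hEx]
    refine lintegral_congr fun g => ?_
    by_cases hg : (x, g) ∈ E
    · rw [indicator_of_mem (show g ∈ Prod.mk x ⁻¹' E from hg), indicator_of_mem hg]
      simp [hρ]
    · rw [indicator_of_notMem (show g ∉ Prod.mk x ⁻¹' E from hg), indicator_of_notMem hg]
      simp
  have step2 := ENNReal.lintegral_mul_le_Lp_mul_Lq ν hpq
    (measurable_one.indicator hEm).aemeasurable (hρm.comp measurable_snd).aemeasurable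
  have i1 : ∫⁻ p, (E.indicator 1 p : ENNReal) ^ (1 + y) ∂ν = ν E := by
    rw [← lintegral_indicator_one hEm]
    refine lintegral_congr fun p => ?_
    by_cases hp : p ∈ E
    · simp [hp]
    · simp [hp, show 0 < 1 + y by linarith]
  have hq : 0 < (1 + y) / y := by positivity
  have i2 : ∫⁻ p, ((ρ ∘ Prod.snd) p : ENNReal) ^ ((1 + y) / y) ∂ν =
      ENNReal.ofReal (Real.exp ((1 + y) / y * (y * v / 2))) := by
    have : ∀ g, ρ g ^ ((1 + y) / y) = ENNReal.ofReal
        (Real.exp (-(m * ((1 + y) / y)) * g + -(m ^ 2 / 2 * ((1 + y) / y)))) := by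
      intro g
      simp only [hρ]
      rw [ENNReal.ofReal_rpow_of_pos (Real.exp_pos _), ← Real.exp_mul]
      congr 2
      ring
    simp only [Function.comp]
    rw [lintegral_prod _ (Measurable.aemeasurable (by fun_prop))]
    simp_rw [this]
    rw [lintegral_exp_gaussianReal]
    simp only [lintegral_const, measure_univ, mul_one]
    congr 2
    have hmv : m ^ 2 = y ^ 2 * v := by
      rw [hm, mul_pow, Real.sq_sqrt hv.le]
    rw [neg_sq, mul_pow, hmv]
    field_simp
    ring
  have step3 : ν {p | ∀ i, p.1 i + a i * p.2 ≤ u i + y} ≤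
      ENNReal.ofReal (Real.exp (y * v / 2)) * ν E ^ (1 / (1 + y)) := by
    refine step1.trans (step2.trans (le_of_eq ?_))
    rw [i1, i2, mul_comm, ENNReal.ofReal_rpow_of_pos (Real.exp_pos _), ← Real.exp_mul]
    congr 3
    field_simp
  rw [hO, hO', measureReal_def, measureReal_def]
  have := ENNReal.toReal_mono (ENNReal.mul_ne_top ENNReal.ofReal_ne_top
    (ENNReal.rpow_ne_top_of_nonneg (by positivity) (measure_ne_top _ _))) step3
  rw [ENNReal.toReal_mul, ENNReal.toReal_ofReal (Real.exp_pos _).le, ← ENNReal.toReal_rpow] at this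
  exact this

end Level

/-! ### Persistence probabilities of stationary covariance functions -/

/-- The covariance matrix at the points `t` of the stationary covariance function `C`. -/
def covMat {ι : Type*} (C : ℝ → ℝ) (t : ι → ℝ) : Matrix ι ι ℝ := Matrix.of fun i j => C (t i - t j)

/-- `C` is a positive semidefinite function on the line. -/
def PSDFun (C : ℝ → ℝ) : Prop := ∀ (n : ℕ) (t : Fin n → ℝ), (covMat C t).PosSemidef

/-- The infimum over finite subfamilies of `[0, T]` of the probability that a centered Gaussian
process with stationary covariance `C` stays below `x`. -/
noncomputable def persist (C : ℝ → ℝ) (T x : ℝ) : ℝ :=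
  ⨅ p : Σ n : ℕ, Fin n → Icc (0 : ℝ) T, orth (covMat C fun i => (p.2 i : ℝ)) fun _ => x

section Persist

variable {ι κ : Type*} {C C' : ℝ → ℝ} {T S x y : ℝ}

lemma covMat_submatrix (C : ℝ → ℝ) (t : ι → ℝ) (e : κ → ι) :
    (covMat C t).submatrix e e = covMat C fun k => t (e k) := rfl

lemma covMat_sub_const (C : ℝ → ℝ) (t : ι → ℝ) (a : ℝ) :
    covMat C (fun i => t i - a) = covMat C t := by
  ext i j
  simp [covMat]

variable [Fintype ι] [Fintype κ]

lemma PSDFun.posSemidef (hC : PSDFun C) (t : ι → ℝ) : (covMat C t).PosSemidef := by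
  let e := Fintype.equivFin ι
  have := (hC _ (fun i => t (e.symm i))).submatrix e
  rw [covMat_submatrix] at this
  simpa using this

lemma PSDFun.neg_apply (hC : PSDFun C) (τ : ℝ) : C (-τ) = C τ := by
  have := (hC 2 ![0, τ]).1.apply 0 1
  simp [covMat] at this
  exact this.symm

lemma PSDFun.le_orth_comp (hC : PSDFun C) (t : ι → ℝ) (e : κ → ι) (x : ℝ) :
    orth (covMat C t) (fun _ => x) ≤ orth (covMat C fun k => t (e k)) fun _ => x :=
  orth_le_orth_submatrix (hC.posSemidef t) e _

lemma persist_bddBelow (C : ℝ → ℝ) (T x : ℝ) :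
    BddBelow (range fun p : Σ n : ℕ, Fin n → Icc (0 : ℝ) T =>
      orth (covMat C fun i => (p.2 i : ℝ)) fun _ => x) :=
  ⟨0, by rintro _ ⟨p, rfl⟩; exact orth_nonneg _ _⟩

instance (T : ℝ) : Nonempty (Σ n : ℕ, Fin n → Icc (0 : ℝ) T) := ⟨⟨0, fun i => i.elim0⟩⟩

lemma persist_le_orth (hC : PSDFun C) (a : ℝ) {t : ι → ℝ} (ht : ∀ i, t i ∈ Icc a (a + T)) (x : ℝ) :
    persist C T x ≤ orth (covMat C t) fun _ => x := by
  let e := Fintype.equivFin ι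
  have h := ciInf_le (persist_bddBelow C T x) ⟨Fintype.card ι, fun i => ⟨t (e.symm i) - a, by
    have := ht (e.symm i)
    constructor <;> linarith [this.1, this.2]⟩⟩
  refine h.trans ?_
  have h2 := hC.le_orth_comp (fun i => t (e.symm i)) e x
  rw [covMat_sub_const C (fun i => t (e.symm i)) a]
  simpa using h2

lemma persist_le_orth' (hC : PSDFun C) {t : ι → ℝ} (ht : ∀ i, t i ∈ Icc 0 T) (x : ℝ) :
    persist C T x ≤ orth (covMat C t) fun _ => x :=
  persist_le_orth hC 0 (by simpa only [zero_add] using ht) x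

lemma le_persist {c : ℝ} (h : ∀ (n : ℕ) (t : Fin n → ℝ), (∀ i, t i ∈ Icc 0 T) →
    c ≤ orth (covMat C t) fun _ => x) : c ≤ persist C T x :=
  le_ciInf fun p => h _ _ fun i => (p.2 i).2

lemma exists_orth_lt {c : ℝ} (h : persist C T x < c) : ∃ (n : ℕ) (t : Fin n → ℝ),
    (∀ i, t i ∈ Icc 0 T) ∧ orth (covMat C t) (fun _ => x) < c := by
  obtain ⟨p, hp⟩ := exists_lt_of_ciInf_lt h
  exact ⟨p.1, fun i => p.2 i, fun i => (p.2 i).2, hp⟩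

lemma persist_nonneg (C : ℝ → ℝ) (T x : ℝ) : 0 ≤ persist C T x :=
  le_persist fun _ _ _ => orth_nonneg _ _

lemma persist_le_one (C : ℝ → ℝ) (T x : ℝ) : persist C T x ≤ 1 :=
  (ciInf_le (persist_bddBelow C T x) ⟨0, fun i => i.elim0⟩).trans (orth_le_one _ _)

lemma persist_mono_level (hC : PSDFun C) (T : ℝ) (hxy : x ≤ y) : persist C T x ≤ persist C T y :=
  le_persist fun _ _ ht => (persist_le_orth' hC ht x).trans
    (orth_mono _ fun _ => hxy)

lemma persist_anti (hC : PSDFun C) (hST : S ≤ T) (x : ℝ) : persist C T x ≤ persist C S x :=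
  le_persist fun _ _ ht => persist_le_orth' hC
    (by intro i; have := ht i; constructor <;> linarith [this.1, this.2]) x

lemma persist_mono_cov (hC : PSDFun C) (hC' : PSDFun C') (h0 : C 0 = C' 0)
    (hle : ∀ τ, |τ| ≤ T → C τ ≤ C' τ) (x : ℝ) : persist C T x ≤ persist C' T x := by
  refine le_persist fun n t ht => (persist_le_orth' hC ht x).trans ?_
  refine orth_le_orth_of_le (hC'.posSemidef t) (hC.posSemidef t) (fun i => ?_) (fun i j => ?_) _
  · simp [covMat, h0]
  · refine hle _ ?_
    have h1 := ht i
    have h2 := ht j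
    rw [abs_le]
    constructor <;> linarith [h1.1, h1.2, h2.1, h2.2]

/-- Nonnegative correlations associate the times up to `T` positively with the later ones, and
stationarity moves the latter back to `[0, S]`. This supermultiplicativity feeds Fekete's lemma. -/
lemma persist_mul_le (hC : PSDFun C) (h0 : ∀ τ, 0 ≤ C τ) (x : ℝ) :
    persist C T x * persist C S x ≤ persist C (T + S) x := by
  refine le_persist fun n t ht => ?_
  refine le_trans ?_ (mul_orth_le_orth (hC.posSemidef t) (fun i => t i ≤ T)
    (fun _ _ _ _ => h0 _) _)
  refine mul_le_mul ?_ ?_ (persist_nonneg _ _ _) (orth_nonneg _ _)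
  · rw [covMat_submatrix]
    exact persist_le_orth' hC (fun i : {i // t i ≤ T} => ⟨(ht i).1, i.2⟩) x
  · rw [covMat_submatrix]
    exact persist_le_orth hC T (fun i : {i // ¬ t i ≤ T} => ⟨(not_le.1 i.2).le, (ht i).2⟩) x

lemma persist_comp_div (hC : PSDFun C) {c : ℝ} (hc : 0 < c) (x : ℝ) :
    persist (fun τ => C (τ / c)) T x = persist C (T / c) x := by
  have hcov : ∀ {n : ℕ} (t : Fin n → ℝ),
      covMat (fun τ => C (τ / c)) t = covMat C fun i => t i / c := by
    intro n t
    ext i j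
    simp [covMat, sub_div]
  have hC2 : PSDFun fun τ => C (τ / c) := fun n t => by rw [hcov]; exact hC _ _
  apply le_antisymm
  · refine le_persist fun n t ht => ?_
    have := persist_le_orth hC2 0 (T := T) (t := fun i => t i * c) (fun i => ?_) x
    · rw [hcov] at this
      simpa [hc.ne'] using this
    · have := ht i
      constructor
      · exact mul_nonneg this.1 hc.le
      · rw [zero_add, ← le_div_iff₀ hc]; exact this.2
  · refine le_persist fun n t ht => ?_
    rw [hcov]
    refine persist_le_orth hC 0 (fun i => ?_) x
    have := ht i
    exact ⟨div_nonneg this.1 hc.le, by rw [zero_add]; exact div_le_div_of_nonneg_right this.2 hc.le⟩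

end Persist

/-! ### Summation of geometric correlations -/

lemma summable_pow_natAbs {r : ℝ} (h0 : 0 ≤ r) (h1 : r < 1) :
    Summable fun k : ℤ => r ^ k.natAbs := by
  refine Summable.of_nat_of_neg ?_ ?_ <;> simpa using summable_geometric_of_lt_one h0 h1

lemma sum_pow_natAbs_le {α : Type*} (s : Finset α) {r : ℝ} (h0 : 0 ≤ r) (h1 : r < 1) {f : α → ℤ}
    (hf : f.Injective) : ∑ l ∈ s, r ^ (f l).natAbs ≤ ∑' k : ℤ, r ^ k.natAbs := by
  have := (summable_pow_natAbs h0 h1).sum_le_tsum (s.map ⟨f, hf⟩) (fun _ _ => by positivity)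
  simpa using this

/-! ### Persistence exponents -/

/-- Conditions on a stationary covariance function under which persistence exponents exist. -/
structure Admissible (C : ℝ → ℝ) : Prop where
  psd : PSDFun C
  one : C 0 = 1
  nonneg : ∀ τ, 0 ≤ C τ
  decay : ∃ A c : ℝ, 0 < A ∧ 0 < c ∧ ∀ τ, C τ ≤ A * Real.exp (-c * |τ|)
  local_pos : ∃ κ > 0, ∀ τ, |τ| ≤ 1 → κ ≤ C τ
  persist_pos : ∀ T, 0 < persist C T 0

/-- The shift direction `w` puts mass `κ⁻¹` at each integer of `[0, T]`. Every time lies within one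
unit of such an integer, so `local_pos` gives `S w ≥ 1`, while exponential decay of correlations
keeps the energy of `w` linear in `T`. -/
lemma Admissible.exists_level_bound {C : ℝ → ℝ} (h : Admissible C) :
    ∃ V > 0, ∀ T ≥ 1, ∀ y > 0, ∀ x, persist C T (x + y) ≤
      Real.exp (y * (V * T)) * persist C T x ^ (1 / (1 + y)) := by
  obtain ⟨A, c, hA, hc, hdec⟩ := h.decay
  obtain ⟨κ, hκ, hloc⟩ := h.local_pos
  set r := Real.exp (-c) with hr
  have hr0 : 0 ≤ r := (Real.exp_pos _).le
  have hr1 : r < 1 := by rw [hr, Real.exp_lt_one_iff]; linarith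
  set B := ∑' k : ℤ, r ^ k.natAbs with hB
  have hB1 : 0 < B := by
    have := sum_pow_natAbs_le {(0 : ℤ)} hr0 hr1 (f := id) Function.injective_id
    simp at this
    linarith
  have hCr : ∀ j l : ℕ, C ((j : ℝ) - l) ≤ A * r ^ ((j : ℤ) - l).natAbs := by
    intro j l
    refine (hdec _).trans (le_of_eq ?_)
    rw [hr, ← Real.exp_nat_mul]
    congr 2
    rw [Nat.cast_natAbs]
    push_cast
    ring
  refine ⟨κ⁻¹ ^ 2 * (A * B), by positivity, fun T hT y hy x => ?_⟩
  have key : ∀ (n : ℕ) (t : Fin n → ℝ), (∀ i, t i ∈ Icc 0 T) →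
      persist C T (x + y) ≤ Real.exp (y * (κ⁻¹ ^ 2 * (A * B) * T)) *
        orth (covMat C t) (fun _ => x) ^ (1 / (1 + y)) := by
    intro n t ht
    set N := ⌊T⌋₊
    have hN : (N : ℝ) ≤ T := Nat.floor_le (by linarith)
    -- The integers carrying `w` are adjoined to the given times; dropping them again at the end
    -- only increases the orthant probability.
    let t' : Fin n ⊕ Fin (N + 1) → ℝ := Sum.elim t fun j => (j : ℝ)
    have ht' : ∀ i, t' i ∈ Icc 0 T := by
      rintro (i | j)
      · exact ht i
      · refine ⟨by simp [t'], ?_⟩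
        have : (j : ℝ) ≤ N := by exact_mod_cast Nat.lt_succ_iff.1 j.2
        exact this.trans hN
    let w : Fin n ⊕ Fin (N + 1) → ℝ := Sum.elim 0 fun _ => κ⁻¹
    set M := covMat C t' with hM
    have hMw : ∀ i, M.mulVec w i = ∑ j : Fin (N + 1), κ⁻¹ * C (t' i - j) := by
      intro i
      simp [Matrix.mulVec, dotProduct, w, hM, covMat, t', mul_comm]
    have hw1 : ∀ i, 1 ≤ M.mulVec w i := by
      intro i
      rw [hMw]
      have hi := ht' i
      have hfl : ⌊t' i⌋₊ < N + 1 := Nat.lt_succ_of_le (Nat.floor_le_floor hi.2)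
      refine le_trans ?_ (Finset.single_le_sum (f := fun j : Fin (N + 1) => κ⁻¹ * C (t' i - j))
        (fun j _ => mul_nonneg (by positivity) (h.nonneg _)) (Finset.mem_univ ⟨⌊t' i⌋₊, hfl⟩))
      have := hloc (t' i - ⌊t' i⌋₊) (by
        rw [abs_le]
        constructor <;> linarith [Nat.floor_le hi.1, Nat.lt_floor_add_one (t' i)])
      calc (1 : ℝ) = κ⁻¹ * κ := by field_simp
        _ ≤ _ := mul_le_mul_of_nonneg_left this (by positivity)
    have hv : w ⬝ᵥ M.mulVec w = ∑ i : Fin (N + 1), κ⁻¹ * M.mulVec w (Sum.inr i) := by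
      simp [dotProduct, w]
    have hv0 : 0 < w ⬝ᵥ M.mulVec w := by
      rw [hv]
      exact Finset.sum_pos (fun i _ => mul_pos (by positivity) (by linarith [hw1 (Sum.inr i)]))
        Finset.univ_nonempty
    have hv1 : w ⬝ᵥ M.mulVec w ≤ 2 * (κ⁻¹ ^ 2 * (A * B) * T) := by
      rw [hv]
      have : ∀ i : Fin (N + 1), κ⁻¹ * M.mulVec w (Sum.inr i) ≤ κ⁻¹ ^ 2 * (A * B) := by
        intro i
        rw [hMw, ← Finset.mul_sum, ← mul_assoc, ← sq]
        refine mul_le_mul_of_nonneg_left ?_ (by positivity)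
        refine (Finset.sum_le_sum (g := fun j : Fin (N + 1) => A * r ^ (((i : ℕ) : ℤ) - (j : ℕ)).natAbs)
          fun j _ => hCr i j).trans ?_
        rw [← Finset.mul_sum]
        refine mul_le_mul_of_nonneg_left (sum_pow_natAbs_le _ hr0 hr1
          (f := fun j : Fin (N + 1) => ((i : ℕ) : ℤ) - (j : ℕ)) ?_) hA.le
        intro a b hab
        simp at hab
        exact Fin.ext hab
      refine (Finset.sum_le_sum fun i _ => this i).trans ?_
      rw [Finset.sum_const, Finset.card_univ, Fintype.card_fin, nsmul_eq_mul]
      push_cast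
      have h2 : (N : ℝ) + 1 ≤ 2 * T := by linarith
      calc ((N : ℝ) + 1) * (κ⁻¹ ^ 2 * (A * B)) ≤ (2 * T) * (κ⁻¹ ^ 2 * (A * B)) :=
            mul_le_mul_of_nonneg_right h2 (by positivity)
        _ = _ := by ring
    have h1 := persist_le_orth' h.psd ht' (x + y)
    have h2 := orth_add_le_exp_mul_rpow (h.psd.posSemidef t') w hv0 hw1 hy fun _ => x
    refine h1.trans (h2.trans ?_)
    have h3 := h.psd.le_orth_comp t' (Sum.inl : Fin n → Fin n ⊕ Fin (N + 1)) x
    refine mul_le_mul (Real.exp_le_exp.2 ?_) (Real.rpow_le_rpow (orth_nonneg _ _) h3 (by positivity))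
      (Real.rpow_nonneg (orth_nonneg _ _) _) (Real.exp_pos _).le
    rw [mul_div_assoc]
    exact mul_le_mul_of_nonneg_left (by linarith) hy.le
  set E := Real.exp (y * (κ⁻¹ ^ 2 * (A * B) * T)) with hE
  have hE0 : 0 < E := Real.exp_pos _
  have h1y : 0 < 1 + y := by linarith
  -- The infimum over families can only be taken once the orthant probability stands alone, so the
  -- power is moved to the other side first and moved back afterwards.
  have h4 : (persist C T (x + y) / E) ^ (1 + y) ≤ persist C T x := by
    refine le_persist fun n t ht => ?_
    have h5 : persist C T (x + y) / E ≤ orth (covMat C t) (fun _ => x) ^ (1 / (1 + y)) := by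
      rw [div_le_iff₀' hE0]
      exact key n t ht
    have h6 := Real.rpow_le_rpow (div_nonneg (persist_nonneg _ _ _) hE0.le) h5 h1y.le
    rwa [← Real.rpow_mul (orth_nonneg _ _), one_div_mul_cancel h1y.ne', Real.rpow_one] at h6
  have h7 := Real.rpow_le_rpow (Real.rpow_nonneg (div_nonneg (persist_nonneg _ _ _) hE0.le) _) h4
    (show 0 ≤ 1 / (1 + y) by positivity)
  rw [← Real.rpow_mul (div_nonneg (persist_nonneg _ _ _) hE0.le), mul_one_div_cancel h1y.ne',
    Real.rpow_one, div_le_iff₀' hE0] at h7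
  exact h7

/-- The persistence exponent of a stationary covariance function. -/
noncomputable def expo (C : ℝ → ℝ) : ℝ :=
  sInf ((fun n : ℕ => -Real.log (persist C n 0) / n) '' Ici 1)

namespace Admissible

variable {C C' : ℝ → ℝ}

lemma neg_log_persist_nonneg (C : ℝ → ℝ) (T x : ℝ) : 0 ≤ -Real.log (persist C T x) :=
  neg_nonneg.2 (Real.log_nonpos (persist_nonneg _ _ _) (persist_le_one _ _ _))

lemma tendsto_nat (h : Admissible C) :
    Tendsto (fun n : ℕ => -Real.log (persist C n 0) / n) atTop (𝓝 (expo C)) := by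
  have hsub : Subadditive fun n : ℕ => -Real.log (persist C n 0) := by
    intro m n
    have h1 := persist_mul_le (T := m) (S := n) h.psd h.nonneg 0
    have h2 := Real.log_le_log (mul_pos (h.persist_pos _) (h.persist_pos _)) h1
    rw [Real.log_mul (h.persist_pos _).ne' (h.persist_pos _).ne'] at h2
    push_cast
    linarith
  have := hsub.tendsto_lim ⟨0, by
    rintro _ ⟨n, rfl⟩
    exact div_nonneg (neg_log_persist_nonneg _ _ _) (Nat.cast_nonneg _)⟩
  rwa [Subadditive.lim] at this

lemma tendsto_zero (h : Admissible C) :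
    Tendsto (fun T : ℝ => -Real.log (persist C T 0) / T) atTop (𝓝 (expo C)) := by
  have hmono : Monotone fun T : ℝ => -Real.log (persist C T 0) := by
    intro S T hST
    exact neg_le_neg (Real.log_le_log (h.persist_pos _) (persist_anti h.psd hST 0))
  have h1 : Tendsto (fun T : ℝ => -Real.log (persist C ⌊T⌋₊ 0) / ⌊T⌋₊ * (⌊T⌋₊ / T)) atTop
      (𝓝 (expo C * 1)) :=
    (h.tendsto_nat.comp (tendsto_nat_floor_atTop (α := ℝ))).mul (tendsto_nat_floor_div_atTop (R := ℝ))
  have h2 : Tendsto (fun T : ℝ => -Real.log (persist C ⌈T⌉₊ 0) / ⌈T⌉₊ * (⌈T⌉₊ / T)) atTop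
      (𝓝 (expo C * 1)) :=
    (h.tendsto_nat.comp (tendsto_nat_ceil_atTop (α := ℝ))).mul (tendsto_nat_ceil_div_atTop (R := ℝ))
  rw [mul_one] at h1 h2
  refine tendsto_of_tendsto_of_tendsto_of_le_of_le' h1 h2 ?_ ?_
  · filter_upwards [eventually_ge_atTop 1] with T hT
    have hf : 0 < ⌊T⌋₊ := Nat.floor_pos.2 hT
    have hf' : (0 : ℝ) < ⌊T⌋₊ := by exact_mod_cast hf
    rw [div_mul_div_cancel₀ hf'.ne']
    exact div_le_div_of_nonneg_right (hmono (Nat.floor_le (by linarith))) (by linarith)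
  · filter_upwards [eventually_ge_atTop 1] with T hT
    have hf : 0 < ⌈T⌉₊ := Nat.ceil_pos.2 (by linarith)
    have hf' : (0 : ℝ) < ⌈T⌉₊ := by exact_mod_cast hf
    rw [div_mul_div_cancel₀ hf'.ne']
    exact div_le_div_of_nonneg_right (hmono (Nat.le_ceil T)) (by linarith)

/-- The persistence exponent is the same for all levels tending to zero. -/
theorem tendsto_level (h : Admissible C) {δ : ℝ → ℝ} (hδ : Tendsto δ atTop (𝓝 0)) :
    (∀ᶠ T in atTop, 0 < persist C T (δ T)) ∧
    Tendsto (fun T : ℝ => -(1 / T * Real.log (persist C T (δ T)))) atTop (𝓝 (expo C)) := by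
  obtain ⟨V, hV, hlev⟩ := h.exists_level_bound
  -- The summand `1 / T` makes `e T` positive, as the level bound requires, while `e T` still
  -- dominates `|δ T|` and tends to zero.
  set e : ℝ → ℝ := fun T => |δ T| + 1 / T with he
  have he0 : Tendsto e atTop (𝓝 0) := by
    have h1 := hδ.abs
    have h2 : Tendsto (fun T : ℝ => 1 / T) atTop (𝓝 0) := by
      simpa using tendsto_inv_atTop_zero (𝕜 := ℝ)
    simpa only [abs_zero, add_zero] using h1.add h2
  have hepos : ∀ T ≥ 1, 0 < e T := fun T hT => by
    have : 0 < 1 / T := by positivity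
    have := abs_nonneg (δ T)
    simp only [he]; linarith
  have hle : ∀ T ≥ 1, δ T ≤ e T ∧ -e T ≤ δ T := fun T hT => by
    have : 0 < 1 / T := by positivity
    have h1 := le_abs_self (δ T)
    have h2 := neg_abs_le (δ T)
    simp only [he]
    constructor <;> linarith
  have hlow : ∀ T ≥ 1, persist C T 0 ≤
      Real.exp (e T * (V * T)) * persist C T (-e T) ^ (1 / (1 + e T)) := fun T hT => by
    have := hlev T hT (e T) (hepos T hT) (-e T)
    rwa [neg_add_cancel] at this
  have hup : ∀ T ≥ 1, persist C T (δ T) ≤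
      Real.exp (e T * (V * T)) * persist C T 0 ^ (1 / (1 + e T)) := fun T hT => by
    have := hlev T hT (e T) (hepos T hT) 0
    rw [zero_add] at this
    exact (persist_mono_level h.psd T (hle T hT).1).trans this
  have hpos' : ∀ T ≥ 1, 0 < persist C T (-e T) := fun T hT => by
    refine (persist_nonneg _ _ _).lt_of_ne fun h0 => ?_
    have h1 := hlow T hT
    have h2 : 0 < 1 + e T := by linarith [hepos T hT]
    rw [← h0, Real.zero_rpow (by positivity), mul_zero] at h1
    exact (h.persist_pos T).not_ge h1
  have hpos : ∀ T ≥ 1, 0 < persist C T (δ T) := fun T hT =>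
    (hpos' T hT).trans_le (persist_mono_level h.psd T (hle T hT).2)
  refine ⟨(eventually_ge_atTop 1).mono hpos, ?_⟩
  have hr := h.tendsto_zero
  have hL : Tendsto (fun T => -Real.log (persist C T 0) / T / (1 + e T) - e T * V) atTop
      (𝓝 (expo C / (1 + 0) - 0 * V)) :=
    (hr.div (he0.const_add 1) (by norm_num)).sub (he0.mul_const V)
  have hU : Tendsto (fun T => (1 + e T) * (-Real.log (persist C T 0) / T + e T * V)) atTop
      (𝓝 ((1 + 0) * (expo C + 0 * V))) :=
    (he0.const_add 1).mul (hr.add (he0.mul_const V))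
  simp only [add_zero, zero_mul, sub_zero, div_one, one_mul] at hL hU
  refine tendsto_of_tendsto_of_tendsto_of_le_of_le' hL hU ?_ ?_
  · filter_upwards [eventually_ge_atTop 1] with T hT
    have hT0 : 0 < T := by linarith
    have h1e : 0 < 1 + e T := by linarith [hepos T hT]
    have h1 := Real.log_le_log (hpos T hT) (hup T hT)
    rw [Real.log_mul (Real.exp_pos _).ne' (Real.rpow_pos_of_pos (h.persist_pos T) _).ne',
      Real.log_exp, Real.log_rpow (h.persist_pos T)] at h1
    have h2 : 1 / T * Real.log (persist C T (δ T)) ≤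
        1 / T * (e T * (V * T) + 1 / (1 + e T) * Real.log (persist C T 0)) :=
      mul_le_mul_of_nonneg_left h1 (by positivity)
    have h3 : 1 / T * (e T * (V * T) + 1 / (1 + e T) * Real.log (persist C T 0)) =
        -(-Real.log (persist C T 0) / T / (1 + e T) - e T * V) := by
      field_simp
      ring
    linarith
  · filter_upwards [eventually_ge_atTop 1] with T hT
    have hT0 : 0 < T := by linarith
    have h1e : 0 < 1 + e T := by linarith [hepos T hT]
    have h1 := Real.log_le_log (h.persist_pos T) (hlow T hT)
    rw [Real.log_mul (Real.exp_pos _).ne' (Real.rpow_pos_of_pos (hpos' T hT) _).ne',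
      Real.log_exp, Real.log_rpow (hpos' T hT)] at h1
    have h0 := Real.log_le_log (hpos' T hT) (persist_mono_level h.psd T (hle T hT).2)
    have h2 : (1 + e T) / T * Real.log (persist C T 0) ≤
        (1 + e T) / T * (e T * (V * T) + 1 / (1 + e T) * Real.log (persist C T (-e T))) :=
      mul_le_mul_of_nonneg_left h1 (by positivity)
    have h3 : (1 + e T) / T * (e T * (V * T) + 1 / (1 + e T) * Real.log (persist C T (-e T))) =
        (1 + e T) * (e T * V) + 1 / T * Real.log (persist C T (-e T)) := by
      field_simp
    have h4 : 1 / T * Real.log (persist C T (-e T)) ≤ 1 / T * Real.log (persist C T (δ T)) :=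
      mul_le_mul_of_nonneg_left h0 (by positivity)
    have h5 : (1 + e T) * (-Real.log (persist C T 0) / T + e T * V) =
        -((1 + e T) / T * Real.log (persist C T 0)) + (1 + e T) * (e T * V) := by
      ring
    rw [h5]
    linarith

lemma expo_le_expo (h : Admissible C) (h' : Admissible C') (hle : ∀ τ, C τ ≤ C' τ) :
    expo C' ≤ expo C := by
  refine le_of_tendsto_of_tendsto h'.tendsto_zero h.tendsto_zero ?_
  filter_upwards [eventually_gt_atTop 0] with T hT
  refine div_le_div_of_nonneg_right (neg_le_neg (Real.log_le_log (h.persist_pos T) ?_)) hT.le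
  exact persist_mono_cov h.psd h'.psd (h.one.trans h'.one.symm) (fun τ _ => hle τ) 0

lemma expo_le_of_tendsto_le (h : Admissible C) {f : ℝ → ℝ} {b : ℝ} (hf : Tendsto f atTop (𝓝 b))
    (hle : ∀ᶠ T in atTop, -Real.log (persist C T 0) / T ≤ f T) : expo C ≤ b :=
  le_of_tendsto_of_tendsto h.tendsto_zero hf hle

lemma le_expo_of_tendsto_le (h : Admissible C) {f : ℝ → ℝ} {b : ℝ} (hf : Tendsto f atTop (𝓝 b))
    (hle : ∀ᶠ T in atTop, f T ≤ -Real.log (persist C T 0) / T) : b ≤ expo C :=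
  le_of_tendsto_of_tendsto hf h.tendsto_zero hle

lemma expo_comp_div (h : Admissible C) {c : ℝ} (hc : 0 < c)
    (h' : Admissible fun τ => C (τ / c)) : expo (fun τ => C (τ / c)) = expo C / c := by
  refine tendsto_nhds_unique h'.tendsto_zero ?_
  have h1 := h.tendsto_zero.comp (tendsto_id.atTop_div_const hc)
  refine (h1.div_const c).congr fun T => ?_
  rw [persist_comp_div h.psd hc]
  simp only [Function.comp, id]
  field_simp

lemma le_expo_of_persist_le_pow (h : Admissible C) {L ρ : ℝ} (hL : 0 < L)
    (hle : ∀ n : ℕ, persist C (n * L) 0 ≤ ρ ^ n) : -Real.log ρ / L ≤ expo C := by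
  have h1 : Tendsto (fun n : ℕ => (n : ℝ) * L) atTop atTop :=
    tendsto_natCast_atTop_atTop.atTop_mul_const hL
  refine ge_of_tendsto (h.tendsto_zero.comp h1) ?_
  filter_upwards [eventually_ge_atTop 1] with n hn
  have hn' : (0 : ℝ) < n := by exact_mod_cast hn
  have h2 := Real.log_le_log (h.persist_pos _) (hle n)
  rw [Real.log_pow] at h2
  simp only [Function.comp]
  rw [div_le_div_iff₀ hL (by positivity)]
  nlinarith

end Admissible

/-! ### Comparison with independent blocks -/

section BlockComparison

lemma CenteredGaussian.map_sum_eq {Ω ι : Type*} [MeasurableSpace Ω] [Fintype ι] {P : Measure Ω}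
    {X : ι → Ω → ℝ} {S : Matrix ι ι ℝ} (h : CenteredGaussian X P S) (w : ι → ℝ) :
    P.map (fun ω => ∑ i, w i * X i ω) = gaussianReal 0 (w ⬝ᵥ S.mulVec w).toNNReal := by
  have hP := h.isProbabilityMeasure
  have h1 := h.linear (Matrix.of fun (_ : Unit) i => w i)
  have h2 := (h1.gaussian.eval ()).map_eq_gaussianReal
  have h3 : ∫ ω, ∑ i, w i * X i ω ∂P = 0 := h1.centered ()
  simp only [Matrix.of_apply] at h2
  rw [h2, h3, variance_of_integral_eq_zero
    (X := fun ω => ∑ i, w i * X i ω) (h1.aemeasurable ()) h3]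
  congr 2
  exact h.integral_sq_sum w

/-- Chernoff for the sum over `s`: on the event the sum is below `-K |s|`, its variance is at most
`B |s|` by the row bound, and `-K / B` is the optimal parameter. -/
lemma CenteredGaussian.real_forall_lt_le {Ω ι : Type*} [MeasurableSpace Ω] [Fintype ι]
    {P : Measure Ω} {X : ι → Ω → ℝ} {S : Matrix ι ι ℝ} (h : CenteredGaussian X P S) {B K : ℝ}
    (hB : 0 < B) (hK : 0 ≤ K) (s : Finset ι) (hs : ∀ i ∈ s, ∑ j ∈ s, S i j ≤ B) :
    P.real {ω | ∀ i ∈ s, X i ω < -K} ≤ Real.exp (-(K ^ 2 / (2 * B))) ^ s.card := by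
  classical
  have hP := h.isProbabilityMeasure
  set w : ι → ℝ := fun i => if i ∈ s then 1 else 0 with hw
  have hsum : ∀ ω, ∑ i, w i * X i ω = ∑ i ∈ s, X i ω := fun ω => by
    simp [hw, ite_mul]
  have hv : w ⬝ᵥ S.mulVec w = ∑ i ∈ s, ∑ j ∈ s, S i j := by
    simp [hw, dotProduct, Matrix.mulVec]
  have hv0 : 0 ≤ w ⬝ᵥ S.mulVec w := by
    have := h.posSemidef.dotProduct_mulVec_nonneg w
    simpa using this
  have hv1 : w ⬝ᵥ S.mulVec w ≤ s.card * B := by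
    rw [hv]
    refine (Finset.sum_le_sum hs).trans ?_
    simp
  have hmap := h.map_sum_eq w
  have hmgf := mgf_gaussianReal hmap (-(K / B))
  have hint : Integrable (fun ω => Real.exp (-(K / B) * ∑ i, w i * X i ω)) P := by
    have h1 : Integrable (fun x => Real.exp (-(K / B) * x))
        (P.map fun ω => ∑ i, w i * X i ω) := by
      rw [hmap]; exact integrable_exp_mul_gaussianReal _
    refine h1.comp_aemeasurable ?_
    exact Finset.aemeasurable_fun_sum _ fun i _ => (h.aemeasurable i).const_mul _
  have hch := measure_le_le_exp_mul_mgf (μ := P) (X := fun ω => ∑ i, w i * X i ω)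
    (-(K * s.card)) (t := -(K / B)) (by rw [neg_nonpos]; positivity) hint
  refine (measureReal_mono (s₂ := {ω | ∑ i, w i * X i ω ≤ -(K * s.card)}) ?_).trans
    (hch.trans ?_)
  · intro ω hω
    change ∑ i, w i * X i ω ≤ _
    rw [hsum]
    refine (Finset.sum_le_sum fun i hi => (hω i hi).le).trans ?_
    simp [mul_comm]
  · rw [hmgf, ← Real.exp_nat_mul, ← Real.exp_add]
    refine Real.exp_le_exp.2 ?_
    rw [Real.coe_toNNReal _ hv0]
    have : (w ⬝ᵥ S.mulVec w) * (-(K / B)) ^ 2 / 2 ≤ (s.card * B) * (-(K / B)) ^ 2 / 2 := by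
      gcongr
    refine (add_le_add_right (add_le_add_right this _) _).trans (le_of_eq ?_)
    field_simp
    ring

/-- Expanding the product over subsets turns the hypothesis into the binomial theorem; joint bounds
on the `A i` thus replace independence. -/
lemma lintegral_prod_add_indicator_le {Ω ι : Type*} [MeasurableSpace Ω] [Fintype ι]
    {P : Measure Ω} [IsProbabilityMeasure P] {A : ι → Set Ω} (hA : ∀ i, MeasurableSet (A i))
    {p θ : ENNReal} (h : ∀ s : Finset ι, P (⋂ i ∈ s, A i) ≤ θ ^ s.card) :
    ∫⁻ ω, ∏ i, ((A i).indicator 1 ω + p) ∂P ≤ (θ + p) ^ Fintype.card ι := by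
  classical
  have hprod : ∀ (s : Finset ι) (ω : Ω), ∏ i ∈ s, ((A i).indicator 1 ω : ENNReal) =
      (⋂ i ∈ s, A i).indicator 1 ω := by
    intro s ω
    by_cases hω : ∀ i ∈ s, ω ∈ A i
    · rw [indicator_of_mem (by simpa using hω)]
      exact Finset.prod_eq_one fun i hi => by simp [hω i hi]
    · rw [indicator_of_notMem (by simpa using hω)]
      push Not at hω
      obtain ⟨i, hi, hi'⟩ := hω
      exact Finset.prod_eq_zero hi (by simp [hi'])
  have hm : ∀ s : Finset ι, MeasurableSet (⋂ i ∈ s, A i) := fun s =>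
    Finset.measurableSet_biInter s fun i _ => hA i
  simp_rw [Finset.prod_add, hprod, Finset.prod_const]
  rw [lintegral_finsetSum _ fun s _ => (measurable_one.indicator (hm s)).mul_const _]
  refine (Finset.sum_le_sum (g := fun s : Finset ι =>
    θ ^ s.card * p ^ ((Finset.univ : Finset ι).card - s.card)) fun s hs => ?_).trans (le_of_eq ?_)
  · rw [lintegral_mul_const _ (measurable_one.indicator (hm s)), lintegral_indicator_one (hm s),
      Finset.card_sdiff_of_subset (Finset.subset_univ s)]
    gcongr
    exact h s
  · rw [Finset.sum_pow_mul_eq_add_pow, Finset.card_univ]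

/-- The Ornstein-Uhlenbeck covariance function. -/
noncomputable def ouCov (τ : ℝ) : ℝ := Real.exp (-(|τ| / 2))

/-- The total mass of the correlations `2 ^ (-|k|)`. -/
noncomputable def geomMass : ℝ := ∑' k : ℤ, (1 / 2 : ℝ) ^ k.natAbs

lemma geomMass_pos : 0 < geomMass := by
  have := sum_pow_natAbs_le {(0 : ℤ)} (r := 1 / 2) (by norm_num) (by norm_num)
    Function.injective_id
  simp only [id, Finset.sum_singleton, Int.natAbs_zero, pow_zero] at this
  unfold geomMass
  linarith

/-- The spacing `2 log 2` makes neighbouring correlations equal to `1/2`; positive semidefiniteness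
of `2 ^ (-|k - l|)` is then inherited from `ouCov`. -/
lemma covMat_ouCov_nat {n : ℕ} (k l : Fin n) :
    covMat ouCov (fun k : Fin n => 2 * Real.log 2 * (k : ℕ)) k l =
      (1 / 2 : ℝ) ^ (((k : ℕ) : ℤ) - (l : ℕ)).natAbs := by
  simp only [covMat, Matrix.of_apply, ouCov]
  rw [← mul_sub, abs_mul, abs_of_pos (by positivity),
    show -(2 * Real.log 2 * |((k : ℕ) : ℝ) - (l : ℕ)| / 2) =
      (((((k : ℕ) : ℤ) - (l : ℕ)).natAbs : ℕ) : ℝ) * (-Real.log 2) by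
      rw [Nat.cast_natAbs]; push_cast; ring, Real.exp_nat_mul, Real.exp_neg,
    Real.exp_log (by norm_num)]
  norm_num

/-- By Slepian, the process at the times `k L + t i` is compared with `√(1-γ) Z^k_i + √γ g_k`, where
the `Z^k` are independent with covariance `C'` and `g` has correlations `2 ^ (-|k - l|)`. A block
with `g_k ≥ -K` stays nonpositive only if `Z^k ≤ K √γ / √(1-γ)`. Blocks with `g_k < -K` are bounded
by one, and any prescribed set of them costs a factor `exp (-K² / (2 geomMass))` per block. -/
theorem persist_le_pow_of_block {C C' : ℝ → ℝ} (hC : PSDFun C) (hC' : PSDFun C')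
    (hOU : PSDFun ouCov) (h1 : C 0 = 1) (h1' : C' 0 = 1) {m : ℕ} {t : Fin m → ℝ} {M L γ K : ℝ}
    (ht : ∀ i, t i ∈ Icc 0 M) (hML : M ≤ L) (hγ0 : 0 < γ) (hγ1 : γ < 1) (hK : 0 ≤ K)
    (hin : ∀ i j, C (t i - t j) ≤ (1 - γ) * C' (t i - t j) + γ)
    (hout : ∀ k l : ℕ, k ≠ l → ∀ i j, C (k * L + t i - (l * L + t j)) ≤
      γ * (1 / 2) ^ ((k : ℤ) - l).natAbs) (n : ℕ) :
    persist C (n * L) 0 ≤ (Real.exp (-(K ^ 2 / (2 * geomMass))) +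
      orth (covMat C' t) fun _ => K * √γ / √(1 - γ)) ^ n := by
  classical
  -- An empty block is handled separately because `0 ≤ M` is deduced from a point of the block.
  rcases Nat.eq_zero_or_pos m with rfl | hm
  · have hone : orth (covMat C' t) (fun _ => K * √γ / √(1 - γ)) = 1 := by
      unfold orth
      rw [show {x : Fin 0 → ℝ | ∀ i, x i ≤ K * √γ / √(1 - γ)} = univ by ext x; simp]
      simp
    refine (persist_le_one _ _ _).trans (one_le_pow₀ ?_)
    rw [hone]
    linarith [Real.exp_pos (-(K ^ 2 / (2 * geomMass)))]
  have hM : 0 ≤ M := (ht ⟨0, hm⟩).1.trans (ht ⟨0, hm⟩).2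
  have hL : 0 ≤ L := hM.trans hML
  set R := covMat ouCov (fun k : Fin n => 2 * Real.log 2 * (k : ℕ)) with hR
  have hRpsd : R.PosSemidef := hOU.posSemidef _
  let pts : (Σ _ : Fin n, Fin m) → ℝ := fun p => (p.1 : ℕ) * L + t p.2
  have hpts : ∀ p, pts p ∈ Icc 0 (n * L) := by
    rintro ⟨k, i⟩
    have hi := ht i
    have hk : ((k : ℕ) : ℝ) + 1 ≤ n := by exact_mod_cast k.2
    have hkL := mul_le_mul_of_nonneg_right hk hL
    have : 0 ≤ ((k : ℕ) : ℝ) * L := by positivity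
    constructor
    · change 0 ≤ ((k : ℕ) : ℝ) * L + t i
      linarith [hi.1]
    · change ((k : ℕ) : ℝ) * L + t i ≤ _
      linarith [hi.2]
  have hsq1 : √(1 - γ) ^ 2 = 1 - γ := Real.sq_sqrt (by linarith)
  have hsq2 : √γ ^ 2 = γ := Real.sq_sqrt hγ0.le
  have hB : ∀ k : Fin n, (covMat C' t).PosSemidef := fun _ => hC' _ _
  have hG := ((CenteredGaussian.blockDiagonal' hB).const_mul √(1 - γ)).add_prod
    (((CenteredGaussian.of_gaussN hRpsd).comp
      (Sigma.fst : (Σ _ : Fin n, Fin m) → Fin n)).const_mul √γ)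
  rw [hsq1, hsq2] at hG
  have hcmp : orth (covMat C pts) (fun _ => 0) ≤
      orth ((1 - γ) • Matrix.blockDiagonal' (fun _ : Fin n => covMat C' t) +
        γ • R.submatrix Sigma.fst Sigma.fst) fun _ => 0 := by
    refine orth_le_orth_of_le hG.posSemidef (hC.posSemidef _) ?_ ?_ _
    · rintro ⟨k, i⟩
      simp only [Matrix.add_apply, Matrix.smul_apply, Matrix.blockDiagonal'_apply_eq,
        Matrix.submatrix_apply, hR, covMat_ouCov_nat]
      simp [covMat, h1, h1']
    · rintro ⟨k, i⟩ ⟨l, j⟩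
      simp only [Matrix.add_apply, Matrix.smul_apply, Matrix.submatrix_apply, hR, covMat_ouCov_nat,
        smul_eq_mul]
      rcases eq_or_ne k l with rfl | hkl
      · rw [Matrix.blockDiagonal'_apply_eq]
        simp only [sub_self, Int.natAbs_zero, pow_zero, mul_one]
        refine le_trans (le_of_eq ?_) (hin i j)
        simp [covMat, pts]
      · rw [Matrix.blockDiagonal'_apply_ne _ _ _ hkl, mul_zero, zero_add]
        exact hout k l (fun h => hkl (Fin.ext h)) i j
  refine (persist_le_orth' hC hpts 0).trans (hcmp.trans ?_)
  rw [← hG.real_le]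
  set θ := Real.exp (-(K ^ 2 / (2 * geomMass))) with hθ
  set x₀ := K * √γ / √(1 - γ) with hx₀
  set Pz := Measure.pi fun _ : Fin n => gaussN (covMat C' t)
  set A : Fin n → Set (Fin n → ℝ) := fun k => {r | r k < -K} with hA
  have hAm : ∀ k, MeasurableSet (A k) := fun k =>
    measurableSet_lt (measurable_pi_apply k) measurable_const
  set p := gaussN (covMat C' t) {x | ∀ i, x i ≤ x₀} with hp
  have hs1 : 0 < √(1 - γ) := Real.sqrt_pos.2 (by linarith)
  have hset : MeasurableSet {ω : (Fin n → Fin m → ℝ) × (Fin n → ℝ) |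
      ∀ q : Σ _ : Fin n, Fin m, √(1 - γ) * ω.1 q.1 q.2 + √γ * ω.2 q.1 ≤ 0} :=
    measurableSet_forall_le (fun _ => 0) fun q => by
      have h1 : Measurable fun ω : (Fin n → Fin m → ℝ) × (Fin n → ℝ) => ω.1 q.1 q.2 :=
        (measurable_pi_apply q.2).comp ((measurable_pi_apply q.1).comp measurable_fst)
      fun_prop
  have hfin : (Pz.prod (gaussN R)) {ω : (Fin n → Fin m → ℝ) × (Fin n → ℝ) |
      ∀ q : Σ _ : Fin n, Fin m, √(1 - γ) * ω.1 q.1 q.2 + √γ * ω.2 q.1 ≤ 0} ≤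
      (ENNReal.ofReal θ + p) ^ n := by
    rw [Measure.prod_apply_symm hset]
    -- For a fixed value `r` of the common noise the blocks are independent, so the inner integral
    -- is a product.
    refine (lintegral_mono (g := fun r => ∏ k, ((A k).indicator 1 r + p)) fun r => ?_).trans
      ((lintegral_prod_add_indicator_le (θ := ENNReal.ofReal θ) hAm fun s => ?_).trans
        (le_of_eq (by rw [Fintype.card_fin])))
    · have : (fun z : Fin n → Fin m → ℝ => (z, r)) ⁻¹' {ω | ∀ q : Σ _ : Fin n, Fin m,
          √(1 - γ) * ω.1 q.1 q.2 + √γ * ω.2 q.1 ≤ 0} ⊆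
          univ.pi fun k => {x | ∀ i, √(1 - γ) * x i + √γ * r k ≤ 0} := by
        intro z hz k _ i
        exact hz ⟨k, i⟩
      refine (measure_mono this).trans ?_
      rw [Measure.pi_pi]
      refine Finset.prod_le_prod' fun k _ => ?_
      by_cases hk : r ∈ A k
      · rw [indicator_of_mem hk]
        exact prob_le_one.trans le_self_add
      · rw [indicator_of_notMem hk, zero_add]
        refine measure_mono fun x hx i => ?_
        have h2 : -K ≤ r k := not_lt.1 hk
        have h3 := hx i
        rw [hx₀, le_div_iff₀ hs1]
        have h4 := mul_le_mul_of_nonneg_left h2 (Real.sqrt_nonneg γ)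
        linarith
    · have h2 := (CenteredGaussian.of_gaussN hRpsd).real_forall_lt_le geomMass_pos hK s
        (fun k _ => by
          simp_rw [hR, covMat_ouCov_nat]
          refine sum_pow_natAbs_le s (by norm_num) (by norm_num)
            (f := fun l : Fin n => ((k : ℕ) : ℤ) - (l : ℕ)) ?_
          intro a b hab
          simp at hab
          exact Fin.ext hab)
      have h3 : (⋂ k ∈ s, A k) = {r | ∀ k ∈ s, r k < -K} := by
        ext r; simp [hA]
      rw [h3, ← ENNReal.ofReal_pow (Real.exp_pos _).le]
      exact ENNReal.le_ofReal_iff_toReal_le (measure_ne_top _ _) (by positivity) |>.2 h2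
  have := ENNReal.toReal_mono (by
    exact ENNReal.pow_ne_top (ENNReal.add_ne_top.2 ⟨ENNReal.ofReal_ne_top, measure_ne_top _ _⟩)) hfin
  rw [ENNReal.toReal_pow, ENNReal.toReal_add ENNReal.ofReal_ne_top (measure_ne_top _ _),
    ENNReal.toReal_ofReal (Real.exp_pos _).le] at this
  exact this

end BlockComparison

/-! ### Lower semicontinuity of persistence exponents -/

section Semicontinuity

lemma Admissible.expo_nonneg {C : ℝ → ℝ} (h : Admissible C) : 0 ≤ expo C := by
  refine ge_of_tendsto h.tendsto_zero ?_
  filter_upwards [eventually_gt_atTop 0] with T hT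
  exact div_nonneg (Admissible.neg_log_persist_nonneg _ _ _) hT.le

/-- The noise threshold satisfies `K² = a M` and the noise weight is `γ = 4 exp (-η M / 2)`:
exponential decay beats linear growth, so the level seen by a block still tends to zero. -/
lemma tendsto_block_level (a : ℝ) {η : ℝ} (hη : 0 < η) :
    Tendsto (fun M => √(a * M) * √(4 * Real.exp (-(η * M / 2))) /
      √(1 - 4 * Real.exp (-(η * M / 2)))) atTop (𝓝 0) := by
  have hlin : Tendsto (fun M : ℝ => η * M / 2) atTop atTop :=
    (tendsto_id.const_mul_atTop hη).atTop_div_const (by norm_num)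
  have h0 := (Real.tendsto_pow_mul_exp_neg_atTop_nhds_zero 0).comp hlin
  have h1 := (Real.tendsto_pow_mul_exp_neg_atTop_nhds_zero 1).comp hlin
  simp only [Function.comp_def, pow_zero, one_mul, pow_one] at h0 h1
  have h2 : Tendsto (fun M => √(a * (8 / η) * (η * M / 2 * Real.exp (-(η * M / 2))))) atTop
      (𝓝 √(a * (8 / η) * 0)) := (h1.const_mul _).sqrt
  have h3 : Tendsto (fun M => √(1 - 4 * Real.exp (-(η * M / 2)))) atTop (𝓝 √(1 - 4 * 0)) :=
    ((h0.const_mul 4).const_sub 1).sqrt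
  have h4 := h2.div h3 (by norm_num)
  rw [mul_zero, Real.sqrt_zero, zero_div] at h4
  refine h4.congr fun M => ?_
  simp only [Pi.div_apply]
  rw [← Real.sqrt_mul' _ (by positivity)]
  congr 2
  field_simp
  ring

/-- Blocks of length `M` start every `(1 + η) M`, so points of blocks with index difference `d + 1`
are at least `(d + 1) η M` apart. Of the resulting `q ^ (d + 1)`, with `q ≤ 1/2`, one factor `q` is
kept for the weight `γ = 4 q`. -/
lemma exp_decay_block_le {C : ℝ → ℝ} (hC : ∀ τ, C τ ≤ 2 * Real.exp (-(|τ| / 2))) {η M : ℝ}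
    (hη : 0 < η) (hM : 0 < M) (hq : Real.exp (-(η * M / 2)) ≤ 1 / 2) {s t : ℝ}
    (hs : s ∈ Icc 0 M) (ht : t ∈ Icc 0 M) {k l : ℕ} (hkl : k ≠ l) :
    C (k * ((1 + η) * M) + s - (l * ((1 + η) * M) + t)) ≤
      4 * Real.exp (-(η * M / 2)) * (1 / 2) ^ ((k : ℤ) - l).natAbs := by
  obtain ⟨d, hd⟩ : ∃ d, ((k : ℤ) - l).natAbs = d + 1 :=
    Nat.exists_eq_succ_of_ne_zero (by omega)
  have hdr : |(k : ℝ) - l| = d + 1 := by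
    have : ((((k : ℤ) - l).natAbs : ℕ) : ℝ) = ((d + 1 : ℕ) : ℝ) := by rw [hd]
    rw [Nat.cast_natAbs] at this
    push_cast at this
    exact this
  have hL : 0 < (1 + η) * M := by positivity
  have habs : (d + 1) * (η * M) ≤ |k * ((1 + η) * M) + s - (l * ((1 + η) * M) + t)| := by
    have h1 : k * ((1 + η) * M) + s - (l * ((1 + η) * M) + t) =
      ((k : ℝ) - l) * ((1 + η) * M) - (t - s) := by ring
    have h2 := abs_sub_abs_le_abs_sub (((k : ℝ) - l) * ((1 + η) * M)) (t - s)
    rw [abs_mul, hdr, abs_of_pos hL] at h2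
    have h3 : |t - s| ≤ M := by
      rw [abs_le]; constructor <;> linarith [hs.1, hs.2, ht.1, ht.2]
    rw [h1]
    have : 0 ≤ (d : ℝ) * M := by positivity
    nlinarith
  set q := Real.exp (-(η * M / 2)) with hqdef
  have hq0 : 0 < q := Real.exp_pos _
  rw [hd]
  calc _ ≤ 2 * Real.exp (-((d + 1) * (η * M) / 2)) := by
        refine (hC _).trans ?_
        gcongr
    _ = 2 * (q ^ d * q) := by
        rw [← pow_succ, hqdef, ← Real.exp_nat_mul]
        congr 2
        push_cast
        ring
    _ ≤ 2 * ((1 / 2) ^ d * q) := by gcongr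
    _ = 4 * q * (1 / 2) ^ (d + 1) := by rw [pow_succ]; ring

/-- Finitely many times in a window of length `M` witness the exponent of `C₀` at the block level.
On them `C β ≤ (1-γ) C₀ + γ` eventually holds, since `C₀ < 1` off zero leaves room; the uniform
exponential bound takes care of pairs in different blocks. The converse inequality is not claimed
here: in the applications it follows from monotonicity. -/
theorem eventually_sub_le_expo {α : Type*} {l : Filter α} {C : α → ℝ → ℝ} {C₀ : ℝ → ℝ}
    (h₀ : Admissible C₀) (hlt : ∀ τ, τ ≠ 0 → C₀ τ < 1) (hOU : PSDFun ouCov)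
    (hC : ∀ᶠ β in l, Admissible (C β) ∧ ∀ τ, C β τ ≤ 2 * Real.exp (-(|τ| / 2)))
    (hlim : ∀ τ, Tendsto (fun β => C β τ) l (𝓝 (C₀ τ))) {ε : ℝ} (hε : 0 < ε) :
    ∀ᶠ β in l, expo C₀ - ε ≤ expo (C β) := by
  set b := expo C₀ with hb
  have hb0 : 0 ≤ b := h₀.expo_nonneg
  -- The gaps between blocks dilute the exponent by the factor `1 + η`, at a cost of at most `ε /
  -- 2`.
  set η := ε / (2 * (b + 1)) with hη
  have hη0 : 0 < η := by positivity
  have hηb : η * b ≤ ε / 2 := by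
    rw [hη, div_mul_eq_mul_div, div_le_div_iff₀ (by positivity) (by norm_num)]
    nlinarith
  -- With this `a` the Chernoff factor becomes `exp (-(b + 1) M)`, smaller than the bound `exp (-(b
  -- - ε/4) M)` for a block. The resulting factor `2` is absorbed by `hMlog`.
  set a := 2 * geomMass * (b + 1) with ha
  have ha0 : 0 < a := by have := geomMass_pos; positivity
  obtain ⟨hpos, hten⟩ := h₀.tendsto_level (tendsto_block_level a hη0)
  have hlin : Tendsto (fun M : ℝ => η * M / 2) atTop atTop :=
    (tendsto_id.const_mul_atTop hη0).atTop_div_const (by norm_num)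
  have hexp : Tendsto (fun M : ℝ => Real.exp (-(η * M / 2))) atTop (𝓝 0) :=
    Real.tendsto_exp_neg_atTop_nhds_zero.comp hlin
  obtain ⟨M, hMpos, hMb, hMq, hM0, hMlog⟩ := (hpos.and ((hten.eventually_const_lt
    (show b - ε / 4 < b by linarith)).and ((hexp.eventually_lt_const
    (show (0 : ℝ) < 1 / 4 by norm_num)).and ((eventually_gt_atTop (0 : ℝ)).and
    (eventually_ge_atTop (Real.log 2 / (ε / 4))))))).exists
  set q := Real.exp (-(η * M / 2)) with hq
  set γ := 4 * q with hγ
  set K := √(a * M) with hK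
  have hq0 : 0 < q := Real.exp_pos _
  have hp : persist C₀ M (K * √γ / √(1 - γ)) < Real.exp (-((b - ε / 4) * M)) := by
    rw [← Real.log_lt_iff_lt_exp hMpos]
    have : 1 / M * Real.log (persist C₀ M (K * √γ / √(1 - γ))) < -(b - ε / 4) := by linarith
    rw [one_div, inv_mul_lt_iff₀ hM0] at this
    linarith
  obtain ⟨n, t, ht, hor⟩ := exists_orth_lt hp
  have hin : ∀ᶠ β in l, ∀ i j : Fin n, C₀ (t i - t j) < 1 →
      C β (t i - t j) ≤ (1 - γ) * C₀ (t i - t j) + γ := by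
    rw [eventually_all]; intro i
    rw [eventually_all]; intro j
    by_cases hij : C₀ (t i - t j) < 1
    · have : C₀ (t i - t j) < (1 - γ) * C₀ (t i - t j) + γ := by
        have h1 : 0 < γ * (1 - C₀ (t i - t j)) := mul_pos (by positivity) (by linarith)
        linarith
      filter_upwards [(hlim (t i - t j)).eventually_le_const this] with β hβ _ using hβ
    · exact Eventually.of_forall fun β h => absurd h hij
  filter_upwards [hC, hin] with β hβ hβin
  have hL : 0 < (1 + η) * M := by positivity
  have hblock := persist_le_pow_of_block hβ.1.psd h₀.psd hOU hβ.1.one h₀.one ht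
    (show M ≤ (1 + η) * M by nlinarith) (show 0 < γ by positivity)
    (show γ < 1 by simp only [hγ]; linarith) (Real.sqrt_nonneg (a * M)) (fun i j => by
      by_cases hij : t i - t j = 0
      · rw [hij, hβ.1.one, h₀.one]; linarith
      · exact hβin i j (hlt _ hij))
    (fun k l hkl i j => exp_decay_block_le hβ.2 hη0 hM0 (by linarith) (ht i) (ht j) hkl)
  have h1 := hβ.1.le_expo_of_persist_le_pow hL hblock
  refine le_trans ?_ h1
  have hθ : Real.exp (-(√(a * M) ^ 2 / (2 * geomMass))) = Real.exp (-((b + 1) * M)) := by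
    rw [Real.sq_sqrt (by positivity), ha]
    have := geomMass_pos
    congr 2
    field_simp
  set ρ := Real.exp (-(√(a * M) ^ 2 / (2 * geomMass))) +
    orth (covMat C₀ t) fun _ => √(a * M) * √γ / √(1 - γ) with hρ
  have hρ0 : 0 < ρ := add_pos_of_pos_of_nonneg (Real.exp_pos _) (orth_nonneg _ _)
  have hρ1 : ρ ≤ 2 * Real.exp (-((b - ε / 4) * M)) := by
    rw [hρ, hθ]
    have : Real.exp (-((b + 1) * M)) ≤ Real.exp (-((b - ε / 4) * M)) :=
      Real.exp_le_exp.2 (by nlinarith)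
    linarith
  have h2 := Real.log_le_log hρ0 hρ1
  rw [Real.log_mul (by norm_num) (Real.exp_pos _).ne', Real.log_exp] at h2
  rw [le_div_iff₀ hL]
  have h3 : Real.log 2 ≤ M * (ε / 4) := by
    rwa [div_le_iff₀ (by positivity)] at hMlog
  have h4 : 0 ≤ η * ε * M := by positivity
  have h5 : η * b * M ≤ ε / 2 * M := mul_le_mul_of_nonneg_right hηb hM0.le
  nlinarith

end Semicontinuity

/-! ### Gaussian random walks staying nonnegative -/

section Walk

/-- The partial sums of the sequence `σ j * ξ j`. -/
def walk {Ω : Type*} (ξ : ℕ → Ω → ℝ) (σ : ℕ → ℝ) (k : ℕ) (ω : Ω) : ℝ :=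
  ∑ j ∈ Finset.range (k + 1), σ j * ξ j ω

/-- The event that the walk is nonnegative up to time `k`. -/
def walkNonneg {Ω : Type*} (ξ : ℕ → Ω → ℝ) (σ : ℕ → ℝ) (k : ℕ) : Set Ω :=
  {ω | ∀ j ≤ k, 0 ≤ walk ξ σ j ω}

lemma walk_succ {Ω : Type*} (ξ : ℕ → Ω → ℝ) (σ : ℕ → ℝ) (k : ℕ) (ω : Ω) :
    walk ξ σ (k + 1) ω = walk ξ σ k ω + σ (k + 1) * ξ (k + 1) ω :=
  Finset.sum_range_succ _ _

lemma walkNonneg_succ {Ω : Type*} (ξ : ℕ → Ω → ℝ) (σ : ℕ → ℝ) (k : ℕ) :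
    walkNonneg ξ σ (k + 1) = walkNonneg ξ σ k ∩ {ω | 0 ≤ walk ξ σ (k + 1) ω} := by
  ext ω
  constructor
  · intro h
    exact ⟨fun j hj => h j (by omega), h _ le_rfl⟩
  · rintro ⟨h1, h2⟩ j hj
    rcases Nat.le_succ_iff.1 hj with hj | rfl
    · exact h1 j hj
    · exact h2

/-- `ξ` is a family of independent standard Gaussian variables. -/
structure IsStdGaussianFamily {Ω ι : Type*} [MeasurableSpace Ω] (ξ : ι → Ω → ℝ) (P : Measure Ω) :
    Prop where
  measurable : ∀ i, Measurable (ξ i)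
  law : ∀ i, P.map (ξ i) = gaussianReal 0 1
  indep : iIndepFun ξ P

variable {Ω ι : Type*} [MeasurableSpace Ω] {P : Measure Ω}

namespace IsStdGaussianFamily

lemma hasGaussianLaw {ξ : ι → Ω → ℝ} (h : IsStdGaussianFamily ξ P) (i : ι) :
    HasGaussianLaw (ξ i) P := ⟨by rw [h.law]; infer_instance⟩

lemma integral_comp {ξ : ι → Ω → ℝ} (h : IsStdGaussianFamily ξ P) (i : ι) {f : ℝ → ℝ}
    (hf : Measurable f) : ∫ ω, f (ξ i ω) ∂P = ∫ x, f x ∂gaussianReal 0 1 := by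
  rw [← h.law i, integral_map (h.measurable i).aemeasurable hf.aestronglyMeasurable]

lemma integral_eq_zero {ξ : ι → Ω → ℝ} (h : IsStdGaussianFamily ξ P) (i : ι) :
    ∫ ω, ξ i ω ∂P = 0 := by
  rw [h.integral_comp i (f := fun x => x) (by fun_prop)]
  exact integral_id_gaussianReal

lemma integral_sq {ξ : ι → Ω → ℝ} (h : IsStdGaussianFamily ξ P) (i : ι) :
    ∫ ω, ξ i ω ^ 2 ∂P = 1 := by
  rw [h.integral_comp i (f := fun x => x ^ 2) (by fun_prop)]
  have := variance_id_gaussianReal (μ := 0) (v := 1)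
  rw [variance_eq_integral (by fun_prop)] at this
  simpa [integral_id_gaussianReal] using this

lemma memLp {ξ : ι → Ω → ℝ} (h : IsStdGaussianFamily ξ P) (i : ι) : MemLp (ξ i) 2 P :=
  (h.hasGaussianLaw i).memLp_two

lemma integrable {ξ : ι → Ω → ℝ} (h : IsStdGaussianFamily ξ P) (i : ι) : Integrable (ξ i) P :=
  (h.hasGaussianLaw i).integrable

lemma integral_mul {ξ : ι → Ω → ℝ} (h : IsStdGaussianFamily ξ P) {i j : ι} (hij : i ≠ j) :
    ∫ ω, ξ i ω * ξ j ω ∂P = 0 := by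
  rw [(h.indep.indepFun hij).integral_fun_mul_eq_mul_integral
    (h.measurable i).aestronglyMeasurable (h.measurable j).aestronglyMeasurable,
    h.integral_eq_zero, zero_mul]

lemma centeredGaussian {κ : Type*} [Fintype κ] [DecidableEq κ] {ξ : ι → Ω → ℝ}
    (h : IsStdGaussianFamily ξ P) {e : κ → ι} (he : e.Injective) :
    CenteredGaussian (fun k => ξ (e k)) P 1 := by
  refine ⟨iIndepFun.hasGaussianLaw (fun k => h.hasGaussianLaw _) (h.indep.precomp he),
    fun k => h.integral_eq_zero _, fun k l => ?_⟩
  rcases eq_or_ne k l with rfl | hkl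
  · rw [Matrix.one_apply_eq, ← h.integral_sq (e k)]
    simp_rw [sq]
  · rw [Matrix.one_apply_ne hkl, h.integral_mul (he.ne hkl)]

end IsStdGaussianFamily

variable {ξ : ℕ → Ω → ℝ} {σ : ℕ → ℝ}

namespace IsStdGaussianFamily

lemma measurable_walk (h : IsStdGaussianFamily ξ P) (σ : ℕ → ℝ) (k : ℕ) :
    Measurable (walk ξ σ k) :=
  Finset.measurable_fun_sum _ fun j _ => (h.measurable j).const_mul _

lemma integrable_walk (h : IsStdGaussianFamily ξ P) (σ : ℕ → ℝ) (k : ℕ) :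
    Integrable (walk ξ σ k) P :=
  integrable_finsetSum _ fun j _ => (h.integrable j).const_mul _

lemma measurableSet_walkNonneg (h : IsStdGaussianFamily ξ P) (σ : ℕ → ℝ) (k : ℕ) :
    MeasurableSet (walkNonneg ξ σ k) := by
  have : walkNonneg ξ σ k = ⋂ j ∈ Finset.range (k + 1), {ω | 0 ≤ walk ξ σ j ω} := by
    ext ω
    simp [walkNonneg]
  rw [this]
  exact Finset.measurableSet_biInter _ fun j _ =>
    measurableSet_le measurable_const (h.measurable_walk σ j)

/-- The event depends only on `ξ 0, …, ξ k`, hence is independent of the centered variable `ξ (k +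
1)`. -/
lemma setIntegral_next (h : IsStdGaussianFamily ξ P) (σ : ℕ → ℝ) (k : ℕ) :
    ∫ ω in walkNonneg ξ σ k, ξ (k + 1) ω ∂P = 0 := by
  classical
  have hind := h.indep.indepFun_finset (Finset.range (k + 1)) {k + 1} (by simp) h.measurable
  let ext : (Finset.range (k + 1) → ℝ) → ℕ → ℝ := fun x j =>
    if hj : j ∈ Finset.range (k + 1) then x ⟨j, hj⟩ else 0
  have hext : ∀ j, Measurable fun x => ext x j := by
    intro j
    by_cases hj : j ∈ Finset.range (k + 1)
    · simp only [ext, hj, dite_true]; fun_prop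
    · simp only [ext, hj, dite_false]; fun_prop
  let D : Set (Finset.range (k + 1) → ℝ) :=
    ⋂ j ∈ Finset.range (k + 1), {x | 0 ≤ walk (fun i x => ext x i) σ j x}
  have hD : MeasurableSet D := Finset.measurableSet_biInter _ fun j _ =>
    measurableSet_le measurable_const
      (Finset.measurable_fun_sum _ fun i _ => (hext i).const_mul _)
  have hpr : Measurable fun x : ({k + 1} : Finset ℕ) → ℝ => x ⟨k + 1, by simp⟩ :=
    measurable_pi_apply _
  have h1 := hind.comp (φ := D.indicator (1 : (Finset.range (k + 1) → ℝ) → ℝ))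
    (ψ := fun x : ({k + 1} : Finset ℕ) → ℝ => x ⟨k + 1, by simp⟩)
    (measurable_one.indicator hD) hpr
  have h2 : (walkNonneg ξ σ k).indicator (1 : Ω → ℝ) =
      (D.indicator 1) ∘ fun ω (i : Finset.range (k + 1)) => ξ i ω := by
    ext ω
    have hiff : ω ∈ walkNonneg ξ σ k ↔ (fun (i : Finset.range (k + 1)) => ξ i ω) ∈ D := by
      simp only [walkNonneg, D, mem_iInter, Finset.mem_range, Nat.lt_succ_iff]
      refine forall_congr' fun j => forall_congr' fun hj => ?_
      change _ ↔ 0 ≤ walk _ σ j _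
      have : walk ξ σ j ω = walk (fun i x => ext x i) σ j
          (fun (i : Finset.range (k + 1)) => ξ i ω) := by
        refine Finset.sum_congr rfl fun i hi => ?_
        have hik : i ∈ Finset.range (k + 1) := by
          rw [Finset.mem_range] at hi ⊢; omega
        simp only [ext, hik, dite_true]
      rw [this]
    by_cases hω : ω ∈ walkNonneg ξ σ k
    · rw [indicator_of_mem hω, Function.comp_apply, indicator_of_mem (hiff.1 hω)]; rfl
    · rw [indicator_of_notMem hω, Function.comp_apply, indicator_of_notMem (mt hiff.2 hω)]
  rw [← h2] at h1
  have h3 := h1.integral_mul_eq_mul_integral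
    (measurable_one.indicator (h.measurableSet_walkNonneg σ k)).aestronglyMeasurable
    (h.measurable (k + 1)).aestronglyMeasurable
  have h4 : ∫ ω, ((fun x : ({k + 1} : Finset ℕ) → ℝ => x ⟨k + 1, by simp⟩) ∘
      fun ω (i : ({k + 1} : Finset ℕ)) => ξ i ω) ω ∂P = 0 := h.integral_eq_zero (k + 1)
  rw [h4, mul_zero] at h3
  rw [← integral_indicator (h.measurableSet_walkNonneg σ k), ← h3]
  refine integral_congr_ae (ae_of_all _ fun ω => ?_)
  by_cases hω : ω ∈ walkNonneg ξ σ k <;> simp [hω]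

/-- The walk is a martingale, so its mean on the survival event changes only by discarding the paths
that have just become negative, that is, by the overshoot. -/
lemma setIntegral_walk_succ (h : IsStdGaussianFamily ξ P) (σ : ℕ → ℝ) (k : ℕ) :
    ∫ ω in walkNonneg ξ σ (k + 1), walk ξ σ (k + 1) ω ∂P =
      ∫ ω in walkNonneg ξ σ k, walk ξ σ k ω ∂P +
      ∫ ω in walkNonneg ξ σ k, max (-walk ξ σ (k + 1) ω) 0 ∂P := by
  have hm := h.measurable_walk σ (k + 1)
  have i1 := (h.integrable_walk σ k).integrableOn (s := walkNonneg ξ σ k)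
  have i2 := ((h.integrable (k + 1)).const_mul (σ (k + 1))).integrableOn (s := walkNonneg ξ σ k)
  have i3 := (h.integrable_walk σ (k + 1)).neg_part.integrableOn (s := walkNonneg ξ σ k)
  have e1 : ∫ ω in walkNonneg ξ σ k, walk ξ σ k ω ∂P =
      ∫ ω in walkNonneg ξ σ k, walk ξ σ (k + 1) ω ∂P := by
    simp_rw [walk_succ]
    rw [integral_add i1 i2, integral_const_mul, h.setIntegral_next, mul_zero, add_zero]
  rw [e1, ← integral_add (h.integrable_walk σ (k + 1)).integrableOn i3, walkNonneg_succ,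
    ← integral_indicator ((h.measurableSet_walkNonneg σ k).inter
      (measurableSet_le measurable_const hm)), ← integral_indicator (h.measurableSet_walkNonneg σ k)]
  refine integral_congr_ae (ae_of_all _ fun ω => ?_)
  by_cases hω : ω ∈ walkNonneg ξ σ k
  · by_cases h0 : 0 ≤ walk ξ σ (k + 1) ω
    · rw [indicator_of_mem hω, indicator_of_mem (show ω ∈ walkNonneg ξ σ k ∩ {ω | 0 ≤ walk ξ σ (k + 1) ω} from ⟨hω, h0⟩),
        max_eq_right (by linarith), add_zero]
    · rw [indicator_of_mem hω, indicator_of_notMem (show ω ∉ walkNonneg ξ σ k ∩ {ω | 0 ≤ walk ξ σ (k + 1) ω} from fun h' => h0 h'.2),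
        max_eq_left (by linarith)]
      ring
  · rw [indicator_of_notMem hω,
      indicator_of_notMem (show ω ∉ walkNonneg ξ σ k ∩ {ω | 0 ≤ walk ξ σ (k + 1) ω} from fun h' => hω h'.1)]

/-- The probability that a standard Gaussian variable is at least one. -/
noncomputable def _root_.gaussTail : ℝ := (gaussianReal 0 1).real (Ici 1)

lemma _root_.gaussTail_pos : 0 < gaussTail := by
  refine ENNReal.toReal_pos (fun h0 => ?_) (measure_ne_top _ _)
  have := gaussianReal_absolutelyContinuous' 0 (v := 1) (by norm_num) h0
  simp at this

lemma setIntegral_walk_zero (h : IsStdGaussianFamily ξ P) (h0 : 0 ≤ σ 0) :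
    σ 0 * gaussTail ≤ ∫ ω in walkNonneg ξ σ 0, walk ξ σ 0 ω ∂P ∧
      ∫ ω in walkNonneg ξ σ 0, walk ξ σ 0 ω ∂P ≤ σ 0 := by
  have := h.indep.isProbabilityMeasure
  have hw : ∀ ω, walk ξ σ 0 ω = σ 0 * ξ 0 ω := fun ω => by simp [walk]
  have hW : ∀ ω, ω ∈ walkNonneg ξ σ 0 ↔ 0 ≤ σ 0 * ξ 0 ω := fun ω => by simp [walkNonneg, hw]
  rw [← integral_indicator (h.measurableSet_walkNonneg σ 0)]
  have hi : Integrable ((walkNonneg ξ σ 0).indicator (walk ξ σ 0)) P :=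
    (h.integrable_walk σ 0).indicator (h.measurableSet_walkNonneg σ 0)
  constructor
  · have hT : σ 0 * gaussTail = ∫ ω, {ω | 1 ≤ ξ 0 ω}.indicator (fun _ => σ 0) ω ∂P := by
      rw [integral_indicator (measurableSet_le measurable_const (h.measurable 0)),
        setIntegral_const, smul_eq_mul, mul_comm, gaussTail, ← h.law 0,
        map_measureReal_apply (h.measurable 0) measurableSet_Ici]
      rfl
    rw [hT]
    refine integral_mono ((integrable_const _).indicator
      (measurableSet_le measurable_const (h.measurable 0))) hi fun ω => ?_
    by_cases h1 : 1 ≤ ξ 0 ω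
    · have h2 : 0 ≤ σ 0 * ξ 0 ω := mul_nonneg h0 (by linarith)
      rw [indicator_of_mem (show ω ∈ {ω | 1 ≤ ξ 0 ω} from h1), indicator_of_mem ((hW ω).2 h2), hw]
      nlinarith
    · rw [indicator_of_notMem (show ω ∉ {ω | 1 ≤ ξ 0 ω} from h1)]
      exact indicator_nonneg (fun ω hω => by rw [hw]; exact (hW ω).1 hω) ω
  · have hsq : Integrable (fun ω => σ 0 * ((1 + ξ 0 ω ^ 2) / 2)) P :=
      (((integrable_const 1).add (h.memLp 0).integrable_sq).div_const 2).const_mul _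
    have : ∫ ω, σ 0 * ((1 + ξ 0 ω ^ 2) / 2) ∂P = σ 0 := by
      rw [integral_const_mul, integral_div, integral_add (integrable_const _)
        (h.memLp 0).integrable_sq, h.integral_sq]
      simp
    rw [← this]
    refine integral_mono hi hsq fun ω => ?_
    by_cases h1 : ω ∈ walkNonneg ξ σ 0
    · rw [indicator_of_mem h1, hw]
      exact mul_le_mul_of_nonneg_left (by nlinarith [sq_nonneg (ξ 0 ω - 1)]) h0
    · rw [indicator_of_notMem h1]
      positivity

lemma le_setIntegral_walk (h : IsStdGaussianFamily ξ P) (h0 : 0 ≤ σ 0) (k : ℕ) :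
    σ 0 * gaussTail ≤ ∫ ω in walkNonneg ξ σ k, walk ξ σ k ω ∂P := by
  induction k with
  | zero => exact (h.setIntegral_walk_zero h0).1
  | succ k ih =>
    rw [h.setIntegral_walk_succ]
    have : 0 ≤ ∫ ω in walkNonneg ξ σ k, max (-walk ξ σ (k + 1) ω) 0 ∂P :=
      integral_nonneg fun ω => le_max_right _ _
    linarith

lemma integrable_pow_four (h : IsStdGaussianFamily ξ P) (k : ℕ) :
    Integrable (fun ω => ξ k ω ^ 4) P := by
  have := ((h.hasGaussianLaw k).memLp (p := 4) (by norm_num)).integrable_norm_pow (p := 4)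
    (by norm_num)
  refine this.congr (ae_of_all _ fun ω => ?_)
  simp only [Real.norm_eq_abs]
  rw [← abs_pow, abs_of_nonneg (by positivity)]

/-- At an exit the overshoot is at most `-z`, where `z` is the last increment, and `-z ≤ 1 + z ^ 4`.
The ones add up to exit probabilities, which telescope against the term `P.real (walkNonneg ξ σ k)`
on the left; the fourth moments are small for fine increments. -/
lemma setIntegral_walk_le (h : IsStdGaussianFamily ξ P) (h0 : 0 ≤ σ 0) (k : ℕ) :
    ∫ ω in walkNonneg ξ σ k, walk ξ σ k ω ∂P + P.real (walkNonneg ξ σ k) ≤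
      σ 0 + 1 + (∑ j ∈ Finset.range k, σ (j + 1) ^ 4) * ∫ x, x ^ 4 ∂gaussianReal 0 1 := by
  have := h.indep.isProbabilityMeasure
  induction k with
  | zero =>
    have := (h.setIntegral_walk_zero h0).2
    have := measureReal_le_one (μ := P) (s := walkNonneg ξ σ 0)
    simp only [Finset.range_zero, Finset.sum_empty, zero_mul]
    linarith
  | succ k ih =>
    rw [h.setIntegral_walk_succ, Finset.sum_range_succ, add_mul]
    have hW := h.measurableSet_walkNonneg σ k
    have hW' := h.measurableSet_walkNonneg σ (k + 1)
    have hb : ∫ ω in walkNonneg ξ σ k, max (-walk ξ σ (k + 1) ω) 0 ∂P ≤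
        P.real (walkNonneg ξ σ k) - P.real (walkNonneg ξ σ (k + 1)) +
          σ (k + 1) ^ 4 * ∫ x, x ^ 4 ∂gaussianReal 0 1 := by
      rw [← h.integral_comp (k + 1) (f := fun x => x ^ 4) (by fun_prop), ← integral_const_mul,
        ← integral_indicator_one hW, ← integral_indicator_one hW', ← integral_indicator hW]
      have j1 : Integrable ((walkNonneg ξ σ k).indicator (1 : Ω → ℝ)) P :=
        (integrable_const (1 : ℝ)).indicator hW
      have j2 : Integrable ((walkNonneg ξ σ (k + 1)).indicator (1 : Ω → ℝ)) P :=
        (integrable_const (1 : ℝ)).indicator hW'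
      have j3 := (h.integrable_pow_four (k + 1)).const_mul (σ (k + 1) ^ 4)
      have e := integral_add (j1.sub j2) j3
      rw [integral_sub' j1 j2] at e
      rw [← e]
      refine integral_mono ((h.integrable_walk σ (k + 1)).neg_part.indicator hW)
        ((j1.sub j2).add j3) fun ω => ?_
      simp only [Pi.sub_apply]
      have hnn : 0 ≤ σ (k + 1) ^ 4 * ξ (k + 1) ω ^ 4 := by positivity
      by_cases hω : ω ∈ walkNonneg ξ σ k
      · by_cases h1 : 0 ≤ walk ξ σ (k + 1) ω
        · have h2 : ω ∈ walkNonneg ξ σ (k + 1) := by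
            rw [walkNonneg_succ]; exact ⟨hω, h1⟩
          rw [indicator_of_mem hω, indicator_of_mem hω, indicator_of_mem h2,
            max_eq_right (by linarith)]
          simpa using hnn
        · have h2 : ω ∉ walkNonneg ξ σ (k + 1) := by
            rw [walkNonneg_succ]; exact fun h' => h1 h'.2
          rw [indicator_of_mem hω, indicator_of_mem hω, indicator_of_notMem h2,
            max_eq_left (by linarith), walk_succ, ← mul_pow]
          have h3 : 0 ≤ walk ξ σ k ω := hω k le_rfl
          simp only [Pi.one_apply]
          set z := σ (k + 1) * ξ (k + 1) ω
          have h4 : -z ≤ 1 + z ^ 4 := by nlinarith [sq_nonneg (z ^ 2 - 1 / 2), sq_nonneg (z + 1 / 2)]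
          linarith
      · have h2 : ω ∉ walkNonneg ξ σ (k + 1) := by
          rw [walkNonneg_succ]; exact fun h' => hω h'.1
        rw [indicator_of_notMem hω, indicator_of_notMem hω, indicator_of_notMem h2]
        simpa using hnn
    linarith

end IsStdGaussianFamily

end Walk

/-! ### The Ornstein–Uhlenbeck covariance -/

section OrnsteinUhlenbeck

lemma exists_isStdGaussianFamily : ∃ (Ω : Type u) (_ : MeasurableSpace Ω) (P : Measure Ω)
    (ξ : ℕ → Ω → ℝ), IsStdGaussianFamily ξ P := by
  refine ⟨ULift.{u} ℕ → ℝ, inferInstance, Measure.infinitePi fun _ => gaussianReal 0 1,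
    fun n ω => ω ⟨n⟩, fun i => measurable_pi_apply _, fun i => ?_, ?_⟩
  · exact Measure.infinitePi_map_eval _ (ULift.up i)
  · exact (iIndepFun_infinitePi (X := fun (_ : ULift.{u} ℕ) x => x) fun _ => measurable_id).precomp
      ULift.up_injective

/-- The standard deviations of the increments over the times `exp (r k)`. -/
noncomputable def increments (r : ℕ → ℝ) : ℕ → ℝ
  | 0 => Real.exp (r 0 / 2)
  | k + 1 => √(Real.exp (r (k + 1)) - Real.exp (r k))

lemma sum_increments_sq {r : ℕ → ℝ} (hr : Monotone r) (m : ℕ) :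
    ∑ j ∈ Finset.range (m + 1), increments r j ^ 2 = Real.exp (r m) := by
  induction m with
  | zero =>
    rw [zero_add, Finset.sum_range_one, increments, ← Real.exp_nat_mul]
    congr 1
    push_cast
    ring
  | succ m ih =>
    rw [Finset.sum_range_succ, ih, increments, Real.sq_sqrt]
    · ring
    · exact sub_nonneg.2 (Real.exp_le_exp.2 (hr (Nat.le_succ m)))

variable {Ω : Type*} [MeasurableSpace Ω] {P : Measure Ω} {ξ : ℕ → Ω → ℝ} {r : ℕ → ℝ}

/-- The walk is Brownian motion sampled at the times `exp (r k)`, and `exp (-s/2) B (exp s)` is the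
stationary Ornstein–Uhlenbeck process. The minus sign turns staying nonnegative into staying below
zero. -/
lemma IsStdGaussianFamily.centeredGaussian_walk {κ : Type*} [Fintype κ]
    (h : IsStdGaussianFamily ξ P) (hr : Monotone r) (e : κ → ℕ) :
    CenteredGaussian (fun k ω => -Real.exp (-(r (e k) / 2)) * walk ξ (increments r) (e k) ω) P
      (covMat ouCov fun k => r (e k)) := by
  classical
  set N := ∑ k, e k with hN
  have heN : ∀ k, e k ≤ N := fun k => Finset.single_le_sum (fun _ _ => Nat.zero_le _)
    (Finset.mem_univ k)
  let A : Matrix κ (Fin (N + 1)) ℝ := fun k j =>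
    -Real.exp (-(r (e k) / 2)) * if (j : ℕ) < e k + 1 then increments r j else 0
  have h1 := (h.centeredGaussian (e := fun j : Fin (N + 1) => (j : ℕ)) Fin.val_injective).linear A
  have hsum : ∀ (m : ℕ) (f : ℕ → ℝ), m ≤ N →
      ∑ j : Fin (N + 1), (if (j : ℕ) < m + 1 then f j else 0) =
        ∑ j ∈ Finset.range (m + 1), f j := by
    intro m f hm
    rw [Fin.sum_univ_eq_sum_range (fun j => if j < m + 1 then f j else 0), ← Finset.sum_filter]
    refine Finset.sum_congr ?_ fun _ _ => rfl
    ext j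
    simp only [Finset.mem_filter, Finset.mem_range]
    omega
  convert h1 using 1
  · funext k ω
    rw [walk, ← hsum (e k) (fun j => increments r j * ξ j ω) (heN k), Finset.mul_sum]
    refine Finset.sum_congr rfl fun j _ => ?_
    simp only [A]
    split_ifs <;> ring
  · ext k l
    rw [Matrix.mul_one, Matrix.mul_apply]
    have h2 : ∀ j, A k j * A.transpose j l = Real.exp (-(r (e k) / 2)) *
        Real.exp (-(r (e l) / 2)) *
          if (j : ℕ) < min (e k) (e l) + 1 then increments r j ^ 2 else 0 := by
      intro j
      rw [Matrix.transpose_apply]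
      simp only [A]
      by_cases h3 : (j : ℕ) < e k + 1 <;> by_cases h4 : (j : ℕ) < e l + 1
      · rw [if_pos h3, if_pos h4, if_pos (by omega)]; ring
      all_goals
        rw [if_neg (show ¬ (j : ℕ) < min (e k) (e l) + 1 by omega)]
        simp [h3, h4]
    simp_rw [h2]
    rw [← Finset.mul_sum, hsum _ (fun j => increments r j ^ 2) ((min_le_left _ _).trans (heN k)),
      sum_increments_sq hr, ← Real.exp_add, ← Real.exp_add]
    simp only [covMat, Matrix.of_apply, ouCov]
    congr 1
    rcases le_total (e k) (e l) with h3 | h3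
    · rw [min_eq_left h3, abs_of_nonpos (sub_nonpos.2 (hr h3))]; ring
    · rw [min_eq_right h3, abs_of_nonneg (sub_nonneg.2 (hr h3))]; ring

lemma exists_monotone_sort {n : ℕ} (hn : 0 < n) (t : Fin n → ℝ) : ∃ (r : ℕ → ℝ) (e : Fin n → ℕ),
    Monotone r ∧ (∀ i, r (e i) = t i) ∧ (∀ i, e i ≤ n - 1) ∧ ∀ k, ∃ i, r k = t i := by
  let s := Tuple.sort t
  have hs : Monotone (t ∘ s) := Tuple.monotone_sort t
  refine ⟨fun k => t (s ⟨min k (n - 1), by omega⟩), fun i => (s.symm i : ℕ), ?_, ?_, ?_, ?_⟩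
  · intro k l hkl
    exact hs (Fin.mk_le_mk.2 (min_le_min_right _ hkl))
  · intro i
    have h1 : min (s.symm i : ℕ) (n - 1) = s.symm i := min_eq_left (by omega)
    simp [h1]
  · intro i
    exact Nat.le_sub_one_of_lt (s.symm i).2
  · exact fun k => ⟨_, rfl⟩

lemma psdFun_ouCov : PSDFun ouCov := by
  intro n t
  rcases Nat.eq_zero_or_pos n with rfl | hn
  · have : covMat ouCov t = 0 := Subsingleton.elim _ _
    rw [this]
    exact Matrix.PosSemidef.zero
  obtain ⟨Ω, _, P, ξ, h⟩ := exists_isStdGaussianFamily.{0}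
  obtain ⟨r, e, hr, he, -, -⟩ := exists_monotone_sort hn t
  have := (h.centeredGaussian_walk hr e).posSemidef
  simpa only [he] using this

namespace IsStdGaussianFamily

lemma hasLaw_walk (h : IsStdGaussianFamily ξ P) (hr : Monotone r) (N : ℕ) :
    P.map (fun ω => -Real.exp (-(r N / 2)) * walk ξ (increments r) N ω) = gaussianReal 0 1 := by
  have h1 := (h.centeredGaussian_walk hr (fun _ : Unit => N)).map_sum_eq (fun _ => 1)
  simpa [covMat, ouCov, dotProduct, Matrix.mulVec] using h1

/-- The mean of the walk on the survival event is at least `gaussTail`, since overshoots only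
increase it. But the walk is `exp (r N / 2)` times a standard Gaussian, which exceeds `K` only with
a small contribution, so the event cannot be too rare. -/
lemma le_measure_walkNonneg (h : IsStdGaussianFamily ξ P) (hr : Monotone r) (h0 : 0 ≤ r 0)
    (N : ℕ) {K : ℝ} (hK : 1 ≤ K) :
    gaussTail ≤ Real.exp (r N / 2) * (K * P.real (walkNonneg ξ (increments r) N) +
      Real.exp (K - K ^ 2 / 2)) := by
  have := h.indep.isProbabilityMeasure
  have h1 := h.le_setIntegral_walk (σ := increments r) (Real.exp_pos _).le N
  have h2 : gaussTail ≤ increments r 0 * gaussTail :=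
    le_mul_of_one_le_left gaussTail_pos.le (Real.one_le_exp (by linarith))
  refine (h2.trans h1).trans ?_
  have hA := h.measurableSet_walkNonneg (increments r) N
  set A := walkNonneg ξ (increments r) N
  set g : Ω → ℝ := fun ω => -Real.exp (-(r N / 2)) * walk ξ (increments r) N ω with hg
  have hgm : Measurable g := (h.measurable_walk _ N).const_mul _
  have hlaw : P.map g = gaussianReal 0 1 := h.hasLaw_walk hr N
  have hexp : Integrable (fun ω => Real.exp (-K * g ω)) P := by
    have := integrable_exp_mul_gaussianReal (μ := 0) (v := 1) (-K)
    rw [← hlaw] at this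
    exact (integrable_map_measure (by fun_prop) hgm.aemeasurable).1 this
  have hmgf : ∫ ω, Real.exp (-K * g ω) ∂P = Real.exp (K ^ 2 / 2) := by
    have := congrFun (mgf_id_gaussianReal (μ := 0) (v := 1)) (-K)
    rw [mgf, ← hlaw, integral_map hgm.aemeasurable (by fun_prop)] at this
    simpa using this
  have hw : ∀ ω, walk ξ (increments r) N ω = Real.exp (r N / 2) * (-g ω) := by
    intro ω
    simp only [hg]
    rw [neg_mul, neg_neg, ← mul_assoc, ← Real.exp_add]
    simp
  have hE : Real.exp (K - K ^ 2 / 2) =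
      Real.exp (K - K ^ 2) * ∫ ω, Real.exp (-K * g ω) ∂P := by
    rw [hmgf, ← Real.exp_add]
    congr 1
    ring
  rw [← integral_indicator hA]
  -- For `h = -g ω ≥ K` the bound reads `h ≤ exp (K - K² + K h)`, which follows from `1 + x ≤ exp x`
  -- and `(K - 1) (h - K) ≥ 0`.
  have hle : ∀ ω, A.indicator (walk ξ (increments r) N) ω ≤ Real.exp (r N / 2) *
      (K * A.indicator 1 ω + Real.exp (K - K ^ 2) * Real.exp (-K * g ω)) := by
    intro ω
    have hpos : 0 ≤ Real.exp (K - K ^ 2) * Real.exp (-K * g ω) := by positivity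
    by_cases hω : ω ∈ A
    · rw [indicator_of_mem hω, indicator_of_mem hω, hw]
      refine mul_le_mul_of_nonneg_left ?_ (Real.exp_pos _).le
      simp only [Pi.one_apply, mul_one]
      rcases le_total (-g ω) K with h3 | h3
      · linarith
      · rw [← Real.exp_add]
        have := Real.add_one_le_exp (K - K ^ 2 + -K * g ω)
        nlinarith [mul_nonneg (sub_nonneg.2 hK) (sub_nonneg.2 h3)]
    · rw [indicator_of_notMem hω, indicator_of_notMem hω]
      positivity
  have hi1 : Integrable (fun ω => K * A.indicator (1 : Ω → ℝ) ω) P :=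
    ((integrable_const (1 : ℝ)).indicator hA).const_mul _
  refine (integral_mono ((h.integrable_walk _ N).indicator hA)
    ((hi1.add (hexp.const_mul _)).const_mul _) hle).trans_eq ?_
  rw [integral_const_mul]
  congr 1
  rw [integral_add' hi1 (hexp.const_mul _), integral_const_mul, integral_const_mul,
    integral_indicator_one hA, hE]

end IsStdGaussianFamily

/-- Truncation at `K = T` costs a factor `T` only, and leaves an error that is negligible against
`exp (-T/2)`. -/
lemma le_persist_ouCov {T : ℝ} (hT : 1 ≤ T) :
    (gaussTail * Real.exp (-(T / 2)) - Real.exp (T - T ^ 2 / 2)) / T ≤ persist ouCov T 0 := by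
  refine le_persist fun n t ht => ?_
  rw [div_le_iff₀' (by linarith)]
  rcases Nat.eq_zero_or_pos n with rfl | hn
  · have h1 : orth (covMat ouCov t) (fun _ => (0 : ℝ)) = 1 := by
      have : IsProbabilityMeasure (gaussN (covMat ouCov t)) :=
        (CenteredGaussian.of_gaussN (psdFun_ouCov 0 t)).isProbabilityMeasure
      simp [orth]
    rw [h1]
    have h2 : gaussTail ≤ 1 := measureReal_le_one
    have h3 : Real.exp (-(T / 2)) ≤ 1 := Real.exp_le_one_iff.2 (by linarith)
    have h4 := Real.exp_pos (T - T ^ 2 / 2)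
    have h5 := mul_le_mul h2 h3 (Real.exp_pos _).le zero_le_one
    linarith
  obtain ⟨Ω, _, P, ξ, h⟩ := exists_isStdGaussianFamily.{0}
  have := h.indep.isProbabilityMeasure
  obtain ⟨r, e, hr, he, hle, hran⟩ := exists_monotone_sort hn t
  have h1 := (h.centeredGaussian_walk hr e).real_le fun _ => 0
  simp only [he] at h1
  rw [← h1]
  obtain ⟨i0, hi0⟩ := hran 0
  obtain ⟨i1, hi1⟩ := hran (n - 1)
  have h2 := h.le_measure_walkNonneg hr (by rw [hi0]; exact (ht i0).1) (n - 1) hT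
  have h3 : P.real (walkNonneg ξ (increments r) (n - 1)) ≤
      P.real {ω | ∀ i, -Real.exp (-(t i / 2)) * walk ξ (increments r) (e i) ω ≤ 0} := by
    refine measureReal_mono fun ω hω i => ?_
    have := mul_nonneg (Real.exp_pos (-(t i / 2))).le (hω (e i) (hle i))
    linarith
  set p := P.real (walkNonneg ξ (increments r) (n - 1))
  have hp : 0 ≤ p := measureReal_nonneg
  have h4 : Real.exp (r (n - 1) / 2) ≤ Real.exp (T / 2) := by
    rw [hi1]
    exact Real.exp_le_exp.2 (by linarith [(ht i1).2])
  have h5 : gaussTail ≤ Real.exp (T / 2) * (T * p + Real.exp (T - T ^ 2 / 2)) :=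
    h2.trans (mul_le_mul_of_nonneg_right h4 (by positivity))
  have h6 := mul_le_mul_of_nonneg_right h5 (Real.exp_pos (-(T / 2))).le
  rw [mul_right_comm, ← Real.exp_add, add_neg_cancel, Real.exp_zero, one_mul] at h6
  have h7 := mul_le_mul_of_nonneg_left h3 (show (0 : ℝ) ≤ T by linarith)
  linarith

lemma eventually_le_persist_ouCov :
    ∀ᶠ T in atTop, gaussTail / 2 * Real.exp (-(T / 2)) / T ≤ persist ouCov T 0 := by
  have hg := gaussTail_pos
  filter_upwards [eventually_ge_atTop 4,
    eventually_ge_atTop (2 * Real.log (2 / gaussTail))] with T hT hT2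
  refine le_trans ?_ (le_persist_ouCov (by linarith))
  refine div_le_div_of_nonneg_right ?_ (by linarith)
  have h1 : Real.exp (T - T ^ 2 / 2) ≤ gaussTail / 2 * Real.exp (-(T / 2)) := by
    have h2 : gaussTail / 2 = Real.exp (-Real.log (2 / gaussTail)) := by
      rw [Real.exp_neg, Real.exp_log (by positivity), inv_div]
    rw [h2, ← Real.exp_add]
    exact Real.exp_le_exp.2 (by nlinarith)
  linarith

lemma admissible_ouCov : Admissible ouCov where
  psd := psdFun_ouCov
  one := by simp [ouCov]
  nonneg τ := (Real.exp_pos _).le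
  decay := ⟨1, 1 / 2, one_pos, by norm_num, fun τ => by
    rw [ouCov, one_mul]; exact Real.exp_le_exp.2 (by linarith)⟩
  local_pos := ⟨Real.exp (-(1 / 2)), Real.exp_pos _, fun τ hτ =>
    Real.exp_le_exp.2 (by linarith)⟩
  persist_pos T := by
    obtain ⟨S, hS, hTS, hS0⟩ := (eventually_le_persist_ouCov.and
      ((eventually_ge_atTop T).and (eventually_gt_atTop 0))).exists
    have hg := gaussTail_pos
    exact lt_of_lt_of_le (by positivity) (hS.trans (persist_anti psdFun_ouCov hTS 0))

/-- Survival is positively associated with the endpoint being at least one standard deviation `exp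
(r N / 2)`, so a fixed proportion of the surviving mass sits that high. -/
lemma IsStdGaussianFamily.measure_walkNonneg_mul_le (h : IsStdGaussianFamily ξ P)
    (hr : Monotone r) (N : ℕ) :
    P.real (walkNonneg ξ (increments r) N) * gaussTail * Real.exp (r N / 2) ≤
      ∫ ω in walkNonneg ξ (increments r) N, walk ξ (increments r) N ω ∂P := by
  have := h.indep.isProbabilityMeasure
  have hA := h.measurableSet_walkNonneg (increments r) N
  -- The last index repeats time `N` with level `-1` instead of `0`, so that survival and the large
  -- endpoint are one orthant event.
  let e : Fin (N + 2) → ℕ := fun k => min k N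
  let u : Fin (N + 2) → ℝ := fun k => if (k : ℕ) ≤ N then 0 else -1
  have hG := h.centeredGaussian_walk hr e
  have h1 := mul_orth_le_orth hG.posSemidef (fun k => (k : ℕ) ≤ N)
    (fun _ _ _ _ => (Real.exp_pos _).le) u
  rw [← (hG.comp _).real_le, ← (hG.comp _).real_le, ← hG.real_le] at h1
  have hneg : ∀ (k : ℕ) (ω : Ω), -Real.exp (-(r k / 2)) * walk ξ (increments r) k ω ≤ 0 ↔
      0 ≤ walk ξ (increments r) k ω := by
    intro k ω
    rw [neg_mul, neg_nonpos, mul_nonneg_iff_of_pos_left (Real.exp_pos _)]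
  have e1 : {ω | ∀ i : {k : Fin (N + 2) // (k : ℕ) ≤ N}, -Real.exp (-(r (e i.1) / 2)) *
      walk ξ (increments r) (e i.1) ω ≤ u i.1} = walkNonneg ξ (increments r) N := by
    ext ω
    constructor
    · intro hω k hk
      have := hω ⟨⟨k, by omega⟩, hk⟩
      simp only [e, u, hk, if_true, min_eq_left hk] at this
      exact (hneg k ω).1 this
    · rintro hω ⟨k, hk⟩
      simp only [e, u, hk, if_true, min_eq_left hk]
      exact (hneg k ω).2 (hω k hk)
  have e2 : {ω | ∀ i : {k : Fin (N + 2) // ¬ (k : ℕ) ≤ N}, -Real.exp (-(r (e i.1) / 2)) *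
      walk ξ (increments r) (e i.1) ω ≤ u i.1} =
      {ω | -Real.exp (-(r N / 2)) * walk ξ (increments r) N ω ≤ -1} := by
    ext ω
    constructor
    · intro hω
      have := hω ⟨⟨N + 1, by omega⟩, by simp⟩
      simpa [e, u] using this
    · rintro hω ⟨k, hk⟩
      simp only [e, u, hk, if_false, min_eq_right (not_le.1 hk).le]
      exact hω
  have e3 : P.real {ω | -Real.exp (-(r N / 2)) * walk ξ (increments r) N ω ≤ -1} = gaussTail := by
    have h2 : gaussTail = (gaussianReal 0 1).real (Iic (-1)) := by
      have h3 := gaussianReal_map_neg (μ := 0) (v := 1)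
      rw [neg_zero] at h3
      rw [gaussTail, ← h3, map_measureReal_apply measurable_neg measurableSet_Ici, h3]
      congr 1
      ext x
      simp [le_neg]
    rw [h2, ← h.hasLaw_walk hr N, map_measureReal_apply
      ((h.measurable_walk _ N).const_mul _) measurableSet_Iic]
    rfl
  rw [e1, e2, e3] at h1
  set B : Set Ω := {ω | ∀ i, -Real.exp (-(r (e i) / 2)) *
      walk ξ (increments r) (e i) ω ≤ u i}
  have hB : MeasurableSet B := by
    have : B = ⋂ i, {ω | -Real.exp (-(r (e i) / 2)) *
      walk ξ (increments r) (e i) ω ≤ u i} := by ext; simp [B]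
    rw [this]
    exact MeasurableSet.iInter fun i =>
      measurableSet_le ((h.measurable_walk _ _).const_mul _) measurable_const
  refine (mul_le_mul_of_nonneg_right h1 (Real.exp_pos _).le).trans ?_
  rw [← integral_indicator hA, ← integral_indicator_one hB, ← integral_mul_const]
  refine integral_mono (((integrable_const (1 : ℝ)).indicator hB).mul_const _)
    ((h.integrable_walk _ N).indicator hA) fun ω => ?_
  by_cases hω : ω ∈ B
  · have hωA : ω ∈ walkNonneg ξ (increments r) N := by
      rw [← e1]
      exact fun i => hω i.1
    have h2 := hω ⟨N + 1, by omega⟩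
    simp only [e, u, add_le_iff_nonpos_right, nonpos_iff_eq_zero, one_ne_zero, if_false,
      min_eq_right (Nat.le_succ N)] at h2
    simp only [indicator_of_mem hω, indicator_of_mem hωA, Pi.one_apply, one_mul]
    have h3 := mul_le_mul_of_nonneg_left h2 (Real.exp_pos (r N / 2)).le
    rw [← mul_assoc, mul_neg, ← Real.exp_add, add_neg_cancel, Real.exp_zero] at h3
    linarith
  · simp only [indicator_of_notMem hω, zero_mul]
    exact indicator_nonneg (fun ω (hω : ω ∈ walkNonneg ξ (increments r) N) => hω N le_rfl) ω

lemma persist_ouCov_le {T : ℝ} (hT : 0 ≤ T) :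
    persist ouCov T 0 ≤ 3 / gaussTail * Real.exp (-(T / 2)) := by
  obtain ⟨Ω, _, P, ξ, h⟩ := exists_isStdGaussianFamily.{0}
  have := h.indep.isProbabilityMeasure
  set m : ℝ := ∫ x, x ^ 4 ∂gaussianReal 0 1
  have hm : 0 ≤ m := integral_nonneg fun x => by positivity
  -- The times `exp (r k)` are equally spaced from `1` to `exp T`, so the fourth powers of the
  -- increments sum to `(exp T - 1) ^ 2 / N`. This `N` makes their total contribution at most one,
  -- whence the constant `3 = 1 + 1 + 1`.
  obtain ⟨N, hN⟩ := exists_nat_ge ((Real.exp T - 1) ^ 2 * m + 1)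
  have hE : 0 ≤ Real.exp T - 1 := sub_nonneg.2 (Real.one_le_exp hT)
  have hN0 : (0 : ℝ) < N := lt_of_lt_of_le (by positivity) hN
  set Δ := (Real.exp T - 1) / N with hΔ
  have hΔ0 : 0 ≤ Δ := by positivity
  have hpos : ∀ k : ℕ, 0 < 1 + k * Δ := fun k => by positivity
  let r : ℕ → ℝ := fun k => Real.log (1 + k * Δ)
  have hexp : ∀ k, Real.exp (r k) = 1 + k * Δ := fun k => Real.exp_log (hpos k)
  have hr : Monotone r := by
    intro k l hkl
    refine Real.log_le_log (hpos k) ?_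
    have : (k : ℝ) ≤ l := by exact_mod_cast hkl
    nlinarith
  have hrN : r N = T := by
    simp only [r, hΔ]
    rw [mul_div_cancel₀ _ hN0.ne', add_sub_cancel, Real.log_exp]
  have hr0 : r 0 = 0 := by simp [r]
  have h1 := h.setIntegral_walk_le (σ := increments r) (Real.exp_pos _).le N
  have h2 := h.measure_walkNonneg_mul_le hr N
  have hσ0 : increments r 0 = 1 := by simp [increments, hr0]
  have hσ : ∀ j, increments r (j + 1) ^ 4 = Δ ^ 2 := by
    intro j
    rw [increments, hexp, hexp, show (4 : ℕ) = 2 * 2 from rfl, pow_mul, Real.sq_sqrt]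
    · push_cast; ring
    · push_cast; linarith
  rw [hσ0] at h1
  simp only [hσ, Finset.sum_const, Finset.card_range, nsmul_eq_mul] at h1
  have h3 : N * Δ ^ 2 * m ≤ 1 := by
    rw [hΔ, div_pow, show (N : ℝ) * ((Real.exp T - 1) ^ 2 / (N : ℝ) ^ 2) * m =
      ((Real.exp T - 1) ^ 2 * m) / N by field_simp]
    rw [div_le_one hN0]
    linarith
  have hp : 0 ≤ P.real (walkNonneg ξ (increments r) N) := measureReal_nonneg
  rw [hrN] at h2
  have h4 : persist ouCov T 0 ≤ P.real (walkNonneg ξ (increments r) N) := by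
    refine (persist_le_orth' psdFun_ouCov (t := fun k : Fin (N + 1) => r k) (fun k => ?_) 0).trans ?_
    · exact ⟨hr0 ▸ hr (Nat.zero_le _), hrN ▸ hr (Nat.lt_succ_iff.1 k.2)⟩
    · rw [← (h.centeredGaussian_walk hr fun k : Fin (N + 1) => (k : ℕ)).real_le]
      refine measureReal_mono fun ω hω k hk => ?_
      have := hω ⟨k, by omega⟩
      rwa [neg_mul, neg_nonpos, mul_nonneg_iff_of_pos_left (Real.exp_pos _)] at this
  refine h4.trans ?_
  have hg := gaussTail_pos
  rw [Real.exp_neg, ← div_eq_mul_inv, le_div_iff₀ (Real.exp_pos _), le_div_iff₀ hg]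
  linarith

theorem expo_ouCov : expo ouCov = 1 / 2 := by
  have hg := gaussTail_pos
  have hlog : Tendsto (fun T : ℝ => Real.log T / T) atTop (𝓝 0) := by
    simpa using Real.tendsto_pow_log_div_mul_add_atTop 1 0 1 one_ne_zero
  have hinv : ∀ c : ℝ, Tendsto (fun T : ℝ => c / T) atTop (𝓝 0) := fun c =>
    tendsto_const_nhds.div_atTop tendsto_id
  apply le_antisymm
  · refine admissible_ouCov.expo_le_of_tendsto_le
      (f := fun T => -Real.log (gaussTail / 2) / T + 1 / 2 + Real.log T / T) ?_ ?_
    · simpa using ((hinv _).add_const (1 / 2 : ℝ)).add hlog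
    · filter_upwards [eventually_le_persist_ouCov, eventually_gt_atTop 0] with T h1 hT
      have h2 := Real.log_le_log (by positivity) h1
      rw [Real.log_div (by positivity) hT.ne', Real.log_mul (by positivity) (Real.exp_pos _).ne',
        Real.log_exp] at h2
      rw [div_le_iff₀ hT]
      field_simp
      linarith
  · refine admissible_ouCov.le_expo_of_tendsto_le
      (f := fun T => -Real.log (3 / gaussTail) / T + 1 / 2) ?_ ?_
    · simpa using (hinv _).add_const (1 / 2 : ℝ)
    · filter_upwards [eventually_gt_atTop 0] with T hT
      have h2 := Real.log_le_log (admissible_ouCov.persist_pos T) (persist_ouCov_le hT.le)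
      rw [Real.log_mul (by positivity) (Real.exp_pos _).ne', Real.log_exp] at h2
      rw [le_div_iff₀ hT]
      field_simp
      linarith

end OrnsteinUhlenbeck

/-! ### The covariance functions `sech ^ p` -/

section SechPow

/-- `C τ = sech (τ / 2) ^ p`. -/
noncomputable def sechPow (p τ : ℝ) : ℝ := (1 / Real.cosh (τ / 2)) ^ p

/-- `C τ = exp (-τ² / 8)`. -/
noncomputable def gaussCov (τ : ℝ) : ℝ := Real.exp (-τ ^ 2 / 8)

lemma gKernel_mul {α s t r : ℝ} (hr : 0 < r) : gKernel α s r * gKernel α t r =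
    r ^ α * Real.exp (-((Real.exp (-s) + Real.exp (-t)) * r)) := by
  rw [gKernel, gKernel, mul_mul_mul_comm, ← Real.rpow_add hr, ← Real.exp_add]
  congr 2 <;> ring

lemma integrableOn_gKernel_mul {α : ℝ} (hα : -1 < α) (s t : ℝ) :
    IntegrableOn (fun r => gKernel α s r * gKernel α t r) (Ioi 0) := by
  have h := integrableOn_rpow_mul_exp_neg_mul_rpow hα one_pos
    (show 0 < Real.exp (-s) + Real.exp (-t) by positivity)
  refine h.congr_fun (fun r hr => ?_) measurableSet_Ioi
  rw [mem_Ioi] at hr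
  simp only [gKernel_mul hr, Real.rpow_one, neg_mul]

lemma integral_gKernel_mul {α : ℝ} (hα : -1 < α) (s t : ℝ) :
    ∫ r in Ioi (0 : ℝ), gKernel α s r * gKernel α t r =
      Real.Gamma (α + 1) * (1 / (Real.exp (-s) + Real.exp (-t))) ^ (α + 1) := by
  rw [mul_comm, ← Real.integral_rpow_mul_exp_neg_mul_Ioi (by linarith)
    (show 0 < Real.exp (-s) + Real.exp (-t) by positivity)]
  refine setIntegral_congr_fun measurableSet_Ioi fun r hr => ?_
  rw [mem_Ioi] at hr
  simp only [gKernel_mul hr, add_sub_cancel_right]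

lemma integral_gKernel_sq {α : ℝ} (hα : -1 < α) (t : ℝ) :
    ∫ r in Ioi (0 : ℝ), gKernel α t r ^ 2 =
      Real.Gamma (α + 1) * (Real.exp t / 2) ^ (α + 1) := by
  simp_rw [sq]
  rw [integral_gKernel_mul hα, Real.exp_neg]
  congr 2
  field_simp
  norm_num

lemma integral_gKernel_sq_pos {α : ℝ} (hα : -1 < α) (t : ℝ) :
    0 < ∫ r in Ioi (0 : ℝ), gKernel α t r ^ 2 := by
  rw [integral_gKernel_sq hα]
  have := Real.Gamma_pos_of_pos (show 0 < α + 1 by linarith)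
  positivity

lemma sechPow_eq_integral {α : ℝ} (hα : -1 < α) (s t : ℝ) : sechPow (α + 1) (s - t) =
    (∫ r in Ioi (0 : ℝ), gKernel α s r * gKernel α t r) /
      (√(∫ r in Ioi (0 : ℝ), gKernel α s r ^ 2) * √(∫ r in Ioi (0 : ℝ), gKernel α t r ^ 2)) := by
  have hG := Real.Gamma_pos_of_pos (show 0 < α + 1 by linarith)
  rw [← Real.sqrt_mul (integral_gKernel_sq_pos hα s).le, integral_gKernel_mul hα,
    integral_gKernel_sq hα, integral_gKernel_sq hα, mul_mul_mul_comm, ← sq,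
    ← Real.mul_rpow (by positivity) (by positivity), Real.sqrt_mul (by positivity),
    Real.sqrt_sq hG.le, mul_div_mul_left _ _ hG.ne',
    show Real.exp s / 2 * (Real.exp t / 2) = (Real.exp ((s + t) / 2) / 2) ^ 2 by
      rw [div_pow, ← Real.exp_nat_mul]
      push_cast
      rw [mul_div_cancel₀ _ (two_ne_zero), Real.exp_add]
      ring,
    ← Real.rpow_natCast, ← Real.rpow_mul (by positivity), mul_comm ((2 : ℕ) : ℝ),
    Real.rpow_mul (by positivity), Real.rpow_natCast, Real.sqrt_sq (by positivity),
    ← Real.div_rpow (by positivity) (by positivity), sechPow, Real.cosh_eq]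
  congr 1
  have h1 : Real.exp ((s + t) / 2) * (Real.exp (-s) + Real.exp (-t)) =
      Real.exp ((s - t) / 2) + Real.exp (-((s - t) / 2)) := by
    rw [mul_add, ← Real.exp_add, ← Real.exp_add, add_comm]
    congr 2 <;> ring
  rw [← h1]
  field_simp

/-- With `p = α + 1`, the kernel is the Gram kernel of the normalized functions `gKernel α t` in
`L²(0, ∞)`. -/
lemma psdFun_sechPow {p : ℝ} (hp : 0 < p) : PSDFun (sechPow p) := by
  obtain ⟨α, rfl⟩ : ∃ α, p = α + 1 := ⟨p - 1, by ring⟩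
  have hα : -1 < α := by linarith
  intro n t
  refine Matrix.PosSemidef.of_dotProduct_mulVec_nonneg ?_ fun x => ?_
  · ext i j
    simp only [Matrix.conjTranspose_apply, covMat, Matrix.of_apply, star_trivial, sechPow]
    rw [← Real.cosh_neg, ← neg_div, neg_sub]
  · set c : Fin n → ℝ := fun i => x i / √(∫ r in Ioi (0 : ℝ), gKernel α (t i) r ^ 2)
    have h1 : dotProduct (star x) (Matrix.mulVec (covMat (sechPow (α + 1)) t) x) =
        ∫ r in Ioi (0 : ℝ), (∑ i, c i * gKernel α (t i) r) ^ 2 := by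
      have h2 : ∀ r, (∑ i, c i * gKernel α (t i) r) ^ 2 =
          ∑ i, ∑ j, c i * c j * (gKernel α (t i) r * gKernel α (t j) r) := by
        intro r
        rw [sq, Finset.sum_mul_sum]
        exact Finset.sum_congr rfl fun i _ => Finset.sum_congr rfl fun j _ => by ring
      simp_rw [h2]
      rw [integral_finsetSum _ fun i _ => integrable_finsetSum _ fun j _ =>
        (integrableOn_gKernel_mul hα _ _).const_mul _]
      rw [dotProduct]
      refine Finset.sum_congr rfl fun i _ => ?_
      rw [integral_finsetSum _ fun j _ => (integrableOn_gKernel_mul hα _ _).const_mul _,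
        Matrix.mulVec, dotProduct, Finset.mul_sum]
      refine Finset.sum_congr rfl fun j _ => ?_
      rw [integral_const_mul]
      simp only [covMat, Matrix.of_apply, sechPow_eq_integral hα, c, star_trivial]
      ring
    rw [h1]
    exact integral_nonneg fun r => sq_nonneg _

lemma PSDFun.comp_div {C : ℝ → ℝ} (hC : PSDFun C) (c : ℝ) : PSDFun fun τ => C (τ / c) := by
  intro n t
  have : covMat (fun τ => C (τ / c)) t = covMat C fun i => t i / c := by
    ext i j
    simp [covMat, sub_div]
  rw [this]
  exact hC _ _

lemma PSDFun.of_tendsto {α : Type*} {l : Filter α} [l.NeBot] {C : α → ℝ → ℝ} {C₀ : ℝ → ℝ}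
    (h : ∀ᶠ a in l, PSDFun (C a)) (hlim : ∀ τ, Tendsto (fun a => C a τ) l (𝓝 (C₀ τ))) :
    PSDFun C₀ := by
  intro n t
  refine Matrix.PosSemidef.of_dotProduct_mulVec_nonneg ?_ fun x => ?_
  · ext i j
    refine tendsto_nhds_unique (hlim _) ((hlim (t i - t j)).congr' ?_)
    filter_upwards [h] with a ha
    exact ((ha n t).1.apply i j).symm
  · have h1 : Tendsto (fun a => dotProduct (star x) (Matrix.mulVec (covMat (C a) t) x)) l
        (𝓝 (dotProduct (star x) (Matrix.mulVec (covMat C₀ t) x))) :=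
      tendsto_finsetSum _ fun i _ => tendsto_const_nhds.mul
        (tendsto_finsetSum Finset.univ fun j _ => (hlim (t i - t j)).mul tendsto_const_nhds)
    refine ge_of_tendsto h1 ?_
    filter_upwards [h] with a ha
    exact (ha n t).dotProduct_mulVec_nonneg x

/-! Estimates for `log cosh`. -/

/-- Jensen for the concave power `z ^ c` at the midpoint of `exp x` and `exp (-x)`. -/
lemma log_cosh_mul_le {c : ℝ} (h0 : 0 ≤ c) (h1 : c ≤ 1) (x : ℝ) :
    Real.log (Real.cosh (c * x)) ≤ c * Real.log (Real.cosh x) := by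
  rw [← Real.log_rpow (Real.cosh_pos _)]
  refine Real.log_le_log (Real.cosh_pos _) ?_
  have := (Real.concaveOn_rpow h0 h1).2 (mem_Ici.2 (Real.exp_pos x).le)
    (mem_Ici.2 (Real.exp_pos (-x)).le) (show (0 : ℝ) ≤ 1 / 2 by norm_num)
    (show (0 : ℝ) ≤ 1 / 2 by norm_num) (by norm_num)
  simp only [smul_eq_mul, ← Real.exp_mul] at this
  rw [Real.cosh_eq, Real.cosh_eq,
    show (Real.exp x + Real.exp (-x)) / 2 = 1 / 2 * Real.exp x + 1 / 2 * Real.exp (-x) by ring]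
  refine le_trans (le_of_eq ?_) this
  rw [neg_mul, mul_comm x c]
  ring

/-- The difference of the two sides vanishes at zero and has derivative `(sinh x cosh x - x) / cosh²
x ≥ 0`. This is what makes `log cosh x / x²` decrease. -/
lemma mul_tanh_le_two_mul_log_cosh {x : ℝ} (hx : 0 ≤ x) :
    x * (Real.sinh x / Real.cosh x) ≤ 2 * Real.log (Real.cosh x) := by
  have hc := fun x => (Real.cosh_pos x).ne'
  have hd : ∀ x, HasDerivAt (fun x => 2 * Real.log (Real.cosh x) - x * (Real.sinh x / Real.cosh x))
      (2 * (Real.sinh x / Real.cosh x) - (1 * (Real.sinh x / Real.cosh x) +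
        x * ((Real.cosh x * Real.cosh x - Real.sinh x * Real.sinh x) / Real.cosh x ^ 2))) x :=
    fun x => (((Real.hasDerivAt_cosh x).log (hc x)).const_mul 2).sub
      ((hasDerivAt_id x).mul ((Real.hasDerivAt_sinh x).div (Real.hasDerivAt_cosh x) (hc x)))
  have hmono : MonotoneOn
      (fun x => 2 * Real.log (Real.cosh x) - x * (Real.sinh x / Real.cosh x)) (Ici 0) := by
    refine monotoneOn_of_deriv_nonneg (convex_Ici 0)
      (fun x _ => (hd x).continuousAt.continuousWithinAt)
      (fun x _ => (hd x).differentiableAt.differentiableWithinAt) fun x hx => ?_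
    rw [interior_Ici, mem_Ioi] at hx
    rw [(hd x).deriv]
    have h1 : Real.cosh x * Real.cosh x - Real.sinh x * Real.sinh x = 1 := by
      have := Real.cosh_sq_sub_sinh_sq x
      nlinarith
    have h2 : x ≤ Real.sinh x * Real.cosh x :=
      (Real.self_le_sinh_iff.2 hx.le).trans (le_mul_of_one_le_right
        (Real.sinh_nonneg_iff.2 hx.le) (Real.one_le_cosh x))
    rw [h1, show 2 * (Real.sinh x / Real.cosh x) - (1 * (Real.sinh x / Real.cosh x) +
      x * (1 / Real.cosh x ^ 2)) = (Real.sinh x * Real.cosh x - x) / Real.cosh x ^ 2 by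
        have := hc x
        field_simp
        ring]
    have := Real.cosh_pos x
    exact div_nonneg (by linarith) (by positivity)
  have := hmono (mem_Ici.2 le_rfl) hx hx
  simp only [Real.cosh_zero, Real.log_one, Real.sinh_zero] at this
  linarith

lemma sq_mul_log_cosh_le {c : ℝ} (h0 : 0 < c) (h1 : c ≤ 1) (x : ℝ) :
    c ^ 2 * Real.log (Real.cosh x) ≤ Real.log (Real.cosh (c * x)) := by
  wlog hx : 0 ≤ x generalizing x
  · have := this (-x) (by linarith)
    rwa [Real.cosh_neg, mul_neg, Real.cosh_neg] at this
  rcases hx.eq_or_lt with rfl | hx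
  · simp
  have hc := fun x => (Real.cosh_pos x).ne'
  have hd : ∀ x, 0 < x → HasDerivAt (fun x => Real.log (Real.cosh x) / x ^ 2)
      ((Real.sinh x / Real.cosh x * x ^ 2 - Real.log (Real.cosh x) * (2 * x)) / (x ^ 2) ^ 2) x := by
    intro x hx
    exact (((Real.hasDerivAt_cosh x).log (hc x)).div (hasDerivAt_pow 2 x)
      (by positivity)).congr_deriv (by simp)
  have hanti : AntitoneOn (fun x => Real.log (Real.cosh x) / x ^ 2) (Ioi 0) := by
    refine antitoneOn_of_deriv_nonpos (convex_Ioi 0)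
      (fun x hx => (hd x hx).continuousAt.continuousWithinAt)
      (fun x hx => (hd x (interior_subset hx)).differentiableAt.differentiableWithinAt)
      fun x hx => ?_
    rw [interior_Ioi, mem_Ioi] at hx
    rw [(hd x hx).deriv]
    refine div_nonpos_of_nonpos_of_nonneg ?_ (by positivity)
    have := mul_le_mul_of_nonneg_right (mul_tanh_le_two_mul_log_cosh hx.le) hx.le
    linarith
  have h2 := hanti (mem_Ioi.2 (mul_pos h0 hx)) (mem_Ioi.2 hx) (mul_le_of_le_one_left hx.le h1)
  simp only at h2
  rw [div_le_div_iff₀ (by positivity) (by positivity)] at h2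
  have hx2 : 0 < x ^ 2 := by positivity
  refine le_of_mul_le_mul_right ?_ hx2
  linarith

lemma log_cosh_le_abs (x : ℝ) : Real.log (Real.cosh x) ≤ |x| := by
  rw [Real.log_le_iff_le_exp (Real.cosh_pos x), ← Real.cosh_abs, Real.cosh_eq]
  have := Real.exp_le_exp.2 (neg_le_self (abs_nonneg x))
  linarith

lemma abs_sub_le_log_cosh (x : ℝ) : |x| - Real.log 2 ≤ Real.log (Real.cosh x) := by
  rw [Real.le_log_iff_exp_le (Real.cosh_pos x), Real.exp_sub, Real.exp_log two_pos,
    ← Real.cosh_abs, Real.cosh_eq]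
  have := Real.exp_pos (-|x|)
  linarith

lemma log_cosh_le_sq (x : ℝ) : Real.log (Real.cosh x) ≤ x ^ 2 / 2 := by
  rw [Real.log_le_iff_le_exp (Real.cosh_pos x)]
  exact Real.cosh_le_exp_half_sq x

lemma sq_mul_exp_le_log_cosh (x : ℝ) :
    x ^ 2 / 2 * Real.exp (-(x ^ 2 / 2)) ≤ Real.log (Real.cosh x) := by
  wlog hx : 0 ≤ x generalizing x
  · have := this (-x) (by linarith)
    rwa [Real.cosh_neg, neg_sq] at this
  have h1 := mul_tanh_le_two_mul_log_cosh hx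
  have h2 : x * Real.exp (-(x ^ 2 / 2)) ≤ Real.sinh x / Real.cosh x := by
    rw [Real.exp_neg, ← div_eq_mul_inv]
    exact div_le_div₀ (Real.sinh_nonneg_iff.2 hx) (Real.self_le_sinh_iff.2 hx) (Real.cosh_pos x)
      (Real.cosh_le_exp_half_sq x)
  nlinarith [mul_le_mul_of_nonneg_left h2 hx]

/-! ### Bounds and monotonicity in `p` of the rescaled kernels -/

lemma sechPow_eq_exp (p τ : ℝ) :
    sechPow p τ = Real.exp (-(p * Real.log (Real.cosh (τ / 2)))) := by
  rw [sechPow, Real.rpow_def_of_pos (by have := Real.cosh_pos (τ / 2); positivity), one_div,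
    Real.log_inv]
  congr 1
  ring

lemma sechPow_comp_div_le {p c : ℝ} (hp : 0 < p) (hc : 0 < c) (τ : ℝ) :
    sechPow p (τ / c) ≤ 2 ^ p * Real.exp (-(p / (2 * c)) * |τ|) := by
  rw [sechPow_eq_exp, Real.rpow_def_of_pos two_pos, ← Real.exp_add]
  refine Real.exp_le_exp.2 ?_
  have h1 := mul_le_mul_of_nonneg_left (abs_sub_le_log_cosh (τ / c / 2)) hp.le
  rw [abs_div, abs_div, abs_two, abs_of_pos hc] at h1
  have h2 : p * (|τ| / c / 2) = p / (2 * c) * |τ| := by field_simp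
  linarith

lemma exp_le_sechPow_comp_div {p c : ℝ} (hp : 0 < p) (hc : 0 < c) (τ : ℝ) :
    Real.exp (-(p / c * |τ| / 2)) ≤ sechPow p (τ / c) := by
  rw [sechPow_eq_exp]
  refine Real.exp_le_exp.2 (neg_le_neg ?_)
  have h1 := mul_le_mul_of_nonneg_left (log_cosh_le_abs (τ / c / 2)) hp.le
  rw [abs_div, abs_div, abs_two, abs_of_pos hc] at h1
  have h2 : p * (|τ| / c / 2) = p / c * |τ| / 2 := by field_simp
  linarith

/-- On a bounded window the kernel dominates a time-changed Ornstein–Uhlenbeck covariance, so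
positivity of the persistence probabilities follows from Slepian. -/
lemma admissible_of_exp_le {C : ℝ → ℝ} (psd : PSDFun C) (one : C 0 = 1)
    (decay : ∃ A c : ℝ, 0 < A ∧ 0 < c ∧ ∀ τ, C τ ≤ A * Real.exp (-c * |τ|))
    (lower : ∀ T > 0, ∃ K > 0, ∀ τ, |τ| ≤ T → Real.exp (-(K * |τ| / 2)) ≤ C τ) :
    Admissible C where
  psd := psd
  one := one
  nonneg τ := by
    obtain ⟨K, -, h⟩ := lower (|τ| + 1) (by positivity)
    exact (Real.exp_pos _).le.trans (h τ (by linarith))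
  decay := decay
  local_pos := by
    obtain ⟨K, hK, h⟩ := lower 1 one_pos
    refine ⟨Real.exp (-(K / 2)), Real.exp_pos _, fun τ hτ => le_trans ?_ (h τ hτ)⟩
    exact Real.exp_le_exp.2 (by nlinarith)
  persist_pos T := by
    obtain ⟨K, hK, h⟩ := lower (|T| + 1) (by positivity)
    have h1 := admissible_ouCov.persist_pos (T / K⁻¹)
    rw [← persist_comp_div psdFun_ouCov (inv_pos.2 hK)] at h1
    refine h1.trans_le (persist_mono_cov (psdFun_ouCov.comp_div _) psd (by simp [ouCov, one])
      (fun τ hτ => le_trans (le_of_eq ?_) (h τ (by linarith [le_abs_self T]))) 0)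
    rw [ouCov, abs_div, abs_of_pos (inv_pos.2 hK), div_inv_eq_mul]
    congr 1
    ring

lemma admissible_sechPow_comp_div {p c : ℝ} (hp : 0 < p) (hc : 0 < c) :
    Admissible fun τ => sechPow p (τ / c) :=
  admissible_of_exp_le ((psdFun_sechPow hp).comp_div c) (by simp [sechPow])
    ⟨2 ^ p, p / (2 * c), by positivity, by positivity, sechPow_comp_div_le hp hc⟩
    fun _ _ => ⟨p / c, by positivity, fun τ _ => exp_le_sechPow_comp_div hp hc τ⟩

lemma admissible_sechPow {p : ℝ} (hp : 0 < p) : Admissible (sechPow p) := by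
  simpa using admissible_sechPow_comp_div hp one_pos

lemma sechPow_comp_div_self_le {p q : ℝ} (hp : 0 < p) (hpq : p ≤ q) (τ : ℝ) :
    sechPow p (τ / p) ≤ sechPow q (τ / q) := by
  have hq : 0 < q := hp.trans_le hpq
  rw [sechPow_eq_exp, sechPow_eq_exp]
  refine Real.exp_le_exp.2 (neg_le_neg ?_)
  have h1 := log_cosh_mul_le (c := p / q) (by positivity) ((div_le_one hq).2 hpq) (τ / p / 2)
  rw [show p / q * (τ / p / 2) = τ / q / 2 by field_simp] at h1
  have h2 := mul_le_mul_of_nonneg_left h1 hq.le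
  rwa [← mul_assoc, mul_div_cancel₀ _ hq.ne'] at h2

lemma sechPow_comp_div_sqrt_le {p q : ℝ} (hp : 0 < p) (hpq : p ≤ q) (τ : ℝ) :
    sechPow q (τ / √q) ≤ sechPow p (τ / √p) := by
  have hq : 0 < q := hp.trans_le hpq
  have hp' := Real.sqrt_pos.2 hp
  have hq' := Real.sqrt_pos.2 hq
  rw [sechPow_eq_exp, sechPow_eq_exp]
  refine Real.exp_le_exp.2 (neg_le_neg ?_)
  have h1 := sq_mul_log_cosh_le (c := √p / √q) (by positivity)
    ((div_le_one hq').2 (Real.sqrt_le_sqrt hpq)) (τ / √p / 2)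
  rw [show √p / √q * (τ / √p / 2) = τ / √q / 2 by field_simp, div_pow, Real.sq_sqrt hp.le,
    Real.sq_sqrt hq.le] at h1
  have h2 := mul_le_mul_of_nonneg_left h1 hq.le
  rwa [← mul_assoc, mul_div_cancel₀ _ hq.ne'] at h2

lemma gaussCov_le_sechPow {p : ℝ} (hp : 0 < p) (τ : ℝ) : gaussCov τ ≤ sechPow p (τ / √p) := by
  rw [sechPow_eq_exp, gaussCov, neg_div]
  refine Real.exp_le_exp.2 (neg_le_neg ?_)
  have h1 := mul_le_mul_of_nonneg_left (log_cosh_le_sq (τ / √p / 2)) hp.le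
  rw [div_pow, div_pow, Real.sq_sqrt hp.le] at h1
  refine h1.trans_eq ?_
  field_simp
  norm_num

lemma tendsto_sechPow_comp_div_sqrt (τ : ℝ) :
    Tendsto (fun p => sechPow p (τ / √p)) atTop (𝓝 (gaussCov τ)) := by
  have h1 : Tendsto (fun p : ℝ => Real.exp (-(τ ^ 2 / 8 * Real.exp (-(τ ^ 2 / 8 / p))))) atTop
      (𝓝 (Real.exp (-(τ ^ 2 / 8 * Real.exp (-0))))) := by
    refine Real.continuous_exp.continuousAt.tendsto.comp (Tendsto.neg (Tendsto.const_mul _ ?_))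
    exact Real.continuous_exp.continuousAt.tendsto.comp
      (Tendsto.neg (tendsto_const_nhds.div_atTop tendsto_id))
  rw [neg_zero, Real.exp_zero, mul_one, ← neg_div, ← gaussCov] at h1
  refine tendsto_of_tendsto_of_tendsto_of_le_of_le' tendsto_const_nhds h1 ?_ ?_
  · filter_upwards [eventually_gt_atTop 0] with p hp using gaussCov_le_sechPow hp τ
  · filter_upwards [eventually_gt_atTop 0] with p hp
    rw [sechPow_eq_exp]
    refine Real.exp_le_exp.2 (neg_le_neg ?_)
    have h2 := mul_le_mul_of_nonneg_left (sq_mul_exp_le_log_cosh (τ / √p / 2)) hp.le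
    rw [div_pow, div_pow, Real.sq_sqrt hp.le, ← mul_assoc] at h2
    have h3 : τ ^ 2 / p / 2 ^ 2 / 2 = τ ^ 2 / 8 / p := by ring
    rw [h3, mul_div_cancel₀ _ hp.ne'] at h2
    exact h2

lemma psdFun_gaussCov : PSDFun gaussCov :=
  PSDFun.of_tendsto (l := atTop) (C := fun p τ => sechPow p (τ / √p))
    ((eventually_gt_atTop 0).mono fun _ hp => (psdFun_sechPow hp).comp_div _)
    tendsto_sechPow_comp_div_sqrt

lemma admissible_gaussCov : Admissible gaussCov := by
  refine admissible_of_exp_le psdFun_gaussCov (by simp [gaussCov])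
    ⟨Real.exp 2, 1, Real.exp_pos _, one_pos, fun τ => ?_⟩ fun T hT =>
    ⟨T / 4, by positivity, fun τ hτ => ?_⟩
  · rw [gaussCov, ← Real.exp_add]
    refine Real.exp_le_exp.2 ?_
    rw [← sq_abs]
    nlinarith [sq_nonneg (|τ| - 4)]
  · refine Real.exp_le_exp.2 ?_
    rw [← sq_abs]
    nlinarith [abs_nonneg τ]

/-! ### Monotonicity and limits of the rescaled exponents -/

lemma expo_sechPow_div_self {p : ℝ} (hp : 0 < p) :
    p ^ (-1 : ℝ) * expo (sechPow p) = expo fun τ => sechPow p (τ / p) := by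
  rw [(admissible_sechPow hp).expo_comp_div hp (admissible_sechPow_comp_div hp hp),
    Real.rpow_neg_one]
  ring

lemma expo_sechPow_div_sqrt {p : ℝ} (hp : 0 < p) :
    p ^ (-(1 / 2) : ℝ) * expo (sechPow p) = expo fun τ => sechPow p (τ / √p) := by
  rw [(admissible_sechPow hp).expo_comp_div (Real.sqrt_pos.2 hp)
    (admissible_sechPow_comp_div hp (Real.sqrt_pos.2 hp)), Real.rpow_neg hp.le,
    ← Real.sqrt_eq_rpow]
  ring

theorem antitoneOn_expo_sechPow :
    AntitoneOn (fun p : ℝ => p ^ (-1 : ℝ) * expo (sechPow p)) (Ioi 0) := by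
  intro p hp q hq hpq
  rw [mem_Ioi] at hp hq
  simp only [expo_sechPow_div_self hp, expo_sechPow_div_self hq]
  exact (admissible_sechPow_comp_div hp hp).expo_le_expo (admissible_sechPow_comp_div hq hq)
    (sechPow_comp_div_self_le hp hpq)

theorem monotoneOn_expo_sechPow :
    MonotoneOn (fun p : ℝ => p ^ (-(1 / 2) : ℝ) * expo (sechPow p)) (Ioi 0) := by
  intro p hp q hq hpq
  rw [mem_Ioi] at hp hq
  simp only [expo_sechPow_div_sqrt hp, expo_sechPow_div_sqrt hq]
  exact (admissible_sechPow_comp_div hq (Real.sqrt_pos.2 hq)).expo_le_expo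
    (admissible_sechPow_comp_div hp (Real.sqrt_pos.2 hp)) (sechPow_comp_div_sqrt_le hp hpq)

lemma tendsto_of_eventually_sub_le {α : Type*} {l : Filter α} {f : α → ℝ} {b : ℝ}
    (hle : ∀ᶠ a in l, f a ≤ b) (hge : ∀ ε > 0, ∀ᶠ a in l, b - ε ≤ f a) : Tendsto f l (𝓝 b) := by
  rw [Metric.tendsto_nhds]
  intro ε hε
  filter_upwards [hle, hge (ε / 2) (half_pos hε)] with a h1 h2
  rw [Real.dist_eq, abs_lt]
  constructor <;> linarith

lemma sechPow_one_le (τ : ℝ) : sechPow 1 τ ≤ 2 * Real.exp (-(|τ| / 2)) := by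
  have := sechPow_comp_div_le one_pos one_pos τ
  rw [div_one, Real.rpow_one] at this
  refine this.trans_eq ?_
  congr 2
  ring

lemma ouCov_le_sechPow {p : ℝ} (hp : 0 < p) (τ : ℝ) : ouCov τ ≤ sechPow p (τ / p) := by
  have := exp_le_sechPow_comp_div hp hp τ
  rwa [div_self hp.ne', one_mul] at this

/-- The kernels lie above their limit `ouCov`, which bounds the exponents from above; for `p ≤ 1`
they lie below the kernel with `p = 1`, which supplies the uniform decay for lower semicontinuity.
-/
theorem tendsto_expo_sechPow_zero :
    Tendsto (fun p : ℝ => p ^ (-1 : ℝ) * expo (sechPow p)) (𝓝[>] 0) (𝓝 (1 / 2)) := by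
  have hpos : ∀ᶠ p : ℝ in 𝓝[>] 0, 0 < p := self_mem_nhdsWithin
  have hone : ∀ᶠ p : ℝ in 𝓝[>] 0, p ≤ 1 :=
    (eventually_le_nhds one_pos).filter_mono nhdsWithin_le_nhds
  have : Tendsto (fun p : ℝ => expo fun τ => sechPow p (τ / p)) (𝓝[>] 0) (𝓝 (expo ouCov)) := by
    refine tendsto_of_eventually_sub_le ?_ fun ε hε => ?_
    · filter_upwards [hpos] with p hp
      exact admissible_ouCov.expo_le_expo (admissible_sechPow_comp_div hp hp) (ouCov_le_sechPow hp)
    · refine eventually_sub_le_expo (C := fun p τ => sechPow p (τ / p)) admissible_ouCov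
        (fun τ hτ => ?_) psdFun_ouCov ?_ (fun τ => ?_) hε
      · rw [ouCov, Real.exp_lt_one_iff]
        have := abs_pos.2 hτ
        linarith
      · filter_upwards [hpos, hone] with p hp hp1
        refine ⟨admissible_sechPow_comp_div hp hp, fun τ => ?_⟩
        have := sechPow_comp_div_self_le hp hp1 τ
        rw [div_one] at this
        exact this.trans (sechPow_one_le τ)
      · have h1 : Tendsto (fun p : ℝ => (2 : ℝ) ^ p * ouCov τ) (𝓝[>] 0) (𝓝 (2 ^ (0 : ℝ) * ouCov τ)) :=
          (((Real.continuous_const_rpow two_ne_zero).tendsto 0).mono_left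
            nhdsWithin_le_nhds).mul_const _
        rw [Real.rpow_zero, one_mul] at h1
        refine tendsto_of_tendsto_of_tendsto_of_le_of_le' tendsto_const_nhds h1 ?_ ?_
        · filter_upwards [hpos] with p hp using ouCov_le_sechPow hp τ
        · filter_upwards [hpos] with p hp
          refine (sechPow_comp_div_le hp hp τ).trans_eq ?_
          rw [ouCov]
          congr 2
          field_simp
  rw [expo_ouCov] at this
  refine this.congr' ?_
  filter_upwards [hpos] with p hp using (expo_sechPow_div_self hp).symm

/-- Here too the kernels lie above their limit, and the kernel with `p = 1` dominates all those with
`p ≥ 1`. -/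
theorem tendsto_expo_sechPow_atTop :
    Tendsto (fun p : ℝ => p ^ (-(1 / 2) : ℝ) * expo (sechPow p)) atTop (𝓝 (expo gaussCov)) := by
  have : Tendsto (fun p : ℝ => expo fun τ => sechPow p (τ / √p)) atTop (𝓝 (expo gaussCov)) := by
    refine tendsto_of_eventually_sub_le ?_ fun ε hε => ?_
    · filter_upwards [eventually_gt_atTop 0] with p hp
      exact admissible_gaussCov.expo_le_expo (admissible_sechPow_comp_div hp (Real.sqrt_pos.2 hp))
        (gaussCov_le_sechPow hp)
    · refine eventually_sub_le_expo (C := fun p τ => sechPow p (τ / √p)) admissible_gaussCov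
        (fun τ hτ => ?_) psdFun_ouCov ?_ tendsto_sechPow_comp_div_sqrt hε
      · rw [gaussCov, Real.exp_lt_one_iff]
        have : 0 < τ ^ 2 := by positivity
        linarith
      · filter_upwards [eventually_ge_atTop 1] with p hp
        have hp0 : 0 < p := by linarith
        refine ⟨admissible_sechPow_comp_div hp0 (Real.sqrt_pos.2 hp0), fun τ => ?_⟩
        have := sechPow_comp_div_sqrt_le one_pos hp τ
        rw [Real.sqrt_one, div_one] at this
        exact this.trans (sechPow_one_le τ)
  refine this.congr' ?_
  filter_upwards [eventually_gt_atTop 0] with p hp using (expo_sechPow_div_sqrt hp).symm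

end SechPow

/-! ### Gaussian processes with continuous paths -/

section Paths

variable {Ω : Type u} [MeasurableSpace Ω] {P : Measure Ω}

lemma CenteredGaussian.of_isGaussianProcess {I ι : Type*} [Fintype ι] {X : I → Ω → ℝ}
    {K : I → I → ℝ} (hX : IsGaussianProcess X P) (h0 : ∀ t, ∫ ω, X t ω ∂P = 0)
    (hK : ∀ s t, cov[X s, X t; P] = K s t) (t : ι → I) :
    CenteredGaussian (fun i => X (t i)) P (Matrix.of fun i j => K (t i) (t j)) := by
  classical
  have := hX.isProbabilityMeasure
  let J : Finset I := Finset.univ.image t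
  have h1 : CenteredGaussian (fun s : J => X s) P (Matrix.of fun s r : J => K s r) := by
    refine ⟨hX.hasGaussianLaw J, fun s => h0 s, fun s r => ?_⟩
    have h2 := hK s r
    rw [covariance_eq_sub (hX.hasGaussianLaw_eval s).memLp_two
      (hX.hasGaussianLaw_eval r).memLp_two, h0, h0, mul_zero, sub_zero] at h2
    exact h2
  exact h1.comp fun i => ⟨t i, Finset.mem_image_of_mem _ (Finset.mem_univ i)⟩

lemma isStationaryGaussian_of_centeredGaussian {I : Type} [Add I] {X : I → Ω → ℝ}
    {K : I → I → ℝ} (hadd : ∀ h s t, K (s + h) (t + h) = K s t)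
    (hX : ∀ {ι : Type} [Fintype ι] (t : ι → I),
      CenteredGaussian (fun i => X (t i)) P (Matrix.of fun i j => K (t i) (t j))) :
    IsStationaryGaussian X P K where
  gaussian := ⟨fun J => (hX fun t : J => (t : I)).gaussian⟩
  centered t := (hX fun _ : Unit => t).centered ()
  cov_eq s t := (hX ![s, t]).covariance_eq 0 1
  stationary h J := by
    rw [(hX fun t : J => (t : I) + h).map_eq, (hX fun t : J => (t : I)).map_eq]
    simp only [hadd]

variable {X : ℝ≥0 → Ω → ℝ} {C : ℝ → ℝ}

/-- Path continuity reduces the event to a countable dense set of times, and continuity of the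
measure to finite sets; null measurability suffices. -/
lemma real_stayBelow (hX : IsGaussianProcess X P) (h0 : ∀ t, ∫ ω, X t ω ∂P = 0)
    (hK : ∀ s t, cov[X s, X t; P] = C ((t : ℝ) - s)) (hC : PSDFun C)
    (hcont : ∀ᵐ ω ∂P, Continuous fun t => X t ω) {T : ℝ} (hT : 0 ≤ T) (x : ℝ) :
    P.real (stayBelow X T x) = persist C T x := by
  have := hX.isProbabilityMeasure
  have hfin : ∀ {n : ℕ} (t : Fin n → ℝ≥0), P.real {ω | ∀ i, X (t i) ω ≤ x} =
      orth (covMat C fun i => (t i : ℝ)) fun _ => x := by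
    intro n t
    have h1 := CenteredGaussian.of_isGaussianProcess hX h0 hK t
    rw [h1.real_le]
    congr 1
    ext i j
    simp only [Matrix.of_apply, covMat]
    rw [← hC.neg_apply, neg_sub]
  apply le_antisymm
  · refine le_persist fun n t ht => ?_
    have h1 : P.real {ω | ∀ i, X ⟨t i, (ht i).1⟩ ω ≤ x} = orth (covMat C t) fun _ => x :=
      hfin fun i => (⟨t i, (ht i).1⟩ : ℝ≥0)
    rw [← h1]
    exact measureReal_mono fun ω hω i => hω _ (ht i).2
  · have : Nonempty (Iic T.toNNReal) := ⟨⟨0, mem_Iic.2 zero_le⟩⟩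
    let d : ℕ → Iic T.toNNReal := TopologicalSpace.denseSeq _
    let A : ℕ → Set Ω := fun n => {ω | ∀ i : Fin n, X (d i) ω ≤ x}
    have hd : ∀ k, ((d k : ℝ≥0) : ℝ) ≤ T := fun k => by
      have h2 : ((d k : ℝ≥0) : ℝ) ≤ (T.toNNReal : ℝ) := NNReal.coe_le_coe.2 (d k).2
      exact h2.trans_eq (Real.coe_toNNReal T hT)
    have hanti : Antitone A := fun m n hmn ω hω i => hω ⟨i, i.2.trans_le hmn⟩
    have hmeas : ∀ n, NullMeasurableSet (A n) P := fun n => by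
      have h3 : A n = ⋂ i : Fin n, {ω | X (d i) ω ≤ x} := by ext; simp [A]
      rw [h3]
      exact NullMeasurableSet.iInter fun i =>
        nullMeasurableSet_le (hX.aemeasurable _) aemeasurable_const
    have hlim := tendsto_measure_iInter_atTop hmeas hanti ⟨0, measure_ne_top _ _⟩
    have hlim' : Tendsto (fun n => P.real (A n)) atTop (𝓝 (P.real (⋂ n, A n))) :=
      (ENNReal.tendsto_toReal (measure_ne_top _ _)).comp hlim
    have heq : P.real (stayBelow X T x) = P.real (⋂ n, A n) := by
      refine measureReal_congr ?_
      filter_upwards [hcont] with ω hω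
      refine propext ⟨fun h => mem_iInter.2 fun n i => h _ (hd i), fun h t ht => ?_⟩
      have hcl : IsClosed {s : Iic T.toNNReal | X s ω ≤ x} :=
        isClosed_le (hω.comp continuous_subtype_val) continuous_const
      have hdense := (TopologicalSpace.denseRange_denseSeq (Iic T.toNNReal))
      have hall := hdense.induction_on (p := fun s : Iic T.toNNReal => X s ω ≤ x)
        ⟨t, NNReal.le_toNNReal_of_coe_le ht⟩ hcl
        fun k => mem_iInter.1 h (k + 1) ⟨k, Nat.lt_succ_self k⟩
      exact hall
    rw [heq]
    refine ge_of_tendsto' hlim' fun n => ?_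
    have h4 := hfin fun i : Fin n => (d i : ℝ≥0)
    change _ ≤ P.real {ω | ∀ i : Fin n, X (d i) ω ≤ x}
    rw [h4]
    exact persist_le_orth' hC (fun i : Fin n => ⟨NNReal.coe_nonneg _, hd i⟩) x

theorem isPersistenceExponent_expo (hX : IsGaussianProcess X P) (h0 : ∀ t, ∫ ω, X t ω ∂P = 0)
    (hK : ∀ s t, cov[X s, X t; P] = C ((t : ℝ) - s)) (hC : Admissible C)
    (hcont : ∀ᵐ ω ∂P, Continuous fun t => X t ω) : IsPersistenceExponent P X (expo C) := by
  intro δ hδ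
  obtain ⟨h1, h2⟩ := hC.tendsto_level hδ
  have heq : ∀ T, 0 ≤ T → P.real (stayBelow X T (δ T)) = persist C T (δ T) :=
    fun T hT => real_stayBelow hX h0 hK hC.psd hcont hT _
  refine ⟨?_, h2.congr' ?_⟩
  · filter_upwards [h1, eventually_ge_atTop 0] with T hT hT0
    rwa [heq T hT0]
  · filter_upwards [eventually_ge_atTop 0] with T hT0
    rw [heq T hT0]

end Paths

/-! ### Limits in `L²` -/

section L2Limits

variable {Ω : Type*} [MeasurableSpace Ω] {μ : Measure Ω}

lemma inner_toLp {f g : Ω → ℝ} (hf : MemLp f 2 μ) (hg : MemLp g 2 μ) :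
    inner ℝ (hf.toLp f) (hg.toLp g) = ∫ ω, f ω * g ω ∂μ := by
  rw [L2.inner_def]
  refine integral_congr_ae ?_
  filter_upwards [hf.coeFn_toLp, hg.coeFn_toLp] with ω h1 h2
  rw [h1, h2]
  simp [mul_comm]

lemma norm_toLp_sq {f : Ω → ℝ} (hf : MemLp f 2 μ) : ‖hf.toLp f‖ ^ 2 = ∫ ω, f ω ^ 2 ∂μ := by
  rw [← real_inner_self_eq_norm_sq, inner_toLp]
  simp_rw [sq]

lemma tendsto_integral_mul_of_eLpNorm {f f' : ℕ → Ω → ℝ} {g g' : Ω → ℝ}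
    (hf : ∀ n, MemLp (f n) 2 μ) (hf' : ∀ n, MemLp (f' n) 2 μ) (hg : MemLp g 2 μ)
    (hg' : MemLp g' 2 μ) (h : Tendsto (fun n => eLpNorm (g - f n) 2 μ) atTop (𝓝 0))
    (h' : Tendsto (fun n => eLpNorm (g' - f' n) 2 μ) atTop (𝓝 0)) :
    Tendsto (fun n => ∫ ω, f n ω * f' n ω ∂μ) atTop (𝓝 (∫ ω, g ω * g' ω ∂μ)) := by
  simp_rw [eLpNorm_sub_comm g] at h
  simp_rw [eLpNorm_sub_comm g'] at h'
  have h1 := (Lp.tendsto_Lp_iff_tendsto_eLpNorm'' f hf g hg).2 h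
  have h2 := (Lp.tendsto_Lp_iff_tendsto_eLpNorm'' f' hf' g' hg').2 h'
  have h3 := h1.inner (𝕜 := ℝ) h2
  simpa only [inner_toLp] using h3

lemma tendsto_eLpNorm_sum_sub {ι : Type*} [Fintype ι] {X : ι → Ω → ℝ} {Y : ℕ → ι → Ω → ℝ}
    (hX : ∀ i, MemLp (X i) 2 μ) (hY : ∀ n i, MemLp (Y n i) 2 μ)
    (h : ∀ i, Tendsto (fun n => eLpNorm (X i - Y n i) 2 μ) atTop (𝓝 0)) (w : ι → ℝ) :
    Tendsto (fun n => eLpNorm ((fun ω => ∑ i, w i * X i ω) - fun ω => ∑ i, w i * Y n i ω) 2 μ)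
      atTop (𝓝 0) := by
  have h1 : Tendsto (fun n => ∑ i, ‖w i‖ₑ * eLpNorm (X i - Y n i) 2 μ) atTop (𝓝 0) := by
    have := tendsto_finsetSum Finset.univ fun i _ =>
      ENNReal.Tendsto.const_mul (a := ‖w i‖ₑ) (h i) (Or.inr enorm_ne_top)
    simpa using this
  refine tendsto_of_tendsto_of_tendsto_of_le_of_le tendsto_const_nhds h1 (fun n => zero_le)
    fun n => ?_
  have h2 : ((fun ω => ∑ i, w i * X i ω) - fun ω => ∑ i, w i * Y n i ω) =
      ∑ i, w i • (X i - Y n i) := by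
    ext ω
    simp [Finset.sum_apply, mul_sub]
  simp only [h2]
  refine (eLpNorm_sum_le (fun i _ => (((hX i).sub (hY n i)).const_smul (w i)).1)
    (by norm_num)).trans_eq ?_
  exact Finset.sum_congr rfl fun i _ => eLpNorm_const_smul _ _ _ _

/-- Along a subsequence the variables converge almost surely, so their characteristic functions
converge by dominated convergence. -/
lemma map_eq_gaussianReal_of_tendsto_eLpNorm [IsProbabilityMeasure μ] {X : Ω → ℝ}
    {Y : ℕ → Ω → ℝ} {v : ℕ → ℝ≥0} {w : ℝ≥0} (hX : MemLp X 2 μ) (hY : ∀ n, MemLp (Y n) 2 μ)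
    (hlaw : ∀ n, μ.map (Y n) = gaussianReal 0 (v n)) (hv : Tendsto v atTop (𝓝 w))
    (h : Tendsto (fun n => eLpNorm (X - Y n) 2 μ) atTop (𝓝 0)) :
    μ.map X = gaussianReal 0 w := by
  have hXm := hX.1.aemeasurable
  have : IsProbabilityMeasure (μ.map X) := Measure.isProbabilityMeasure_map hXm
  simp_rw [eLpNorm_sub_comm X] at h
  obtain ⟨ns, hns, hae⟩ := (tendstoInMeasure_of_tendsto_eLpNorm two_ne_zero
    (fun n => (hY n).1) hX.1 h).exists_seq_tendsto_ae
  refine Measure.ext_of_charFun (funext fun t => ?_)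
  have hexp : ∀ {Z : Ω → ℝ}, AEMeasurable Z μ → charFun (μ.map Z) t =
      ∫ ω, Complex.exp (t * Z ω * Complex.I) ∂μ := by
    intro Z hZ
    rw [charFun_apply_real, integral_map hZ (by fun_prop)]
  have h1 : Tendsto (fun n => charFun (μ.map (Y (ns n))) t) atTop (𝓝 (charFun (μ.map X) t)) := by
    rw [hexp hXm]
    simp_rw [hexp (hY _).1.aemeasurable]
    refine tendsto_integral_of_dominated_convergence (fun _ => 1) (fun n => ?_)
      (integrable_const _) (fun n => ae_of_all _ fun ω => ?_) ?_
    · have := (hY (ns n)).1.aemeasurable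
      exact AEMeasurable.aestronglyMeasurable (by fun_prop)
    · rw [← Complex.ofReal_mul, Complex.norm_exp_ofReal_mul_I]
    · filter_upwards [hae] with ω hω
      have hc : Continuous fun y : ℝ => Complex.exp (t * y * Complex.I) := by fun_prop
      exact (hc.tendsto _).comp hω
  refine tendsto_nhds_unique h1 ?_
  simp_rw [hlaw, charFun_gaussianReal]
  have h2 : Tendsto (fun n => ((v (ns n) : ℝ) : ℂ)) atTop (𝓝 ((w : ℝ) : ℂ)) :=
    (Complex.continuous_ofReal.tendsto _).comp
      ((NNReal.continuous_coe.tendsto _).comp (hv.comp hns.tendsto_atTop))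
  refine (Complex.continuous_exp.tendsto _).comp ?_
  exact tendsto_const_nhds.sub ((h2.mul_const _).div_const _)

/-- Limits in `L²` of centered Gaussian vectors are centered Gaussian. -/
theorem CenteredGaussian.of_tendsto_eLpNorm {ι : Type*} [Fintype ι] {X : ι → Ω → ℝ}
    {Y : ℕ → ι → Ω → ℝ} {S : ℕ → Matrix ι ι ℝ} [IsProbabilityMeasure μ]
    (hX : ∀ i, MemLp (X i) 2 μ) (hY : ∀ n, CenteredGaussian (Y n) μ (S n))
    (h : ∀ i, Tendsto (fun n => eLpNorm (X i - Y n i) 2 μ) atTop (𝓝 0)) :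
    CenteredGaussian X μ (Matrix.of fun i j => ∫ ω, X i ω * X j ω ∂μ) := by
  classical
  -- Gaussianity of a vector is tested on its linear combinations, which are `L²` limits of Gaussian
  -- variables.
  have hmap : ∀ w : ι → ℝ, ∃ v : ℝ≥0, μ.map (fun ω => ∑ i, w i * X i ω) = gaussianReal 0 v := by
    intro w
    have hXw : MemLp (fun ω => ∑ i, w i * X i ω) 2 μ :=
      memLp_finsetSum _ fun i _ => (hX i).const_mul (w i)
    have hYw : ∀ n, MemLp (fun ω => ∑ i, w i * Y n i ω) 2 μ := fun n =>
      memLp_finsetSum _ fun i _ => ((hY n).memLp i).const_mul (w i)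
    have h1 := tendsto_eLpNorm_sum_sub hX (fun n => (hY n).memLp) h w
    have h2 := tendsto_integral_mul_of_eLpNorm hYw hYw hXw hXw h1 h1
    have h3 : ∀ n, ∫ ω, (∑ i, w i * Y n i ω) * ∑ i, w i * Y n i ω ∂μ =
        dotProduct w ((S n).mulVec w) := by
      intro n
      rw [← (hY n).integral_sq_sum]
      simp_rw [sq]
    simp_rw [h3] at h2
    exact ⟨_, map_eq_gaussianReal_of_tendsto_eLpNorm hXw hYw (fun n => (hY n).map_sum_eq w)
      ((continuous_real_toNNReal.tendsto _).comp h2) h1⟩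
  have hXm : AEMeasurable (fun ω i => X i ω) μ := aemeasurable_pi_lambda _ fun i =>
    (hX i).1.aemeasurable
  refine ⟨⟨isGaussian_of_map_eq_gaussianReal fun L => ?_⟩, fun i => ?_, fun i j => rfl⟩
  · obtain ⟨v, hv⟩ := hmap fun i => L (Pi.single i 1)
    refine ⟨0, v, ?_⟩
    rw [← hv, AEMeasurable.map_map_of_aemeasurable (by fun_prop) hXm]
    congr 1
    ext ω
    have := L.toLinearMap.pi_apply_eq_sum_univ fun i => X i ω
    simp only [ContinuousLinearMap.coe_coe, smul_eq_mul] at this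
    simp only [Function.comp_apply, this]
    refine Finset.sum_congr rfl fun i _ => ?_
    rw [mul_comm]
    congr 2
    ext j
    simp [Pi.single_apply, eq_comm]
  · obtain ⟨v, hv⟩ := hmap (Pi.single i 1)
    simp only [Pi.single_apply, ite_mul, one_mul, zero_mul, Finset.sum_ite_eq', Finset.mem_univ,
      if_true] at hv
    have h4 : ∫ x, x ∂(μ.map (X i)) = ∫ ω, X i ω ∂μ :=
      integral_map (hX i).1.aemeasurable (by fun_prop)
    rw [← h4]
    change ∫ x, x ∂(μ.map fun ω => X i ω) = 0
    rw [hv, integral_id_gaussianReal]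

end L2Limits

/-! ### Wiener integrals -/

section WienerIntegral

/-- The indicator function of `(0, t]`. -/
noncomputable def indIoc (t : ℝ≥0) (r : ℝ) : ℝ := (Ioc 0 (t : ℝ)).indicator (fun _ => 1) r

lemma memLp_indIoc (t : ℝ≥0) : MemLp (indIoc t) 2 (volume.restrict (Ioi (0 : ℝ))) :=
  memLp_indicator_const 2 measurableSet_Ioc 1 (Or.inr (by
    refine ne_top_of_le_ne_top ?_ (Measure.restrict_apply_le _ _)
    simp))

lemma integral_indIoc_mul (s t : ℝ≥0) :
    ∫ r in Ioi (0 : ℝ), indIoc s r * indIoc t r = (min s t : ℝ≥0) := by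
  have h1 : ∀ r, indIoc s r * indIoc t r =
      (Ioc 0 ((min s t : ℝ≥0) : ℝ)).indicator (1 : ℝ → ℝ) r := by
    intro r
    simp only [indIoc, indicator, mem_Ioc, NNReal.coe_min, le_min_iff]
    by_cases h0 : 0 < r <;> by_cases h1 : r ≤ s <;> by_cases h2 : r ≤ t <;> simp [h0, h1, h2]
  simp_rw [h1]
  rw [integral_indicator_one measurableSet_Ioc, measureReal_restrict_apply measurableSet_Ioc,
    inter_eq_left.2 Ioc_subset_Ioi_self]
  rw [measureReal_def, Real.volume_Ioc, sub_zero, ENNReal.toReal_ofReal (NNReal.coe_nonneg _)]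

lemma indicator_Ioc_eq_sub {a b : ℝ≥0} (hab : a ≤ b) (r : ℝ) :
    (Ioc (a : ℝ) b).indicator (fun _ => (1 : ℝ)) r = indIoc b r - indIoc a r := by
  have ha : (0 : ℝ) ≤ a := a.2
  have hab' : (a : ℝ) ≤ b := hab
  simp only [indIoc, indicator, mem_Ioc]
  by_cases h0 : 0 < r <;> by_cases h1 : r ≤ a <;> by_cases h2 : r ≤ b <;>
    simp [h0, h1, h2, not_lt.2, not_le.1] <;> grind

namespace StepFunction

/-- The functions `indIoc t` in `L²(0, ∞)` have the same Gram kernel `min s t` as Brownian motion.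
Treating a step function as an elementary integral against them reduces the isometry to one
computation applied twice. -/
lemma eval_eq_wienerSum (φ : StepFunction) : φ.eval = φ.wienerSum indIoc := by
  ext r
  exact Finset.sum_congr rfl fun i _ => by rw [indicator_Ioc_eq_sub (φ.lo_le_hi i)]

variable {A : Type*} [MeasurableSpace A] {ν : Measure A} {V : ℝ≥0 → A → ℝ}

lemma memLp_wienerSum (hV : ∀ t, MemLp (V t) 2 ν) (φ : StepFunction) :
    MemLp (φ.wienerSum V) 2 ν :=
  memLp_finsetSum _ fun i _ => ((hV _).sub (hV _)).const_mul (φ.c i)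

lemma memLp_eval (φ : StepFunction) : MemLp φ.eval 2 (volume.restrict (Ioi (0 : ℝ))) := by
  rw [eval_eq_wienerSum]
  exact φ.memLp_wienerSum memLp_indIoc

lemma integral_wienerSum_mul (hV : ∀ t, MemLp (V t) 2 ν)
    (hVV : ∀ s t, ∫ a, V s a * V t a ∂ν = (min s t : ℝ≥0)) (φ ψ : StepFunction) :
    ∫ a, φ.wienerSum V a * ψ.wienerSum V a ∂ν = ∑ i, ∑ j, φ.c i * ψ.c j *
      (((min (φ.hi i) (ψ.hi j) : ℝ≥0) - (min (φ.hi i) (ψ.lo j) : ℝ≥0)) -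
        ((min (φ.lo i) (ψ.hi j) : ℝ≥0) - (min (φ.lo i) (ψ.lo j) : ℝ≥0))) := by
  have hint : ∀ s t, Integrable (fun a => V s a * V t a) ν := fun s t => (hV s).integrable_mul (hV t)
  have h1 : ∀ a, φ.wienerSum V a * ψ.wienerSum V a = ∑ i, ∑ j, φ.c i * ψ.c j *
      ((V (φ.hi i) a * V (ψ.hi j) a - V (φ.hi i) a * V (ψ.lo j) a) -
        (V (φ.lo i) a * V (ψ.hi j) a - V (φ.lo i) a * V (ψ.lo j) a)) := by
    intro a
    rw [wienerSum, wienerSum, Finset.sum_mul_sum]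
    exact Finset.sum_congr rfl fun i _ => Finset.sum_congr rfl fun j _ => by ring
  have hd : ∀ s t t', Integrable (fun a => V s a * V t a - V s a * V t' a) ν := fun s t t' =>
    (hint s t).sub (hint s t')
  have hi : ∀ s t s' t', Integrable (fun a => (V s a * V t a - V s a * V t' a) -
      (V s' a * V t a - V s' a * V t' a)) ν := fun s t s' t' =>
    (hd s t t').sub (hd s' t t')
  simp_rw [h1]
  rw [integral_finsetSum _ fun i _ => integrable_finsetSum _ fun j _ => (hi _ _ _ _).const_mul _]
  refine Finset.sum_congr rfl fun i _ => ?_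
  rw [integral_finsetSum _ fun j _ => (hi _ _ _ _).const_mul _]
  refine Finset.sum_congr rfl fun j _ => ?_
  rw [integral_const_mul, integral_sub (hd _ _ _) (hd _ _ _),
    integral_sub (hint _ _) (hint _ _), integral_sub (hint _ _) (hint _ _), hVV, hVV, hVV, hVV]

end StepFunction

variable {Ω : Type u} [MeasurableSpace Ω] {P : Measure Ω} {W : ℝ≥0 → Ω → ℝ}

namespace BrownianIntegral

lemma memLp (hW : IsPreBrownianReal W P) (t : ℝ≥0) : MemLp (W t) 2 P :=
  (hW.isGaussianProcess.hasGaussianLaw_eval t).memLp_two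

lemma integral_mul (hW : IsPreBrownianReal W P) (s t : ℝ≥0) :
    ∫ ω, W s ω * W t ω ∂P = (min s t : ℝ≥0) := by
  have := hW.isGaussianProcess.isProbabilityMeasure
  have h := hW.covariance_eval s t
  rw [covariance_eq_sub (memLp hW s) (memLp hW t), hW.integral_eval, hW.integral_eval,
    mul_zero, sub_zero] at h
  exact h.trans (by simp)

lemma integral_wienerSum_mul_eq (hW : IsPreBrownianReal W P) (φ ψ : StepFunction) :
    ∫ ω, φ.wienerSum W ω * ψ.wienerSum W ω ∂P =
      ∫ r in Ioi (0 : ℝ), φ.eval r * ψ.eval r := by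
  simp_rw [StepFunction.eval_eq_wienerSum]
  rw [StepFunction.integral_wienerSum_mul (memLp hW) (integral_mul hW),
    StepFunction.integral_wienerSum_mul memLp_indIoc integral_indIoc_mul]

lemma centeredGaussian_wienerSum {ι : Type*} [Fintype ι] (hW : IsPreBrownianReal W P)
    (φ : ι → StepFunction) : ∃ S, CenteredGaussian (fun i => (φ i).wienerSum W) P S := by
  classical
  let t : (Σ i, Fin (φ i).n × Bool) → ℝ≥0 := fun p =>
    if p.2.2 then (φ p.1).hi p.2.1 else (φ p.1).lo p.2.1
  have h1 := CenteredGaussian.of_isGaussianProcess hW.isGaussianProcess hW.integral_eval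
    (fun s t => rfl) t
  let A : Matrix ι (Σ i, Fin (φ i).n × Bool) ℝ := Matrix.of fun i p =>
    if p.1 = i then (φ p.1).c p.2.1 * (if p.2.2 then 1 else -1) else 0
  obtain ⟨S, hS⟩ : ∃ S, CenteredGaussian (fun i ω => ∑ p, A i p * W (t p) ω) P S :=
    ⟨_, h1.linear A⟩
  refine ⟨S, ?_⟩
  convert hS using 1
  funext i ω
  rw [Fintype.sum_sigma, Finset.sum_eq_single i]
  · rw [Fintype.sum_prod_type]
    refine Finset.sum_congr rfl fun j _ => ?_
    simp [A, t]
    ring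
  · intro j _ hj
    simp [A, hj]
  · simp

end BrownianIntegral

namespace IsWienerIntegral

open BrownianIntegral

variable {g g' : ℝ → ℝ} {X X' : Ω → ℝ}

lemma integral_mul (hW : IsPreBrownianReal W P) (h : IsWienerIntegral W P g X)
    (h' : IsWienerIntegral W P g' X') :
    ∫ ω, X ω * X' ω ∂P = ∫ r in Ioi (0 : ℝ), g r * g' r := by
  obtain ⟨hg, hX, φ, hφ, hφX⟩ := h
  obtain ⟨hg', hX', ψ, hψ, hψX⟩ := h'
  have h1 := tendsto_integral_mul_of_eLpNorm (fun n => (φ n).memLp_eval)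
    (fun n => (ψ n).memLp_eval) hg hg' hφ hψ
  have h2 := tendsto_integral_mul_of_eLpNorm
    (fun n => (φ n).memLp_wienerSum (memLp hW))
    (fun n => (ψ n).memLp_wienerSum (memLp hW)) hX hX' hφX hψX
  simp_rw [integral_wienerSum_mul_eq hW] at h2
  exact tendsto_nhds_unique h2 h1

lemma centeredGaussian {ι : Type*} [Fintype ι] {g : ι → ℝ → ℝ} {X : ι → Ω → ℝ}
    (hW : IsPreBrownianReal W P) (h : ∀ i, IsWienerIntegral W P (g i) (X i)) :
    CenteredGaussian X P (Matrix.of fun i j => ∫ r in Ioi (0 : ℝ), g i r * g j r) := by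
  have := hW.isGaussianProcess.isProbabilityMeasure
  choose φ hφ hφX using fun i => (h i).2.2
  choose S hS using fun n => centeredGaussian_wienerSum hW fun i => φ i n
  have h1 := CenteredGaussian.of_tendsto_eLpNorm (fun i => (h i).2.1) hS hφX
  simp_rw [integral_mul hW (h _) (h _)] at h1
  exact h1

end IsWienerIntegral

/-! Density of step functions and existence of Wiener integrals. -/

lemma sum_indicator_Ioc (h : ℝ≥0) (N : ℕ) (r : ℝ) :
    ∑ i : Fin N, (Ioc (((i : ℕ) * h : ℝ≥0) : ℝ) ((((i : ℕ) + 1) * h : ℝ≥0) : ℝ)).indicator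
      (fun _ => (1 : ℝ)) r = indIoc (N * h) r := by
  have h1 : ∀ i : Fin N, (Ioc (((i : ℕ) * h : ℝ≥0) : ℝ)
      ((((i : ℕ) + 1) * h : ℝ≥0) : ℝ)).indicator (fun _ => (1 : ℝ)) r =
      indIoc (((i : ℕ) + 1 : ℕ) * h) r - indIoc ((i : ℕ) * h) r := fun i => by
    rw [indicator_Ioc_eq_sub (mul_le_mul_of_nonneg_right (by simp) h.2)]
    push_cast
    rfl
  simp_rw [h1]
  rw [Fin.sum_univ_eq_sum_range (fun i => indIoc ((i + 1 : ℕ) * h) r - indIoc (i * h) r),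
    Finset.sum_range_sub (fun i => indIoc ((i : ℝ≥0) * h) r)]
  simp [indIoc]

lemma exists_step_eLpNorm_sub_le_of_continuous {f : ℝ → ℝ} (hf : Continuous f)
    (hfc : HasCompactSupport f) {ε : ℝ} (hε : 0 < ε) : ∃ φ : StepFunction,
    eLpNorm (fun r => f r - φ.eval r) 2 (volume.restrict (Ioi (0 : ℝ))) ≤ ENNReal.ofReal ε := by
  obtain ⟨R, hR⟩ := hfc.isCompact.isBounded.subset_closedBall 0
  set T : ℝ≥0 := R.toNNReal + 1 with hT
  have hT0 : 0 < T := by positivity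
  have hsupp : ∀ r, (T : ℝ) < r → f r = 0 := by
    intro r hr
    by_contra hne
    have h1 := hR (subset_tsupport f hne)
    rw [Metric.mem_closedBall, Real.dist_eq, sub_zero] at h1
    have h2 := le_abs_self r
    have h3 := Real.le_coe_toNNReal R
    rw [hT, NNReal.coe_add, NNReal.coe_one] at hr
    linarith
  -- A uniform error `η` on `(0, T]` has `L²` norm `η √T ≤ ε`.
  set η := ε / (√T + 1) with hη
  have hη0 : 0 < η := by positivity
  obtain ⟨δ, hδ, hfδ⟩ := Metric.uniformContinuous_iff.1 
    (hfc.uniformContinuous_of_continuous hf) η hη0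
  obtain ⟨N, hN⟩ := exists_nat_gt ((T : ℝ) / δ)
  have hN0 : (0 : ℝ) < N := lt_of_le_of_lt (by positivity) hN
  have hN0' : (N : ℝ≥0) ≠ 0 := by
    rintro h0
    rw [← NNReal.coe_natCast, h0] at hN0
    simp at hN0
  set h : ℝ≥0 := T / N with hh
  have hNh : (N : ℝ≥0) * h = T := mul_div_cancel₀ _ hN0'
  have hhδ : (h : ℝ) < δ := by
    rw [hh, NNReal.coe_div, NNReal.coe_natCast, div_lt_iff₀ hN0]
    rwa [div_lt_iff₀ hδ, mul_comm] at hN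
  let φ : StepFunction := ⟨N, fun i => (i : ℕ) * h, fun i => ((i : ℕ) + 1) * h,
    fun i => mul_le_mul_of_nonneg_right (by simp) h.2, fun i => f (((i : ℕ) + 1) * h : ℝ≥0)⟩
  refine ⟨φ, ?_⟩
  have hbd : ∀ r ∈ Ioi (0 : ℝ), ‖f r - φ.eval r‖ ≤ (Ioc 0 (T : ℝ)).indicator (fun _ => η) r := by
    intro r hr
    have h1 : f r = f r * indIoc T r := by
      by_cases hrT : r ≤ T
      · simp [indIoc, indicator, hrT, mem_Ioi.1 hr]
      · rw [hsupp r (not_le.1 hrT), zero_mul]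
    have h2 : (Ioc 0 (T : ℝ)).indicator (fun _ => η) r = η * indIoc T r := by
      simp [indIoc, indicator]
    rw [h1, h2, ← hNh, ← sum_indicator_Ioc, StepFunction.eval, Finset.mul_sum, Finset.mul_sum,
      ← Finset.sum_sub_distrib]
    refine (norm_sum_le _ _).trans (Finset.sum_le_sum fun i _ => ?_)
    rw [← sub_mul, norm_mul]
    by_cases hri : r ∈ Ioc (((i : ℕ) * h : ℝ≥0) : ℝ) ((((i : ℕ) + 1) * h : ℝ≥0) : ℝ)
    · rw [indicator_of_mem hri, norm_one]
      refine mul_le_mul_of_nonneg_right ?_ zero_le_one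
      have h3 := hri.1
      have h4 := hri.2
      push_cast at h3 h4
      have h5 := hfδ (a := r) (b := ((((i : ℕ) + 1) * h : ℝ≥0) : ℝ)) (by
        rw [Real.dist_eq, abs_lt]
        push_cast
        constructor <;> nlinarith)
      rw [← dist_eq_norm]
      exact h5.le
    · rw [indicator_of_notMem hri, norm_zero, mul_zero, mul_zero]
  refine (eLpNorm_mono_ae_real ((ae_restrict_iff' measurableSet_Ioi).2 (ae_of_all _ hbd))).trans ?_
  refine (eLpNorm_indicator_const_le η 2).trans ?_
  have h1 : (volume.restrict (Ioi (0 : ℝ))) (Ioc 0 (T : ℝ)) ≤ ENNReal.ofReal T := by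
    refine (Measure.restrict_apply_le _ _).trans ?_
    simp
  refine (mul_le_mul_right (ENNReal.rpow_le_rpow h1 (by positivity)) _).trans ?_
  rw [ENNReal.ofReal_rpow_of_nonneg (NNReal.coe_nonneg T) (by positivity), Real.enorm_eq_ofReal hη0.le,
    ← ENNReal.ofReal_mul hη0.le]
  refine ENNReal.ofReal_le_ofReal ?_
  have h2 : (T : ℝ) ^ (1 / (2 : ENNReal).toReal) = √T := by
    rw [Real.sqrt_eq_rpow]
    norm_num
  rw [h2, hη, div_mul_eq_mul_div, div_le_iff₀ (by positivity)]
  nlinarith [Real.sqrt_nonneg (T : ℝ)]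

lemma exists_step_eLpNorm_sub_le {g : ℝ → ℝ} (hg : MemLp g 2 (volume.restrict (Ioi (0 : ℝ))))
    {ε : ℝ} (hε : 0 < ε) : ∃ φ : StepFunction,
    eLpNorm (fun r => g r - φ.eval r) 2 (volume.restrict (Ioi (0 : ℝ))) ≤ ENNReal.ofReal ε := by
  have h1 : MemLp ((Ioi (0 : ℝ)).indicator g) 2 volume :=
    (memLp_indicator_iff_restrict measurableSet_Ioi).2 hg
  obtain ⟨f, hfc, hfg, hf, -⟩ := h1.exists_hasCompactSupport_eLpNorm_sub_le (by norm_num)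
    (ε := ENNReal.ofReal (ε / 2)) (by simpa using hε)
  obtain ⟨φ, hφ⟩ := exists_step_eLpNorm_sub_le_of_continuous hf hfc (half_pos hε)
  refine ⟨φ, ?_⟩
  have h2 : eLpNorm (g - f) 2 (volume.restrict (Ioi (0 : ℝ))) ≤ ENNReal.ofReal (ε / 2) := by
    refine le_trans (le_of_eq ?_) ((eLpNorm_mono_measure _
      (Measure.restrict_le_self (s := Ioi (0 : ℝ)))).trans hfg)
    refine eLpNorm_congr_ae ((ae_restrict_iff' measurableSet_Ioi).2 (ae_of_all _ fun r hr => ?_))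
    simp [indicator_of_mem hr]
  have h3 : (fun r => g r - φ.eval r) = (g - f) + fun r => f r - φ.eval r := by
    ext r
    simp
  rw [h3]
  refine (eLpNorm_add_le (hg.1.sub hf.aestronglyMeasurable)
    (hf.aestronglyMeasurable.sub φ.memLp_eval.1) (by norm_num)).trans ?_
  refine (add_le_add h2 hφ).trans_eq ?_
  rw [← ENNReal.ofReal_add (by positivity) (by positivity), add_halves]

/-- The isometry carries the Cauchy property of the step functions over to their elementary
integrals. -/
theorem exists_isWienerIntegral (hW : IsPreBrownianReal W P) {g : ℝ → ℝ}
    (hg : MemLp g 2 (volume.restrict (Ioi (0 : ℝ)))) : ∃ X, IsWienerIntegral W P g X := by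
  choose φ hφ using fun n : ℕ => exists_step_eLpNorm_sub_le hg (Nat.one_div_pos_of_nat (n := n))
  have hφ0 : Tendsto (fun n => eLpNorm (g - (φ n).eval) 2 (volume.restrict (Ioi (0 : ℝ))))
      atTop (𝓝 0) := by
    have h1 : Tendsto (fun n : ℕ => ENNReal.ofReal (1 / (n + 1 : ℝ))) atTop (𝓝 0) := by
      have := ENNReal.tendsto_ofReal (tendsto_one_div_add_atTop_nhds_zero_nat (𝕜 := ℝ))
      simpa using this
    exact tendsto_of_tendsto_of_tendsto_of_le_of_le tendsto_const_nhds h1 (fun n => zero_le) hφ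
  have hmem := fun n => (φ n).memLp_eval
  have hmemW := fun n => (φ n).memLp_wienerSum (BrownianIntegral.memLp hW)
  have hdist : ∀ m n, dist ((hmemW m).toLp _) ((hmemW n).toLp _) =
      dist ((hmem m).toLp _) ((hmem n).toLp _) := by
    intro m n
    rw [dist_eq_norm, dist_eq_norm, ← sq_eq_sq₀ (norm_nonneg _) (norm_nonneg _),
      norm_sub_sq_real, norm_sub_sq_real]
    simp only [← real_inner_self_eq_norm_sq, inner_toLp,
      BrownianIntegral.integral_wienerSum_mul_eq hW]
  have hconv := (Lp.tendsto_Lp_iff_tendsto_eLpNorm'' _ hmem g hg).2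
    (by simpa only [eLpNorm_sub_comm g] using hφ0)
  have hC : CauchySeq fun n => (hmemW n).toLp _ := by
    have := hconv.cauchySeq
    rw [cauchySeq_iff_tendsto_dist_atTop_0] at this ⊢
    simpa only [hdist] using this
  obtain ⟨L, hL⟩ := cauchySeq_tendsto_of_complete hC
  refine ⟨L, hg, Lp.memLp L, φ, hφ0, ?_⟩
  have h2 := (Lp.tendsto_Lp_iff_tendsto_eLpNorm'' _ hmemW L (Lp.memLp L)).1
    (by rwa [Lp.toLp_coeFn])
  simp_rw [eLpNorm_sub_comm _ (L : Ω → ℝ)] at h2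
  exact h2

/-! The normalized process. -/

lemma CenteredGaussian.congr_ae {ι : Type*} [Fintype ι] {X Y : ι → Ω → ℝ} {S : Matrix ι ι ℝ}
    (h : CenteredGaussian X P S) (hXY : ∀ i, X i =ᵐ[P] Y i) : CenteredGaussian Y P S where
  gaussian := h.gaussian.congr (by
    filter_upwards [ae_all_iff.2 hXY] with ω hω
    exact funext hω)
  centered i := by rw [← integral_congr_ae (hXY i), h.centered]
  cov i j := by
    rw [← h.cov i j]
    refine integral_congr_ae ?_
    filter_upwards [hXY i, hXY j] with ω h1 h2
    rw [h1, h2]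

lemma memLp_gKernel {α : ℝ} (hα : -1 < α) (t : ℝ) :
    MemLp (gKernel α t) 2 (volume.restrict (Ioi (0 : ℝ))) := by
  have hm : AEStronglyMeasurable (gKernel α t) (volume.restrict (Ioi (0 : ℝ))) := by
    unfold gKernel
    exact Measurable.aestronglyMeasurable (by fun_prop)
  rw [memLp_two_iff_integrable_sq hm]
  simp_rw [sq]
  exact integrableOn_gKernel_mul hα t t

lemma IsNormalizedWienerProcess.centeredGaussian {α : ℝ} (hα : -1 < α)
    (hW : IsPreBrownianReal W P) {Y : ℝ → Ω → ℝ} (hY : IsNormalizedWienerProcess W P α Y)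
    {ι : Type*} [Fintype ι] (t : ι → ℝ) :
    CenteredGaussian (fun i => Y (t i)) P (Matrix.of fun i j => sechPow (α + 1) (t j - t i)) := by
  classical
  choose X hX hXY using hY
  have h1 := IsWienerIntegral.centeredGaussian hW fun i => hX (t i)
  have h2 := (h1.linear (Matrix.diagonal fun i =>
    (√(∫ r in Ioi (0 : ℝ), gKernel α (t i) r ^ 2))⁻¹)).congr_ae (Y := fun i => Y (t i)) fun i => by
      filter_upwards [hXY (t i)] with ω hω
      rw [hω, Finset.sum_eq_single i]
      · rw [Matrix.diagonal_apply_eq, div_eq_inv_mul]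
      · intro j _ hj
        rw [Matrix.diagonal_apply_ne _ hj.symm, zero_mul]
      · simp
  convert h2 using 1
  ext i j
  rw [Matrix.diagonal_transpose, Matrix.mul_diagonal, Matrix.diagonal_mul, Matrix.of_apply,
    Matrix.of_apply, sechPow_eq_integral hα]
  simp_rw [mul_comm (gKernel α (t j) _)]
  ring

end WienerIntegral

/-! ### Processes given by random power series -/

section PowerSeries

lemma contDiffAt_tsum_pow {b : ℕ → ℝ} {r x : ℝ} (hb : Summable fun n => |b n| * r ^ n)
    (hx : |x| < r) : ContDiffAt ℝ (⊤ : ℕ∞) (fun x => ∑' n, b n * x ^ n) x := by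
  have hr : 0 < r := (abs_nonneg x).trans_lt hx
  set p := FormalMultilinearSeries.ofScalars ℝ b with hp
  have h1 : ((r.toNNReal : ℝ≥0) : ENNReal) ≤ p.radius := by
    refine p.le_radius_of_summable_norm ?_
    simpa only [hp, FormalMultilinearSeries.ofScalars_norm, Real.norm_eq_abs,
      Real.coe_toNNReal r hr.le] using hb
  have h2 : 0 < p.radius := lt_of_lt_of_le (by simpa using hr) h1
  have h3 : (fun x => ∑' n, b n * x ^ n) = p.sum := by
    ext y
    exact (FormalMultilinearSeries.ofScalars_sum_eq b y).symm
  rw [h3]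
  refine ((p.hasFPowerSeriesOnBall h2).analyticAt_of_mem ?_).contDiffAt
  refine Metric.eball_subset_eball h1 ?_
  rw [Metric.mem_eball, edist_zero_right, enorm_eq_nnnorm, ENNReal.coe_lt_coe,
    ← NNReal.coe_lt_coe, Real.coe_toNNReal r hr.le]
  simpa using hx

variable {Ω : Type*} [MeasurableSpace Ω] {P : Measure Ω}

lemma ae_summable_mul_abs [IsProbabilityMeasure P] {η : ℕ → Ω → ℝ}
    (hη : ∀ n, Measurable (η n)) (hη1 : ∀ n, eLpNorm (η n) 2 P ≤ 1) {c : ℕ → ℝ}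
    (hc : ∀ n, 0 ≤ c n) (hsum : Summable c) : ∀ᵐ ω ∂P, Summable fun n => c n * |η n ω| := by
  have h1 : ∫⁻ ω, ∑' n, ENNReal.ofReal (c n) * ‖η n ω‖ₑ ∂P ≠ ⊤ := by
    rw [lintegral_tsum fun n => ((hη n).enorm.const_mul _).aemeasurable]
    refine ne_top_of_le_ne_top hsum.tsum_ofReal_ne_top (ENNReal.tsum_le_tsum fun n => ?_)
    rw [lintegral_const_mul _ (hη n).enorm, ← eLpNorm_one_eq_lintegral_enorm]
    refine mul_le_of_le_one_right' ?_
    exact (eLpNorm_le_eLpNorm_of_exponent_le (by norm_num)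
      (hη n).aestronglyMeasurable).trans (hη1 n)
  filter_upwards [ae_lt_top (Measurable.tsum fun n => (hη n).enorm.const_mul _) h1]
    with ω hω
  have h2 := ENNReal.summable_toReal hω.ne
  refine h2.congr fun n => ?_
  rw [ENNReal.toReal_mul, ENNReal.toReal_ofReal (hc n), toReal_enorm, Real.norm_eq_abs]

lemma memLp_sum_range {η : ℕ → Ω → ℝ} (hη : ∀ n, MemLp (η n) 2 P) (c : ℕ → ℝ) (N : ℕ) :
    MemLp (fun ω => ∑ n ∈ Finset.range N, c n * η n ω) 2 P :=
  memLp_finsetSum _ fun n _ => (hη n).const_mul (c n)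

lemma toLp_sum_range {η : ℕ → Ω → ℝ} (hη : ∀ n, MemLp (η n) 2 P) (c : ℕ → ℝ) (N : ℕ) :
    (memLp_sum_range hη c N).toLp _ = ∑ n ∈ Finset.range N, c n • (hη n).toLp (η n) := by
  induction N with
  | zero =>
    simp only [Finset.range_zero, Finset.sum_empty]
    exact MemLp.toLp_zero _
  | succ N ih =>
    rw [Finset.sum_range_succ, ← ih, ← MemLp.toLp_const_smul, ← MemLp.toLp_add]
    refine (MemLp.toLp_eq_toLp_iff _ _).2 (ae_of_all _ fun ω => ?_)
    simp [Finset.sum_range_succ]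

lemma exists_tendsto_eLpNorm_sum {η : ℕ → Ω → ℝ} (hη : ∀ n, MemLp (η n) 2 P)
    (hη1 : ∀ n, eLpNorm (η n) 2 P ≤ 1) {c : ℕ → ℝ} (hc : Summable fun n => |c n|) :
    ∃ L : Ω → ℝ, MemLp L 2 P ∧
      Tendsto (fun N => eLpNorm (L - fun ω => ∑ n ∈ Finset.range N, c n * η n ω) 2 P)
        atTop (𝓝 0) := by
  let e : ℕ → Lp ℝ 2 P := fun n => c n • (hη n).toLp (η n)
  have he : Summable e := by
    refine Summable.of_norm_bounded hc fun n => ?_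
    rw [norm_smul, Real.norm_eq_abs, Lp.norm_toLp]
    refine mul_le_of_le_one_right (abs_nonneg _) ?_
    exact ENNReal.toReal_le_of_le_ofReal zero_le_one (by simpa using hη1 n)
  have hS := memLp_sum_range hη c
  have hSe : ∀ N, (hS N).toLp _ = ∑ n ∈ Finset.range N, e n := toLp_sum_range hη c
  refine ⟨(∑' n, e n : Lp ℝ 2 P), Lp.memLp _, ?_⟩
  have h1 := he.hasSum.tendsto_sum_nat
  simp_rw [← hSe] at h1
  have h2 := (Lp.tendsto_Lp_iff_tendsto_eLpNorm'' _ hS _ (Lp.memLp (∑' n, e n : Lp ℝ 2 P))).1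
    (by rwa [Lp.toLp_coeFn])
  simpa only [eLpNorm_sub_comm _ (((∑' n, e n : Lp ℝ 2 P)) : Ω → ℝ)] using h2

lemma ae_eq_of_tendsto_eLpNorm {X X' : Ω → ℝ} {S : ℕ → Ω → ℝ} (hX : MemLp X 2 P)
    (hX' : MemLp X' 2 P) (hS : ∀ n, MemLp (S n) 2 P)
    (h : Tendsto (fun n => eLpNorm (X - S n) 2 P) atTop (𝓝 0))
    (h' : Tendsto (fun n => eLpNorm (X' - S n) 2 P) atTop (𝓝 0)) : X =ᵐ[P] X' := by
  simp_rw [eLpNorm_sub_comm X] at h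
  simp_rw [eLpNorm_sub_comm X'] at h'
  exact tendstoInMeasure_ae_unique
    (tendstoInMeasure_of_tendsto_eLpNorm two_ne_zero (fun n => (hS n).1) hX.1 h)
    (tendstoInMeasure_of_tendsto_eLpNorm two_ne_zero (fun n => (hS n).1) hX'.1 h')

/-- A random power series with coefficients `d n * η n`, evaluated along a smooth function `u`
and multiplied by a smooth function `a`, has a version with smooth paths. -/
theorem exists_contDiff_version [IsProbabilityMeasure P] {η : ℕ → Ω → ℝ}
    (hη : ∀ n, Measurable (η n)) (hη1 : ∀ n, eLpNorm (η n) 2 P ≤ 1) {d r : ℕ → ℝ}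
    (hd : ∀ n, 0 ≤ d n) (hr : ∀ m, 0 ≤ r m) (hsum : ∀ m, Summable fun n => d n * r m ^ n)
    {a u : ℝ → ℝ} (ha : ContDiff ℝ (⊤ : ℕ∞) a) (hu : ContDiff ℝ (⊤ : ℕ∞) u)
    (hur : ∀ t, ∃ m, |u t| < r m) :
    ∃ Y : ℝ → Ω → ℝ, (∀ t, Measurable (Y t)) ∧ (∀ ω, ContDiff ℝ (⊤ : ℕ∞) fun t => Y t ω) ∧
      ∀ t, MemLp (Y t) 2 P ∧ Tendsto (fun N => eLpNorm (Y t -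
        fun ω => ∑ n ∈ Finset.range N, (a t * (d n * u t ^ n)) * η n ω) 2 P) atTop (𝓝 0) := by
  have hmem : ∀ n, MemLp (η n) 2 P := fun n =>
    ⟨(hη n).aestronglyMeasurable, (hη1 n).trans_lt ENNReal.one_lt_top⟩
  have hae : ∀ᵐ ω ∂P, ∀ m, Summable fun n => d n * r m ^ n * |η n ω| :=
    ae_all_iff.2 fun m => ae_summable_mul_abs hη hη1
      (fun n => mul_nonneg (hd n) (pow_nonneg (hr m) n)) (hsum m)
  -- Zeroing the coefficients off a measurable set of full measure, on which the series converges
  -- absolutely at all radii, makes every path smooth and keeps measurability.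
  obtain ⟨G, hGsub, hGm, hG⟩ : ∃ G, G ⊆ {ω | ∀ m, Summable fun n => d n * r m ^ n * |η n ω|} ∧
      MeasurableSet G ∧ ∀ᵐ ω ∂P, ω ∈ G := by
    obtain ⟨B, hB1, hB2, hB3⟩ := exists_measurable_superset_of_null hae
    refine ⟨Bᶜ, fun ω hω => ?_, hB2.compl, measure_eq_zero_iff_ae_notMem.1 hB3⟩
    by_contra hne
    exact hω (hB1 hne)
  let b : Ω → ℕ → ℝ := fun ω n => d n * G.indicator (η n) ω
  have hb : ∀ ω m, Summable fun n => |b ω n| * r m ^ n := by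
    intro ω m
    by_cases hω : ω ∈ G
    · refine (hGsub hω m).congr fun n => ?_
      simp only [b, indicator_of_mem hω, abs_mul, abs_of_nonneg (hd n)]
      ring
    · simp only [b, indicator_of_notMem hω, mul_zero, abs_zero, zero_mul]
      exact summable_zero
  have hbt : ∀ ω t, Summable fun n => b ω n * u t ^ n := by
    intro ω t
    obtain ⟨m, hm⟩ := hur t
    refine Summable.of_norm_bounded (hb ω m) fun n => ?_
    rw [norm_mul, norm_pow, Real.norm_eq_abs, Real.norm_eq_abs]
    gcongr
  refine ⟨fun t ω => a t * ∑' n, b ω n * u t ^ n, fun t => ?_, fun ω => ?_, fun t => ?_⟩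
  · refine Measurable.const_mul ?_ _
    refine measurable_of_tendsto_metrizable
      (f := fun N ω => ∑ n ∈ Finset.range N, b ω n * u t ^ n) (fun N => ?_)
      (tendsto_pi_nhds.2 fun ω => (hbt ω t).hasSum.tendsto_sum_nat)
    exact Finset.measurable_fun_sum _ fun n _ =>
      (((hη n).indicator hGm).const_mul _).mul_const _
  · refine ha.mul (contDiff_iff_contDiffAt.2 fun t => ?_)
    obtain ⟨m, hm⟩ := hur t
    exact (contDiffAt_tsum_pow (hb ω m) hm).comp t hu.contDiffAt
  · obtain ⟨m, hm⟩ := hur t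
    have hc : Summable fun n => |a t * (d n * u t ^ n)| := by
      refine ((hsum m).mul_left |a t|).of_nonneg_of_le (fun n => abs_nonneg _) fun n => ?_
      rw [abs_mul, abs_mul, abs_of_nonneg (hd n), abs_pow]
      have := hd n
      gcongr
    obtain ⟨L, hL, hlim⟩ := exists_tendsto_eLpNorm_sum hmem hη1 hc
    have hS := memLp_sum_range hmem fun n => a t * (d n * u t ^ n)
    have hLY : L =ᵐ[P] fun ω => a t * ∑' n, b ω n * u t ^ n := by
      have h1 : ∀ᵐ ω ∂P, Tendsto
          (fun N => ∑ n ∈ Finset.range N, a t * (d n * u t ^ n) * η n ω) atTop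
          (𝓝 (a t * ∑' n, b ω n * u t ^ n)) := by
        filter_upwards [hG] with ω hω
        refine ((hbt ω t).hasSum.tendsto_sum_nat.const_mul (a t)).congr fun N => ?_
        rw [Finset.mul_sum]
        refine Finset.sum_congr rfl fun n _ => ?_
        simp only [b, indicator_of_mem hω]
        ring
      have h2 := tendstoInMeasure_of_tendsto_ae (fun N => (hS N).1) h1
      simp_rw [eLpNorm_sub_comm L] at hlim
      exact tendstoInMeasure_ae_unique (tendstoInMeasure_of_tendsto_eLpNorm two_ne_zero
        (fun N => (hS N).1) hL.1 hlim) h2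
    refine ⟨(memLp_congr_ae hLY).1 hL, hlim.congr fun N => eLpNorm_congr_ae ?_⟩
    exact hLY.sub EventuallyEq.rfl

end PowerSeries

/-! ### Transfer between families with the same Gram matrix -/

section Gram

variable {E H T : Type*} [NormedAddCommGroup E] [InnerProductSpace ℝ E] [CompleteSpace E]
  [NormedAddCommGroup H] [InnerProductSpace ℝ H] [CompleteSpace H]

/-- Equal Gram matrices make `h t ↦ V t` isometric on linear combinations. It extends to the closed
span, and by orthogonal projection to the whole space. -/
lemma exists_continuousLinearMap_of_inner_eq (h : T → E) (V : T → H)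
    (hVh : ∀ s t, inner ℝ (V s) (V t) = inner ℝ (h s) (h t)) :
    ∃ U : E →L[ℝ] H, (∀ x, ‖U x‖ ≤ ‖x‖) ∧ ∀ t, U (h t) = V t := by
  let A := Finsupp.linearCombination ℝ h
  let B := Finsupp.linearCombination ℝ V
  have hAB : ∀ x, ‖B x‖ = ‖A x‖ := by
    intro x
    rw [← sq_eq_sq₀ (norm_nonneg _) (norm_nonneg _), ← real_inner_self_eq_norm_sq,
      ← real_inner_self_eq_norm_sq]
    simp only [A, B, Finsupp.linearCombination_apply, Finsupp.sum, sum_inner, inner_sum,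
      real_inner_smul_left, real_inner_smul_right, hVh]
  let K := A.range.topologicalClosure
  have : CompleteSpace K := A.range.isClosed_topologicalClosure.completeSpace_coe
  let e : (T →₀ ℝ) →ₗ[ℝ] K := A.codRestrict K fun x =>
    A.range.le_topologicalClosure (LinearMap.mem_range_self A x)
  have he : DenseRange e := by
    rw [DenseRange, Subtype.dense_iff]
    intro y hy
    have h1 : (Subtype.val '' range e : Set E) = A.range := by
      ext z
      simp [e]
    exact closure_mono h1.symm.subset hy
  have hnorm : ∀ x, ‖B x‖ ≤ 1 * ‖e x‖ := fun x => by
    rw [one_mul, hAB]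
    exact le_rfl
  let U := (B.extendOfNorm e).comp K.orthogonalProjectionOnto
  refine ⟨U, fun x => ?_, fun t => ?_⟩
  · have h1 := LinearMap.norm_extendOfNorm_apply_le he 1 hnorm (K.orthogonalProjectionOnto x)
    rw [one_mul] at h1
    exact h1.trans (K.norm_orthogonalProjectionOnto_apply_le x)
  · have h1 : (e (Finsupp.single t 1) : E) = h t := by simp [e, A]
    have h2 : K.orthogonalProjectionOnto (h t) = e (Finsupp.single t 1) := by
      rw [← h1]
      exact K.orthogonalProjectionOnto_mem_subspace_eq_self _
    change B.extendOfNorm e (K.orthogonalProjectionOnto (h t)) = V t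
    rw [h2, LinearMap.extendOfNorm_eq he ⟨1, hnorm⟩]
    simp [B]

/-- If the Gram matrix of `V` is `∑ n, f s n * f t n`, then `V t = ∑ n, f t n • e n` for some
vectors `e n` of norm at most one. -/
lemma exists_hasSum_of_inner_eq (f : T → ℕ → ℝ) (hf : ∀ t, Summable fun n => f t n ^ 2)
    (V : T → H) (hV : ∀ s t, inner ℝ (V s) (V t) = ∑' n, f s n * f t n) :
    ∃ e : ℕ → H, (∀ n, ‖e n‖ ≤ 1) ∧ ∀ t, HasSum (fun n => f t n • e n) (V t) := by
  classical
  have hmem : ∀ t, Memℓp (f t) 2 := fun t => memℓp_gen (by simpa using hf t)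
  let h : T → lp (fun _ : ℕ => ℝ) 2 := fun t => ⟨f t, hmem t⟩
  obtain ⟨U, hU, hUV⟩ := exists_continuousLinearMap_of_inner_eq h V fun s t => by
    rw [hV, lp.inner_eq_tsum]
    refine tsum_congr fun n => ?_
    simp [h, mul_comm]
  -- The vectors are the images of the standard basis of `ℓ²` under the map taking the sequence `f
  -- t` to `V t`.
  refine ⟨fun n => U (lp.single 2 n 1), fun n => (hU _).trans ?_, fun t => ?_⟩
  · rw [lp.norm_single (by norm_num), norm_one]
  · have h1 := (lp.hasSum_single (by norm_num) (h t)).mapL U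
    rw [hUV] at h1
    refine h1.congr_fun fun n => ?_
    rw [← map_smul]
    congr 1
    rw [← lp.single_smul]
    simp [h]

end Gram

/-! ### Smooth versions of the normalized Wiener integrals -/

section SmoothVersion

lemma exists_hasSum_one_div_one_sub_rpow {p : ℝ} (hp : 0 < p) : ∃ c : ℕ → ℝ, (∀ n, 0 ≤ c n) ∧
    ∀ x, |x| < 1 → HasSum (fun n => c n * x ^ n) (1 / (1 - x) ^ p) := by
  refine ⟨fun n => Ring.choose (p + n - 1) n, fun n => ?_, fun x hx => ?_⟩
  · have h1 : Ring.choose (p + n - 1) n = Ring.multichoose p n := by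
      rw [Ring.choose]
      congr 1
      ring
    have h2 := Ring.factorial_nsmul_multichoose_eq_ascPochhammer p n
    rw [Polynomial.ascPochhammer_smeval_eq_eval, nsmul_eq_mul] at h2
    have h3 := ascPochhammer_pos n p hp
    rw [← h2] at h3
    change 0 ≤ Ring.choose (p + n - 1) n
    rw [h1]
    exact (pos_of_mul_pos_right h3 (Nat.cast_nonneg _)).le
  · have h1 := (Real.one_div_one_sub_rpow_hasFPowerSeriesOnBall_zero p).hasSum (y := x) (by
      rw [Metric.mem_eball, edist_zero_right, enorm_eq_nnnorm, ENNReal.coe_lt_one_iff,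
        ← NNReal.coe_lt_coe]
      simpa using hx)
    simpa only [FormalMultilinearSeries.ofScalars_apply_eq, smul_eq_mul, zero_add] using h1

lemma abs_sinh_div_cosh_lt_one (x : ℝ) : |Real.sinh x / Real.cosh x| < 1 := by
  have hc := Real.cosh_pos x
  rw [abs_div, abs_of_pos hc, div_lt_one hc, abs_lt]
  have h1 := Real.cosh_add_sinh x
  have h2 := Real.cosh_sub_sinh x
  have h3 := Real.exp_pos x
  have h4 := Real.exp_pos (-x)
  constructor <;> linarith

/-- The addition formula for `cosh`. The last factor has a power series in the product of the two
hyperbolic tangents with nonnegative coefficients, which splits the kernel as `∑ f_n(s) f_n(t)`. -/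
lemma sechPow_sub (p s t : ℝ) : sechPow p (t - s) = sechPow p s * sechPow p t *
    (1 / (1 - Real.sinh (s / 2) / Real.cosh (s / 2) *
      (Real.sinh (t / 2) / Real.cosh (t / 2))) ^ p) := by
  have hs := Real.cosh_pos (s / 2)
  have ht := Real.cosh_pos (t / 2)
  have h0 : Real.cosh ((t - s) / 2) = Real.cosh (s / 2) * Real.cosh (t / 2) *
      (1 - Real.sinh (s / 2) / Real.cosh (s / 2) * (Real.sinh (t / 2) / Real.cosh (t / 2))) := by
    rw [sub_div, Real.cosh_sub]
    field_simp
  have h1 : 0 < 1 - Real.sinh (s / 2) / Real.cosh (s / 2) *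
      (Real.sinh (t / 2) / Real.cosh (t / 2)) := by
    have := Real.cosh_pos ((t - s) / 2)
    rw [h0] at this
    exact pos_of_mul_pos_right this (by positivity)
  have h2 : 1 / (1 - Real.sinh (s / 2) / Real.cosh (s / 2) *
      (Real.sinh (t / 2) / Real.cosh (t / 2))) ^ p = (1 / (1 - Real.sinh (s / 2) /
      Real.cosh (s / 2) * (Real.sinh (t / 2) / Real.cosh (t / 2)))) ^ p := by
    rw [Real.div_rpow zero_le_one h1.le, Real.one_rpow]
  rw [h2, sechPow, sechPow, sechPow, h0, ← Real.mul_rpow (by positivity) (by positivity),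
    ← Real.mul_rpow (by positivity) (by positivity)]
  congr 1
  field_simp

lemma summable_sqrt_mul_pow {c : ℕ → ℝ} (hc : ∀ n, 0 ≤ c n) {r : ℝ} (h0 : 0 ≤ r) (h1 : r < 1)
    (hsum : Summable fun n => c n * r ^ n) : Summable fun n => √(c n) * r ^ n := by
  refine ((summable_geometric_of_lt_one h0 h1).add hsum).of_nonneg_of_le
    (fun n => by positivity) fun n => ?_
  rw [← one_add_mul]
  refine mul_le_mul_of_nonneg_right ?_ (pow_nonneg h0 n)
  nlinarith [Real.sq_sqrt (hc n), sq_nonneg (√(c n) - 1)]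

variable {Ω : Type u} [MeasurableSpace Ω] {P : Measure Ω} {W : ℝ≥0 → Ω → ℝ}

/-- The version has to live on the given space. Transferring the Gram expansion to `L²(P)` yields
vectors `e n` of norm at most one, with `V t` equal to `sechPow (α + 1) t` times a power series in
`tanh (t / 2)`. The norm bound alone gives almost sure convergence; no independence of the `e n` is
needed. -/
theorem exists_contDiff_isNormalizedWienerProcess {α : ℝ} (hα : -1 < α)
    (hW : IsPreBrownianReal W P) : ∃ Y : ℝ → Ω → ℝ, IsNormalizedWienerProcess W P α Y ∧
      (∀ t, Measurable (Y t)) ∧ ∀ ω, ContDiff ℝ (⊤ : ℕ∞) fun t => Y t ω := by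
  have := hW.isGaussianProcess.isProbabilityMeasure
  have hp : 0 < α + 1 := by linarith
  choose X hX using fun t => exists_isWienerIntegral hW (memLp_gKernel hα t)
  let V : ℝ → Ω → ℝ := fun t ω => X t ω / √(∫ r in Ioi (0 : ℝ), gKernel α t r ^ 2)
  have hV : IsNormalizedWienerProcess W P α V := fun t => ⟨X t, hX t, EventuallyEq.rfl⟩
  have hVm : ∀ t, MemLp (V t) 2 P := fun t => (hV.centeredGaussian hα hW fun _ : Unit => t).memLp ()
  have hVV : ∀ s t, ∫ ω, V s ω * V t ω ∂P = sechPow (α + 1) (t - s) := fun s t =>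
    (hV.centeredGaussian hα hW ![s, t]).cov 0 1
  obtain ⟨c, hc, hcs⟩ := exists_hasSum_one_div_one_sub_rpow hp
  let u : ℝ → ℝ := fun t => Real.sinh (t / 2) / Real.cosh (t / 2)
  have hu1 : ∀ t, |u t| < 1 := fun t => abs_sinh_div_cosh_lt_one _
  let f : ℝ → ℕ → ℝ := fun t n => sechPow (α + 1) t * (√(c n) * u t ^ n)
  have hff : ∀ s t, HasSum (fun n => f s n * f t n) (sechPow (α + 1) (t - s)) := by
    intro s t
    rw [sechPow_sub]
    have h1 := (hcs (u s * u t) (by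
      rw [abs_mul]
      exact mul_lt_one_of_nonneg_of_lt_one_left (abs_nonneg _) (hu1 s) (hu1 t).le)).mul_left
      (sechPow (α + 1) s * sechPow (α + 1) t)
    refine h1.congr_fun fun n => ?_
    simp only [f]
    rw [mul_pow]
    linear_combination (sechPow (α + 1) s * sechPow (α + 1) t * u s ^ n * u t ^ n) *
      (Real.sq_sqrt (hc n))
  obtain ⟨e, he, heV⟩ := exists_hasSum_of_inner_eq f
    (fun t => by simpa only [sq] using (hff t t).summable) (fun t => (hVm t).toLp (V t))
    (fun s t => by rw [inner_toLp, hVV, (hff s t).tsum_eq])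
  have he1 : ∀ n, eLpNorm (e n) 2 P ≤ 1 := fun n => by
    have h1 := he n
    rw [Lp.norm_def] at h1
    rw [← ENNReal.ofReal_toReal (Lp.eLpNorm_ne_top (e n)), ← ENNReal.ofReal_one]
    exact ENNReal.ofReal_le_ofReal h1
  -- Radii increasing to one, so that they exhaust the range `(-1, 1)` of `u`.
  let r : ℕ → ℝ := fun m => 1 - 1 / (m + 1 : ℝ)
  have hr0 : ∀ m, 0 ≤ r m := fun m => by
    have : (0 : ℝ) ≤ m := m.cast_nonneg
    exact sub_nonneg.2 ((div_le_one (by positivity)).2 (by linarith))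
  have hr1 : ∀ m, r m < 1 := fun m => sub_lt_self _ (by positivity)
  have ha : ContDiff ℝ (⊤ : ℕ∞) fun t => sechPow (α + 1) t := by
    refine ContDiff.rpow_const_of_ne (contDiff_const.div
      (Real.contDiff_cosh.comp (contDiff_id.div_const 2)) fun t => (Real.cosh_pos _).ne') fun t => ?_
    have := Real.cosh_pos (t / 2)
    positivity
  have hu : ContDiff ℝ (⊤ : ℕ∞) u :=
    (Real.contDiff_sinh.comp (contDiff_id.div_const 2)).div
      (Real.contDiff_cosh.comp (contDiff_id.div_const 2)) fun t => (Real.cosh_pos _).ne'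
  obtain ⟨Y, hYm, hYs, hYL⟩ := exists_contDiff_version
    (fun n => (Lp.stronglyMeasurable (e n)).measurable) he1 (fun n => Real.sqrt_nonneg (c n)) hr0
    (fun m => summable_sqrt_mul_pow hc (hr0 m) (hr1 m)
      (hcs (r m) (by rw [abs_of_nonneg (hr0 m)]; exact hr1 m)).summable)
    ha hu (fun t => by
      obtain ⟨m, hm⟩ := exists_nat_one_div_lt (sub_pos.2 (hu1 t))
      exact ⟨m, by simp only [r]; linarith⟩)
  refine ⟨Y, fun t => ⟨X t, hX t, ?_⟩, hYm, hYs⟩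
  have hem : ∀ n, MemLp (e n) 2 P := fun n => Lp.memLp (e n)
  refine ae_eq_of_tendsto_eLpNorm (hYL t).1 (hVm t) (memLp_sum_range hem (f t)) (hYL t).2 ?_
  have h1 := (heV t).tendsto_sum_nat
  have h2 : ∀ N, (memLp_sum_range hem (f t) N).toLp _ = ∑ n ∈ Finset.range N, f t n • e n := by
    intro N
    rw [toLp_sum_range hem]
    simp_rw [Lp.toLp_coeFn]
  simp_rw [← h2] at h1
  have h3 := (Lp.tendsto_Lp_iff_tendsto_eLpNorm'' _ (memLp_sum_range hem (f t)) _ (hVm t)).1 h1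
  simpa only [eLpNorm_sub_comm _ (V t)] using h3

end SmoothVersion

/-! ### The process with Gaussian covariance -/

section GaussianCovariance

lemma summable_pow_div_sqrt_factorial (x : ℝ) (hx : 0 ≤ x) :
    Summable fun n : ℕ => 1 / √(n.factorial : ℝ) * x ^ n := by
  -- The term is a product `a b` with `a = (2x)^n / √n!` and `b = 2^{-n}`, bounded by `a² + b²`.
  refine ((Real.summable_pow_div_factorial ((2 * x) ^ 2)).add
    (summable_geometric_of_lt_one (r := (1 / 4 : ℝ)) (by norm_num) (by norm_num))).of_nonneg_of_le
    (fun n => by positivity) fun n => ?_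
  have hn : (0 : ℝ) < n.factorial := by exact_mod_cast n.factorial_pos
  set a := (2 * x) ^ n / √(n.factorial : ℝ)
  set b := (1 / 2 : ℝ) ^ n
  have h1 : 1 / √(n.factorial : ℝ) * x ^ n = a * b := by
    simp only [a, b]
    rw [mul_pow, one_div_pow]
    field_simp
  have h2 : ((2 * x) ^ 2) ^ n / n.factorial = a ^ 2 := by
    simp only [a]
    rw [div_pow, Real.sq_sqrt hn.le, ← pow_mul, ← pow_mul, mul_comm 2 n]
  have h3 : (1 / 4 : ℝ) ^ n = b ^ 2 := by
    simp only [b]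
    rw [← pow_mul, mul_comm, pow_mul]
    norm_num
  rw [h1, h2, h3]
  nlinarith [sq_nonneg (a - b), sq_nonneg a, sq_nonneg b]

/-- Factoring `exp (-(t-s)²/8) = exp (-s²/8) exp (-t²/8) ∑ (s t / 4)^n / n!` suggests the series
`exp (-t²/8) ∑ ξ_n (t/2)^n / √n!` with independent standard Gaussian `ξ_n`. -/
theorem exists_isStationaryGaussian_gaussCov :
    ∃ (Ω : Type u) (_ : MeasurableSpace Ω) (P : Measure Ω) (Z : ℝ≥0 → Ω → ℝ),
      IsStationaryGaussian Z P (fun s t => Real.exp (-((t : ℝ) - s) ^ 2 / 8)) ∧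
      ∀ ω, Continuous fun t => Z t ω := by
  obtain ⟨Ω, _, P, ξ, h⟩ := exists_isStdGaussianFamily.{u}
  have := h.indep.isProbabilityMeasure
  have hξ1 : ∀ n, eLpNorm (ξ n) 2 P ≤ 1 := fun n => by
    have h1 : ‖(h.memLp n).toLp (ξ n)‖ ^ 2 = 1 := by rw [norm_toLp_sq, h.integral_sq]
    have h2 : ‖(h.memLp n).toLp (ξ n)‖ = 1 := by
      exact (pow_eq_one_iff_of_nonneg (norm_nonneg _) two_ne_zero).1 h1
    rw [Lp.norm_toLp] at h2
    exact ((ENNReal.toReal_eq_one_iff _).1 h2).le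
  let a : ℝ → ℝ := fun t => Real.exp (-t ^ 2 / 8)
  let u : ℝ → ℝ := fun t => t / 2
  let d : ℕ → ℝ := fun n => 1 / √(n.factorial : ℝ)
  obtain ⟨Y, -, hYs, hYL⟩ := exists_contDiff_version (a := a) (u := u) h.measurable hξ1 (d := d)
    (r := fun m => m) (fun n => by positivity) (fun m => m.cast_nonneg)
    (fun m => summable_pow_div_sqrt_factorial _ m.cast_nonneg)
    (Real.contDiff_exp.comp (((contDiff_id.pow 2).neg).div_const 8)) (contDiff_id.div_const 2)
    (fun t => exists_nat_gt _)
  have hS : ∀ {ι : Type} [Fintype ι] (t : ι → ℝ) (N : ℕ), CenteredGaussian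
      (fun i ω => ∑ n ∈ Finset.range N, (a (t i) * (d n * u (t i) ^ n)) * ξ n ω) P
      (Matrix.of fun i j => ∑ n ∈ Finset.range N,
        (a (t i) * (d n * u (t i) ^ n)) * (a (t j) * (d n * u (t j) ^ n))) := by
    intro ι _ t N
    have h1 := (h.centeredGaussian (e := fun n : Fin N => (n : ℕ)) Fin.val_injective).linear
      (Matrix.of fun (i : ι) (n : Fin N) => a (t i) * (d n * u (t i) ^ (n : ℕ)))
    convert h1 using 1
    · funext i ω
      rw [Finset.sum_range]
      rfl
    · ext i j
      rw [Matrix.mul_one, Matrix.mul_apply, Matrix.of_apply, Finset.sum_range]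
      rfl
  have hcov : ∀ s t, ∫ ω, Y s ω * Y t ω ∂P = Real.exp (-(t - s) ^ 2 / 8) := by
    intro s t
    have h1 := fun N => (hS ![s, t] N).cov 0 1
    have h2 := tendsto_integral_mul_of_eLpNorm (fun N => (hS ![s, t] N).memLp 0)
      (fun N => (hS ![s, t] N).memLp 1) (hYL s).1 (hYL t).1 (hYL s).2 (hYL t).2
    simp_rw [h1] at h2
    refine tendsto_nhds_unique h2 ?_
    have h3 := (NormedSpace.expSeries_div_hasSum_exp (s * t / 4)).mul_left (a s * a t)
    have h4 : a s * a t * NormedSpace.exp (s * t / 4) = Real.exp (-(t - s) ^ 2 / 8) := by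
      rw [← Real.exp_eq_exp_ℝ, ← Real.exp_add, ← Real.exp_add]
      congr 1
      ring
    rw [h4] at h3
    refine h3.tendsto_sum_nat.congr fun N => Finset.sum_congr rfl fun n _ => ?_
    have hn : (0 : ℝ) < n.factorial := by exact_mod_cast n.factorial_pos
    have h5 : d n * d n = 1 / n.factorial := by
      simp only [d]
      rw [← sq, one_div_pow, Real.sq_sqrt hn.le]
    have h6 : (s * t / 4) ^ n = u s ^ n * u t ^ n := by
      simp only [u]
      rw [← mul_pow]
      congr 1
      ring
    change a s * a t * ((s * t / 4) ^ n / n.factorial) =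
      a s * (d n * u s ^ n) * (a t * (d n * u t ^ n))
    rw [h6]
    linear_combination -(a s * a t * u s ^ n * u t ^ n) * h5
  refine ⟨Ω, inferInstance, P, fun t => Y t, ?_, fun ω => (hYs ω).continuous.comp
    NNReal.continuous_coe⟩
  refine isStationaryGaussian_of_centeredGaussian (fun h s t => ?_) fun {ι} _ t => ?_
  · push_cast
    rw [add_sub_add_right_eq_sub]
  · have h1 := CenteredGaussian.of_tendsto_eLpNorm (X := fun i => Y (t i))
      (fun i => (hYL (t i)).1) (hS fun i => (t i : ℝ)) fun i => (hYL (t i)).2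
    simp_rw [hcov] at h1
    exact h1

end GaussianCovariance

/-! ### Assembly of the main theorem -/

theorem lemma0 :
    ∃ (b : ℝ → ℝ) (bhat : ℝ),
      -- the processes `Y^{(α)}` and their exponents `b α`
      (∀ α : ℝ, -1 < α →
        ∀ (Ω : Type u) [MeasurableSpace Ω] (P : Measure Ω) (W : ℝ≥0 → Ω → ℝ),
          IsBrownianReal W P →
          (∃ Y : ℝ → Ω → ℝ, IsNormalizedWienerProcess W P α Y ∧ (∀ t, Measurable (Y t)) ∧
            ∀ ω, ContDiff ℝ (⊤ : ℕ∞) (fun t => Y t ω)) ∧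
          ∀ Y : ℝ → Ω → ℝ, IsNormalizedWienerProcess W P α Y →
            IsStationaryGaussian Y P (fun s t => sechCov s t ^ (α + 1)) ∧
            ((∀ᵐ ω ∂P, Continuous fun t => Y t ω) →
              IsPersistenceExponent P (fun t : ℝ≥0 => Y t) (b α))) ∧
      -- the process with covariance `exp (-(t - s)² / 8)` and its exponent `bhat`
      (∃ (Ω : Type u) (_ : MeasurableSpace Ω) (P : Measure Ω) (Z : ℝ≥0 → Ω → ℝ),
        IsStationaryGaussian Z P (fun s t => Real.exp (-((t : ℝ) - s) ^ 2 / 8)) ∧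
        ∀ ω, Continuous fun t => Z t ω) ∧
      (∀ (Ω : Type u) [MeasurableSpace Ω] (P : Measure Ω) (Z : ℝ≥0 → Ω → ℝ),
        IsStationaryGaussian Z P (fun s t => Real.exp (-((t : ℝ) - s) ^ 2 / 8)) →
        (∀ᵐ ω ∂P, Continuous fun t => Z t ω) →
        IsPersistenceExponent P Z bhat) ∧
      -- behaviour of `b α` as `α ↓ -1` and as `α ↑ ∞`
      AntitoneOn (fun α => (α + 1) ^ (-1 : ℝ) * b α) (Ioi (-1)) ∧
      Tendsto (fun α => (α + 1) ^ (-1 : ℝ) * b α) (𝓝[>] (-1)) (𝓝 (1 / 2)) ∧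
      MonotoneOn (fun α => (α + 1) ^ (-(1 / 2) : ℝ) * b α) (Ioi (-1)) ∧
      Tendsto (fun α => (α + 1) ^ (-(1 / 2) : ℝ) * b α) atTop (𝓝 bhat) := by
  have hshift : Tendsto (fun α : ℝ => α + 1) (𝓝[>] (-1)) (𝓝[>] 0) := by
    refine tendsto_nhdsWithin_iff.2 ⟨?_, ?_⟩
    · have h : Tendsto (fun α : ℝ => α + 1) (𝓝 (-1)) (𝓝 (-1 + 1)) := tendsto_id.add_const 1
      rw [neg_add_cancel] at h
      exact h.mono_left nhdsWithin_le_nhds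
    · filter_upwards [self_mem_nhdsWithin] with α hα
      rw [mem_Ioi] at hα ⊢
      linarith
  have hmem : ∀ {α : ℝ}, α ∈ Ioi (-1 : ℝ) → α + 1 ∈ Ioi (0 : ℝ) := fun {α} hα => by
    rw [mem_Ioi] at hα ⊢
    linarith
  -- Both exponents are read off from covariances, so they depend neither on the probability space
  -- nor on the version of the process.
  refine ⟨fun α => expo (sechPow (α + 1)), expo gaussCov, ?_, exists_isStationaryGaussian_gaussCov,
    ?_, ?_, ?_, ?_, ?_⟩
  · intro α hα Ω _ P W hW
    refine ⟨exists_contDiff_isNormalizedWienerProcess hα hW.toIsPreBrownianReal,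
      fun Y hY => ?_⟩
    have hst : IsStationaryGaussian Y P (fun s t => sechCov s t ^ (α + 1)) :=
      isStationaryGaussian_of_centeredGaussian
        (fun h s t => by simp only [sechCov, add_sub_add_right_eq_sub])
        fun t => hY.centeredGaussian hα hW.toIsPreBrownianReal t
    refine ⟨hst, fun hcont => ?_⟩
    exact isPersistenceExponent_expo (hst.gaussian.comp_right fun t : ℝ≥0 => (t : ℝ))
      (fun t => hst.centered t) (fun s t => hst.cov_eq s t)
      (admissible_sechPow (by linarith)) (hcont.mono fun ω h => h.comp NNReal.continuous_coe)
  · intro Ω _ P Z hZ hcont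
    exact isPersistenceExponent_expo hZ.gaussian hZ.centered hZ.cov_eq admissible_gaussCov hcont
  · exact fun α hα β hβ hαβ => antitoneOn_expo_sechPow (hmem hα) (hmem hβ) (by linarith)
  · exact tendsto_expo_sechPow_zero.comp hshift
  · exact fun α hα β hβ hαβ => monotoneOn_expo_sechPow (hmem hα) (hmem hβ) (by linarith)
  · exact tendsto_expo_sechPow_atTop.comp (tendsto_atTop_add_const_right _ 1 tendsto_id)
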